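/- **Model.** The asymmetric external memory (AEM) machine has a primary memory holding at most $S$ records and an unbounded secondary memory divided into blocks of at most $B$ records. A *read* copies a block from secondary to primary memory, a *write* copies at most $B$ records from primary memory to a block of secondary memory; computation within primary memory is free. Records are indivisible and are accessed only through comparisons of their keys; memory sizes are measured in records (addresses, counters and random numbers are not charged). Programs may draw uniform random integers. **Algorithm.** Let $k,M,B,n_0$ be positive integers with $B\mid M$ and $kM/B\ge 2$. The $kM/B$-way sample sort with oversampling constant $a$ sorts an array of $n_0$ records with distinct keys as follows. A (sub)problem of size $n\le kM$ is sorted by a selection sort that scans its input $\lceil n/M\rceil$ times and outputs the next $M$ records in sorted order in each scan. For $n>kM$ let $l=\lceil n/(kM)\rceil$ if $n\le k^2M^2/B$, and $l=kM/B$ otherwise. Take a sample of $m=a\,l\,\lceil\log_2 n_0\rceil$ independent uniformly random records of the subproblem (all of its records if $n\le m$, with then $m$ replaced by $n$), sort it by a binary mergesort with in-memory base case, and take as splitters the records at positions $\lfloor im/l\rfloor$, $1\le i\le l-1$, of the sorted sample. Partition the subproblem into the $l$ buckets defined by the splitters in $k$ rounds: each round treats the next $M/B$ splitters (keeping also the last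 splitter of the previous round), scans the whole subproblem, keeps one partially filled block in primary memory for each of the corresponding at most $M/B$ buckets, writes out a block whenever it is full, and skips the records of other buckets. Recurse on the buckets (the depth of recursion is cut off at $n_0$, where selection sort is used), and finally copy the sorted sequence to consecutive blocks. **Theorem.** For every real $c$ there is $a_0$ such that for every integer $a\ge a_0$ there is a constant $C$, depending only on $c$ and $a$, with the following property. For all integers $k,M,B,n$ with $B\ge 1$, $B\mid M$, $kM/B\ge 2$ and $n>B$, and every input array of $n$ records with distinct keys, the $kM/B$-way sample sort with oversampling constant $a$, run on the AEM with primary memory of size $M+B+M/B$, always stays within its primary memory and ends with the sorted input in an array in secondary memory; and with probability at least $1-n^{-c}$ its numbers $R$ of reads and $W$ of writes satisfy $$R\le C\,\frac{kn}{B}\left\lceil\log_{kM/B}\frac nB\right\rceil,\qquad W\le C\,\frac nB\left\lceil\log_{kM/B}\frac nB\right\rceil .$$ -/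

import Mathlib

/-!
# A randomized sample sort in the asymmetric external-memory (AEM) model
-/

namespace AEM

/-! ## The machine model

The machine has an unbounded secondary memory, divided into blocks of at most `B` records, and a
primary memory that holds at most `S` records. Records are indivisible, and a program learns about
them only through comparisons of keys. Computation inside the primary memory is free; the two
transfer instructions are counted separately as reads and writes. The capacity is measured in
records; addresses, counters and random numbers belong to the control of the program. -/

/-- Programs, as decision trees that return a value of type `β`. They do not mention the records:
a record in primary memory is referred to by its current position there. -/
inductive Prog (β : Type) : Type
  /-- Halt with result `b`. -/
  | done (b : β) : Prog β
  /-- Copy block `a` of secondary memory to the end of primary memory; the program is told how many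
  records the block holds. -/
  | read (a : ℕ) (next : ℕ → Prog β) : Prog β
  /-- Copy the `c` records at positions `i, …, i + c - 1` of primary memory to block `a`. -/
  | write (a i c : ℕ) (next : Prog β) : Prog β
  /-- Rearrange primary memory: it now holds the records that were at the positions `ids`, in this
  order (so records can be moved, duplicated and dropped). -/
  | keep (ids : List ℕ) (next : Prog β) : Prog β
  /-- Compare the keys of the records in primary memory: `le i j` says whether the key at position
  `i` is at most the key at position `j`. -/
  | compare (next : (ℕ → ℕ → Bool) → Prog β) : Prog β
  /-- Draw a uniformly random element of `{0, …, N}`. -/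
  | random (N : ℕ) (next : ℕ → Prog β) : Prog β

/-- Sequential composition. -/
def Prog.bind {β γ : Type} : Prog β → (β → Prog γ) → Prog γ
  | .done b, f => f b
  | .read a next, f => .read a fun c => (next c).bind f
  | .write a i c next, f => .write a i c (next.bind f)
  | .keep ids next, f => .keep ids (next.bind f)
  | .compare next, f => .compare fun le => (next le).bind f
  | .random N next, f => .random N fun i => (next i).bind f

instance : Monad Prog where
  pure := Prog.done
  bind := Prog.bind

/-- A configuration: the contents of the two memories, and the transfers made so far. -/
structure State (ρ : Type*) where
  mem : List ρ
  ext : ℕ → List ρ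
  reads : ℕ
  writes : ℕ

/-- The records of `l` at the positions `ids`. -/
def pick {ρ : Type*} (l : List ρ) (ids : List ℕ) : List ρ :=
  ids.filterMap fun i => l[i]?

/-- The outcome of comparing the keys at positions `i` and `j` of `l`. -/
def leAt {ρ κ : Type*} [LinearOrder κ] (key : ρ → κ) (l : List ρ) (i j : ℕ) : Bool :=
  match l[i]?, l[j]? with
  | some x, some y => decide (key x ≤ key y)
  | _, _ => false

/-- The distribution of the outcome of a program on a machine with block size `B` and primary
memory of size `S`. The outcome `none` means that the program has tried to hold more than `S`
records in primary memory, or to write more than `B` records into one block. -/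
noncomputable def exec {ρ κ : Type*} [LinearOrder κ] (key : ρ → κ) (B S : ℕ) {β : Type} :
    Prog β → State ρ → PMF (Option (β × State ρ))
  | .done b, s => PMF.pure (some (b, s))
  | .read a next, s =>
      if s.mem.length + (s.ext a).length ≤ S then
        exec key B S (next (s.ext a).length)
          { s with mem := s.mem ++ s.ext a, reads := s.reads + 1 }
      else PMF.pure none
  | .write a i c next, s =>
      if c ≤ B then
        exec key B S next
          { s with
            ext := Function.update s.ext a ((s.mem.drop i).take c)
            writes := s.writes + 1 }
      else PMF.pure none
  | .keep ids next, s =>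
      if ids.length ≤ S then exec key B S next { s with mem := pick s.mem ids }
      else PMF.pure none
  | .compare next, s => exec key B S (next (leAt key s.mem)) s
  | .random N next, s =>
      (PMF.uniformOfFintype (Fin (N + 1))).bind fun i => exec key B S (next i) s

/-- The list `l` is stored as an array: in consecutive blocks from address `start` on, all of them
full except possibly the last one. -/
def StoredAt {ρ : Type*} (B : ℕ) (ext : ℕ → List ρ) (start : ℕ) (l : List ρ) : Prop :=
  ∀ i, i * B < l.length → ext (start + i) = (l.drop (i * B)).take B

/-- The initial configuration: the input is an array at address `0`, primary memory and the rest of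
secondary memory are empty, and nothing has been transferred. -/
def initial {ρ : Type*} (B : ℕ) (input : List ρ) : State ρ where
  mem := []
  ext := fun i => (input.drop (i * B)).take B
  reads := 0
  writes := 0

/-! ## Program fragments

A fragment threads the address from which on the secondary memory is unused. An array is handled
through the list of the addresses of its blocks. -/

/-- Program fragments. -/
abbrev Code : Type → Type := StateT ℕ Prog

/-- Read block `a`, returning the number of its records. -/
def readBlock (a : ℕ) : Code ℕ := fun f => .read a fun c => .done (c, f)

/-- Write the records at positions `i, …, i + c - 1` to an unused block, returning its address. -/
def store (i c : ℕ) : Code ℕ := fun f => .write f i c (.done (f, f + 1))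

/-- Rearrange primary memory. -/
def keepMem (ids : List ℕ) : Code Unit := fun f => .keep ids (.done ((), f))

/-- Compare the keys in primary memory. -/
def comparisons : Code (ℕ → ℕ → Bool) := fun f => .compare fun le => .done (le, f)

/-- Draw a uniform element of `{0, …, N}`. -/
def randomNat (N : ℕ) : Code ℕ := fun f => .random N fun i => .done (i, f)

/-- `⌈n / d⌉`. -/
def ceilDiv (n d : ℕ) : ℕ := (n + d - 1) / d

/-- Write the records at positions `i, …, i + q - 1` to `⌈q / B⌉` unused blocks. -/
def storeSegment (B i q : ℕ) : Code (List ℕ) :=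
  (List.range (ceilDiv q B)).mapM' fun t => store (i + t * B) (min B (q - t * B))

/-! ### Selection sort -/

/-- One scan of the selection sort. Primary memory holds `h` records (`h = 1`: the largest record
that has been output; `h = 0`: nothing has been output yet), followed by a queue of `q` records. The
scan collects the `M` smallest records that are larger than the former; it returns their number. -/
def selectScan (M h : ℕ) : ℕ → List ℕ → Code ℕ
  | q, [] => pure q
  | q, a :: as => do
      let cnt ← readBlock a
      let le ← comparisons
      let cand := (List.range' h (q + cnt)).filter fun p => h == 0 || !(le p 0)
      let ids := (cand.mergeSort le).take M
      keepMem (List.range h ++ ids)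
      selectScan M h ids.length as

/-- The given number of phases of the selection sort, each of which outputs the next `M` records in
sorted order. -/
def selectPhases (M B : ℕ) (as : List ℕ) : ℕ → ℕ → Code (List ℕ)
  | 0, _ => do
      keepMem []
      pure []
  | p + 1, h => do
      let q ← selectScan M h 0 as
      let out ← storeSegment B h q
      keepMem [h + q - 1]
      let rest ← selectPhases M B as p 1
      pure (out ++ rest)

/-- Selection sort of `n` records with distinct keys in `⌈n / M⌉` phases. -/
def selectionSort (M B : ℕ) (as : List ℕ) (n : ℕ) : Code (List ℕ) :=
  selectPhases M B as (ceilDiv n M) 0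

/-! ### Binary mergesort -/

/-- Read block `a`, ignore its first `d` records, and keep the `B` smallest records in sorted order.
The list `tags` says from which of two runs each record in primary memory comes. -/
def absorb (B d : ℕ) (tag : Bool) (tags : List Bool) (a : ℕ) : Code (List Bool) := do
  let cnt ← readBlock a
  let le ← comparisons
  let len := tags.length
  let ids := ((List.range len ++ List.range' (len + d) (cnt - d)).mergeSort le).take B
  keepMem ids
  pure (ids.map fun i => tags.getD i tag)

/-- Absorb the (at most two) blocks of the run `as` that contain its records at positions
`c, …, c + B - 1`. -/
def absorbRun (B c : ℕ) (tag : Bool) (as : List ℕ) (tags : List Bool) : Code (List Bool) :=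
  match as.drop (c / B) with
  | [] => pure tags
  | [a] => absorb B (c % B) tag tags a
  | a :: a' :: _ => do
      let tags' ← absorb B (c % B) tag tags a
      absorb B 0 tag tags' a'

/-- Output the next blocks (their number is the first argument) of the merge of the sorted runs `xs`
and `ys`, of which `c₁` and `c₂` records have been output already. -/
def mergeRuns (B : ℕ) (xs ys : List ℕ) : ℕ → ℕ → ℕ → Code (List ℕ)
  | 0, _, _ => pure []
  | t + 1, c₁, c₂ => do
      let tags₁ ← absorbRun B c₁ true xs []
      let tags ← absorbRun B c₂ false ys tags₁
      let a ← store 0 tags.length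
      keepMem []
      let rest ← mergeRuns B xs ys t (c₁ + tags.count true) (c₂ + tags.count false)
      pure (a :: rest)

/-- Binary mergesort of an array of `m` records; runs of at most `M / B` blocks are sorted in
primary memory. The first argument bounds the depth of the recursion; the number of blocks is
enough. -/
def ramMergeSort (M B : ℕ) : ℕ → List ℕ → ℕ → Code (List ℕ)
  | 0, as, _ => selectPhases M B as 1 0
  | fuel + 1, as, m =>
      if as.length ≤ M / B then selectPhases M B as 1 0
      else do
        let h := as.length / 2
        let xs ← ramMergeSort M B fuel (as.take h) (h * B)
        let ys ← ramMergeSort M B fuel (as.drop h) (m - h * B)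
        mergeRuns B xs ys (ceilDiv m B) 0 0

/-! ### Copying selected records -/

/-- Primary memory holds an output buffer of `q < B` records and a block of `cnt` records. Append
copies of the records at the given positions of the block to the buffer, writing the buffer out
whenever it is full. Returns the size of the buffer, and the blocks written so far. -/
def gatherBlock (B cnt : ℕ) : List ℕ → ℕ → List ℕ → Code (ℕ × List ℕ)
  | [], q, out => do
      keepMem (List.range q)
      pure (q, out)
  | p :: ps, q, out => do
      keepMem (List.range q ++ [q + p] ++ List.range' q cnt)
      if q + 1 = B then do
        let a ← store 0 B
        keepMem (List.range' B cnt)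
        gatherBlock B cnt ps 0 (out ++ [a])
      else gatherBlock B cnt ps (q + 1) out

/-- Scan the blocks `as`, numbered from `b` on, copying the records of block number `b` at the
positions `sel b cnt`, where `cnt` is the number of its records. -/
def gatherLoop (B : ℕ) (sel : ℕ → ℕ → List ℕ) : List ℕ → ℕ → ℕ → List ℕ → Code (List ℕ)
  | [], _, q, out =>
      if q = 0 then pure out
      else do
        let a ← store 0 q
        keepMem []
        pure (out ++ [a])
  | a :: as, b, q, out => do
      let cnt ← readBlock a
      let r ← gatherBlock B cnt (sel b cnt) q out
      gatherLoop B sel as (b + 1) r.1 r.2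

/-- Copy the records at the positions `pos` (in increasing order) of an array to a new array. -/
def gatherPositions (B : ℕ) (as pos : List ℕ) : Code (List ℕ) :=
  gatherLoop B (fun b _ => (pos.filter fun p => p / B == b).map fun p => p % B) as 0 0 []

/-- Copy all records in the blocks `as`, which need not be full, to a new array. -/
def compact (B : ℕ) (as : List ℕ) : Code (List ℕ) :=
  gatherLoop B (fun _ cnt => List.range cnt) as 0 0 []

/-! ### Choosing the splitters -/

/-- `m` independent uniform elements of `{0, …, N}`. -/
def randomList (N : ℕ) : ℕ → Code (List ℕ)
  | 0 => pure []
  | m + 1 => do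
      let i ← randomNat N
      let rest ← randomList N m
      pure (i :: rest)

/-- The positions of the sample in increasing order: `m` independent uniform positions of an array
of length `n`, or all positions if `n ≤ m`. -/
def samplePositions (n m : ℕ) : Code (List ℕ) :=
  if n ≤ m then pure (List.range n)
  else do
    let pos ← randomList (n - 1) m
    pure (pos.mergeSort fun i j => decide (i ≤ j))

/-- Choose `l - 1` splitters for an array of `n` records: take a sample of size `m`, sort it, and
select from it the records at the positions `m / l, 2 m / l, …, (l - 1) m / l`. -/
def chooseSplitters (M B : ℕ) (as : List ℕ) (n l m : ℕ) : Code (List ℕ) := do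
  let pos ← samplePositions n m
  let smp ← gatherPositions B as pos
  let srt ← ramMergeSort M B smp.length smp pos.length
  gatherPositions B srt ((List.range' 1 (l - 1)).map fun i => i * pos.length / l)

/-! ### Partitioning -/

/-- Load the records at the positions `lo, …, hi - 1` of an array into primary memory, which holds
`h` records already; `b` is the number of the first block in the list. Returns the number of records
then in primary memory. -/
def loadRange (B lo hi : ℕ) : List ℕ → ℕ → ℕ → Code ℕ
  | [], _, h => pure h
  | a :: as, b, h => do
      let cnt ← readBlock a
      let ids := (List.range cnt).filter fun i => decide (lo ≤ b * B + i ∧ b * B + i < hi)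
      keepMem (List.range h ++ ids.map fun i => h + i)
      loadRange B lo hi as (b + 1) (h + ids.length)

/-- Primary memory holds `h` splitters, followed by buffered records, whose buckets are listed in
`tags`. For each of the buckets `js` with at least `need` buffered records, write (at most `B` of)
its records to a new block. The entries `(j, a, c)` of `log` record that block `a` holds `c` records
of bucket `j`. -/
def flush (B need h : ℕ) :
    List ℕ → List ℕ → List (ℕ × ℕ × ℕ) → Code (List ℕ × List (ℕ × ℕ × ℕ))
  | [], tags, log => pure (tags, log)
  | j :: js, tags, log =>
      if need ≤ tags.count j then do
        let sel := ((List.range tags.length).filter fun i => tags[i]? == some j).take B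
        let rest := (List.range tags.length).filter fun i => !(sel.contains i)
        keepMem (List.range h ++ (sel ++ rest).map fun i => h + i)
        let a ← store h sel.length
        keepMem (List.range h ++ List.range' (h + sel.length) rest.length)
        flush B need h js (rest.map fun i => tags.getD i 0) (log ++ [(j, a, sel.length)])
      else flush B need h js tags log

/-- Scan the blocks `as`, distributing to their buckets the records that belong to one of the
buckets `j₀, …, j₁ - 1` and skipping the others; the `h` splitters bounding these buckets are in
primary memory. A block of a bucket is written out as soon as it is full. -/
def bucketScan (B j₀ j₁ h : ℕ) :
    List ℕ → List ℕ → List (ℕ × ℕ × ℕ) → Code (List ℕ × List (ℕ × ℕ × ℕ))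
  | [], tags, log => pure (tags, log)
  | a :: as, tags, log => do
      let cnt ← readBlock a
      let le ← comparisons
      let start := h + tags.length
      let bucket := fun i => (j₀ - 1) + (List.range h).countP fun t => le t (start + i)
      let new := (List.range cnt).filter fun i => decide (j₀ ≤ bucket i ∧ bucket i < j₁)
      keepMem (List.range start ++ new.map fun i => start + i)
      let r ← flush B B h (List.range' j₀ (j₁ - j₀)) (tags ++ new.map bucket) log
      bucketScan B j₀ j₁ h as r.1 r.2

/-- One round of the partitioning: the splitters that bound the buckets `j₀, …, j₁ - 1` are loaded,
the whole input `as` is scanned, and the records of these buckets are written out. Bucket `j`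
consists of the records `x` with `s_j ≤ x < s_{j+1}`, where `s_1 ≤ … ≤ s_{l-1}` are the splitters,
`s_0 = -∞` and `s_l = ∞`. -/
def partitionRound (B : ℕ) (splitters as : List ℕ) (j₀ j₁ : ℕ) : Code (List (ℕ × ℕ × ℕ)) := do
  let h ← loadRange B (j₀ - 1) j₁ splitters 0 0
  let r ← bucketScan B j₀ j₁ h as [] []
  let r' ← flush B 1 h (List.range' j₀ (j₁ - j₀)) r.1 r.2
  keepMem []
  pure r'.2

/-- Partition an array into `l` buckets in `k` rounds, each of which treats `M / B` buckets (so
their `M / B` upper bounding splitters, besides the last splitter of the round before). -/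
def partition (k M B : ℕ) (splitters as : List ℕ) (l : ℕ) : Code (List (ℕ × ℕ × ℕ)) := do
  let logs ← (List.range k).mapM' fun r =>
    partitionRound B splitters as (r * (M / B)) (min ((r + 1) * (M / B)) l)
  pure logs.flatten

/-- The blocks of bucket `j`. -/
def bucketBlocks (log : List (ℕ × ℕ × ℕ)) (j : ℕ) : List ℕ :=
  (log.filter fun e => e.1 == j).map fun e => e.2.1

/-- The number of records of bucket `j`. -/
def bucketSize (log : List (ℕ × ℕ × ℕ)) (j : ℕ) : ℕ :=
  ((log.filter fun e => e.1 == j).map fun e => e.2.2).sum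

/-! ### Sample sort -/

/-- The branching factor for a subproblem of size `n`: it is `kM/B`, except that it is
`⌈n / (kM)⌉` if `n ≤ k²M²/B`. -/
def branching (k M B n : ℕ) : ℕ :=
  if n * B ≤ (k * M) ^ 2 then ceilDiv n (k * M) else k * M / B

/-- The recursion of the sample sort on an array of `n` records. The sample has size
`a * l * ⌈log₂ n₀⌉`, where `n₀` is the original input size. The result is the list of the blocks of
the sorted sequence, some of which may not be full. Beyond the depth of recursion given by the first
argument, selection sort is used for problems of all sizes. -/
def sampleSortRec (a k M B n₀ : ℕ) : ℕ → List ℕ → ℕ → Code (List ℕ)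
  | 0, as, n => selectionSort M B as n
  | fuel + 1, as, n =>
      if n ≤ k * M then selectionSort M B as n
      else do
        let l := branching k M B n
        let splitters ← chooseSplitters M B as n l (a * l * Nat.clog 2 n₀)
        let log ← partition k M B splitters as l
        let outs ← (List.range l).mapM' fun j =>
          sampleSortRec a k M B n₀ fuel (bucketBlocks log j) (bucketSize log j)
        pure outs.flatten

/-- The `kM/B`-way sample sort, with oversampling constant `a`, of an array of `n` records at
address `0`. The result is the address of the sorted array. The depth of recursion is cut off at
`n`. -/
def sampleSort (a k M B n : ℕ) : Prog ℕ :=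
  StateT.run' (s := ceilDiv n B) do
    let blocks ← sampleSortRec a k M B n n (List.range (ceilDiv n B)) n
    let start ← get
    let _ ← compact B blocks
    pure start

end AEM

/-! Sorting and staying within primary memory hold on every run; chance affects only the number of
transfers. `Hoare` bounds the probability that a fragment misses its postcondition. These
probabilities add under sequential composition (`Hoare.bind'`), and `ε = 0` gives a statement about
all runs. The subroutines are specified in this logic through the lists of records that their blocks
represent (`IsArray`), with `Step` counting transfers and protecting used blocks. They all fit into
`M + B + 1` records.

One induction, `sampleSortRec_spec`, yields both halves of the theorem. It carries a proposition
`good` on which only the cost bounds depend. With `good := False` and `ε = 0` it says that every run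
sorts; with `good := True` it bounds the cost up to a failure probability.

Probability. Let `t = a ⌈log₂ n₀⌉`, so that a subproblem of size `n` with `l` buckets draws `l t`
samples. A window of about `3n/(2l)` consecutive ranks receives about `1.5 t` samples on average,
and by an exponential moment bound (`randomList_tail`, `tail_le`) at most `t` with probability at
most `0.95 ^ t`. A union bound covers all windows. Splitters are `t` apart in the sorted sample, so
if every window has more than `t` samples, no bucket has more than `3n/(2l)` records
(`balanced_of_windows`). If all records are taken as the sample, this balance is automatic
(`balanced_of_full`). A subproblem thus fails with probability at most `n * 0.95 ^ t`, a level of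
the recursion with at most `n₀ * 0.95 ^ t`, and there are at most `n₀` levels. For large `a` the
total is below `n₀ ^ (-c)` (`failure_le`).

Cost. Let `K = kM/B`, `y = n/(kM)` and `L = ⌈log_K (n₀/B)⌉`. Apart from sorting the sample, a
subproblem costs `O(n/B)` writes and `k` times as many reads, and balanced buckets give depth `O(L)`
(`depthBound_child`, `depthBound_le`). Sorting the sample needs two cases. If `kM ≥ log² n₀`, it
also costs `O(n/B)`. If `kM < log² n₀`, it may cost more, but only by a multiple of `1/√y`; along a
branch of the recursion these excesses form a geometric series, whose sum is of order `√(log n₀) log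
log n₀`. In that case `K` and `B` are so small that `L` is at least of this order
(`clog_le_of_small`). Both effects are put into a potential `writeBound`, which pays for a node and
all its children (`writeBound_node`); `exists_writeBound` chooses its constants. -/

namespace AEM

/-! ### A program logic -/

section Logic

variable {ρ κ : Type*} [LinearOrder κ] (key : ρ → κ) (B S : ℕ)

/-- Started with free address `f` in state `s`, the fragment `p` ends in a result satisfying `Q`,
except with probability at most `ε`. -/
def Hoare {β : Type} (ε : ENNReal) (p : Code β) (f : ℕ) (s : State ρ)
    (Q : β → ℕ → State ρ → Prop) : Prop :=
  (exec key B S (p f) s).toOuterMeasure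
    {r | ¬ ∃ b f' s', r = some ((b, f'), s') ∧ Q b f' s'} ≤ ε

theorem exec_bind {β γ : Type} (p : Prog β) (g : β → Prog γ) (s : State ρ) :
    exec key B S (p.bind g) s = (exec key B S p s).bind fun r =>
      match r with
      | none => PMF.pure none
      | some (b, s') => exec key B S (g b) s' := by
  induction p generalizing s with
  | done b => simp [Prog.bind, exec]
  | read a next ih =>
    simp only [Prog.bind, exec]
    split_ifs
    · exact ih _ _
    · simp
  | write a i c next ih =>
    simp only [Prog.bind, exec]
    split_ifs
    · exact ih _
    · simp
  | keep ids next ih =>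
    simp only [Prog.bind, exec]
    split_ifs
    · exact ih _
    · simp
  | compare next ih => exact ih _ _
  | random N next ih =>
    simp only [Prog.bind, exec, PMF.bind_bind]
    congr 1
    funext i
    exact ih _ _

/-- The union bound for a two-stage experiment: failure means that the first stage lands in `A`, or
that the second stage fails from an outcome outside `A`. -/
theorem toOuterMeasure_bind_le {α β : Type*} (p : PMF α) (g : α → PMF β) (A : Set α) (E : Set β)
    (ε₁ ε₂ : ENNReal) (h₁ : p.toOuterMeasure A ≤ ε₁)
    (h₂ : ∀ a ∈ p.support, a ∉ A → (g a).toOuterMeasure E ≤ ε₂) :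
    (p.bind g).toOuterMeasure E ≤ ε₁ + ε₂ := by
  classical
  rw [PMF.toOuterMeasure_bind_apply]
  have hle : ∀ a, p a * (g a).toOuterMeasure E ≤ A.indicator p a + p a * ε₂ := by
    intro a
    by_cases ha : a ∈ A
    · rw [Set.indicator_of_mem ha]
      refine le_add_right ?_
      calc p a * (g a).toOuterMeasure E ≤ p a * 1 := by
            gcongr
            rw [PMF.toOuterMeasure_apply]
            calc _ ≤ ∑' x, (g a) x := ENNReal.tsum_le_tsum fun x => Set.indicator_le_self _ _ _
              _ = 1 := (g a).tsum_coe
        _ = p a := mul_one _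
    · refine le_add_left ?_
      by_cases h0 : p a = 0
      · simp [h0]
      · gcongr
        exact h₂ a ((PMF.mem_support_iff _ _).2 h0) ha
  calc _ ≤ ∑' a, (A.indicator p a + p a * ε₂) := ENNReal.tsum_le_tsum hle
    _ = p.toOuterMeasure A + ε₂ := by
      rw [ENNReal.tsum_add, ENNReal.tsum_mul_right, p.tsum_coe, one_mul, PMF.toOuterMeasure_apply]
    _ ≤ _ := by gcongr

variable {key B S} {β γ : Type} {ε ε₁ ε₂ : ENNReal} {f : ℕ} {s : State ρ}
  {Q R : β → ℕ → State ρ → Prop}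

theorem Hoare.mono {p : Code β} (h : Hoare key B S ε₁ p f s R) (hε : ε₁ ≤ ε₂)
    (hQ : ∀ b f' s', R b f' s' → Q b f' s') : Hoare key B S ε₂ p f s Q := by
  refine le_trans (MeasureTheory.measure_mono ?_) (le_trans h hε)
  rintro r hr ⟨b, f', s', rfl, h'⟩
  exact hr ⟨b, f', s', rfl, hQ _ _ _ h'⟩

theorem Hoare.imp {p : Code β} (h : Hoare key B S ε p f s R)
    (hQ : ∀ b f' s', R b f' s' → Q b f' s') : Hoare key B S ε p f s Q :=
  h.mono le_rfl hQ

theorem Hoare.and {p : Code β} (h₁ : Hoare key B S ε₁ p f s Q) (h₂ : Hoare key B S ε₂ p f s R) :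
    Hoare key B S (ε₁ + ε₂) p f s fun b f' s' => Q b f' s' ∧ R b f' s' := by
  refine le_trans (MeasureTheory.measure_mono ?_)
    (le_trans (MeasureTheory.measure_union_le _ _) (add_le_add h₁ h₂))
  intro r hr
  by_contra hc
  simp only [Set.mem_union, Set.mem_ofPred_eq, not_or, not_not] at hc
  obtain ⟨⟨b, f', s', rfl, h⟩, ⟨b₁, f₁, s₁, he, h'⟩⟩ := hc
  simp only [Option.some.injEq, Prod.mk.injEq] at he
  obtain ⟨⟨rfl, rfl⟩, rfl⟩ := he
  exact hr ⟨_, _, _, rfl, h, h'⟩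

/-- The union bound over a finite family of events. For the empty family one still has to know that
no run crashes, which is what `h₀` supplies. -/
theorem Hoare.forall_mem {ι : Type*} {p : Code β} (F : Finset ι) (e : ι → ENNReal)
    (P : ι → β → ℕ → State ρ → Prop) (h : ∀ i ∈ F, Hoare key B S (e i) p f s (P i))
    (h₀ : Hoare key B S 0 p f s fun _ _ _ => True) :
    Hoare key B S (∑ i ∈ F, e i) p f s fun b f' s' => ∀ i ∈ F, P i b f' s' := by
  classical
  induction F using Finset.induction_on with
  | empty => simpa using h₀
  | insert i F hi ih =>
    rw [Finset.sum_insert hi]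
    refine ((h i (by simp)).and (ih fun j hj => h j (by simp [hj]))).imp ?_
    rintro b f' s' ⟨h₁, h₂⟩ j hj
    rcases Finset.mem_insert.1 hj with rfl | hj
    · exact h₁
    · exact h₂ j hj

theorem Hoare.of_support {p : Code β}
    (h : ∀ r ∈ (exec key B S (p f) s).support, ∃ b f' s', r = some ((b, f'), s') ∧ Q b f' s') :
    Hoare key B S ε p f s Q := by
  refine le_trans (le_of_eq ?_) (zero_le)
  rw [PMF.toOuterMeasure_apply_eq_zero_iff, Set.disjoint_left]
  intro r hr hn
  exact hn (h r hr)

theorem Hoare.ret {b : β} (h : Q b f s) : Hoare key B S ε (pure b : Code β) f s Q := by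
  refine Hoare.of_support fun r hr => ?_
  have : r = some ((b, f), s) := by
    have hr' : r ∈ (PMF.pure (some ((b, f), s))).support := hr
    simpa using hr'
  exact ⟨b, f, s, this, h⟩

theorem Hoare.bind' {p : Code β} {g : β → Code γ} {Q : γ → ℕ → State ρ → Prop}
    (h₁ : Hoare key B S ε₁ p f s R)
    (h₂ : ∀ b f' s', R b f' s' → Hoare key B S ε₂ (g b) f' s' Q) :
    Hoare key B S (ε₁ + ε₂) (p >>= g) f s Q := by
  unfold Hoare
  have : (p >>= g) f = (p f).bind fun r => g r.1 r.2 := rfl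
  rw [this, exec_bind]
  refine toOuterMeasure_bind_le _ _ _ _ _ _ h₁ ?_
  intro r hr hn
  simp only [Set.mem_ofPred_eq, not_not] at hn
  obtain ⟨b, f', s', rfl, h⟩ := hn
  exact h₂ b f' s' h

theorem Hoare.bind {p : Code β} {g : β → Code γ} {Q : γ → ℕ → State ρ → Prop}
    (h₁ : Hoare key B S 0 p f s R)
    (h₂ : ∀ b f' s', R b f' s' → Hoare key B S ε (g b) f' s' Q) :
    Hoare key B S ε (p >>= g) f s Q := by
  simpa using h₁.bind' h₂

theorem Hoare.readBlock {a : ℕ} {Q : ℕ → ℕ → State ρ → Prop}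
    (h : s.mem.length + (s.ext a).length ≤ S)
    (hQ : Q (s.ext a).length f { s with mem := s.mem ++ s.ext a, reads := s.reads + 1 }) :
    Hoare key B S ε (readBlock a) f s Q := by
  refine Hoare.of_support fun r hr => ?_
  simp only [AEM.readBlock, exec, h, if_true, PMF.support_pure, Set.mem_singleton_iff] at hr
  exact ⟨_, _, _, hr, hQ⟩

theorem Hoare.store {i c : ℕ} {Q : ℕ → ℕ → State ρ → Prop} (h : c ≤ B)
    (hQ : Q f (f + 1) { s with
      ext := Function.update s.ext f ((s.mem.drop i).take c), writes := s.writes + 1 }) :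
    Hoare key B S ε (store i c) f s Q := by
  refine Hoare.of_support fun r hr => ?_
  simp only [AEM.store, exec, h, if_true, PMF.support_pure, Set.mem_singleton_iff] at hr
  exact ⟨_, _, _, hr, hQ⟩

theorem Hoare.keepMem {ids : List ℕ} {Q : Unit → ℕ → State ρ → Prop} (h : ids.length ≤ S)
    (hQ : Q () f { s with mem := pick s.mem ids }) :
    Hoare key B S ε (keepMem ids) f s Q := by
  refine Hoare.of_support fun r hr => ?_
  simp only [AEM.keepMem, exec, h, if_true, PMF.support_pure, Set.mem_singleton_iff] at hr
  exact ⟨_, _, _, hr, hQ⟩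

theorem Hoare.comparisons {Q : (ℕ → ℕ → Bool) → ℕ → State ρ → Prop}
    (hQ : Q (leAt key s.mem) f s) :
    Hoare key B S ε comparisons f s Q := by
  refine Hoare.of_support fun r hr => ?_
  simp only [AEM.comparisons, exec, PMF.support_pure, Set.mem_singleton_iff] at hr
  exact ⟨_, _, _, hr, hQ⟩

theorem Hoare.readBlock_bind {a : ℕ} {g : ℕ → Code β}
    (h : s.mem.length + (s.ext a).length ≤ S)
    (hQ : Hoare key B S ε (g (s.ext a).length) f
      { s with mem := s.mem ++ s.ext a, reads := s.reads + 1 } Q) :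
    Hoare key B S ε (AEM.readBlock a >>= g) f s Q :=
  Hoare.bind (R := fun b f' s' => b = (s.ext a).length ∧ f' = f ∧
    s' = { s with mem := s.mem ++ s.ext a, reads := s.reads + 1 })
    (Hoare.readBlock h ⟨rfl, rfl, rfl⟩) fun _ _ _ ⟨h₁, h₂, h₃⟩ => h₁ ▸ h₂ ▸ h₃ ▸ hQ

theorem Hoare.store_bind {i c : ℕ} {g : ℕ → Code β} (h : c ≤ B)
    (hQ : Hoare key B S ε (g f) (f + 1) { s with
      ext := Function.update s.ext f ((s.mem.drop i).take c), writes := s.writes + 1 } Q) :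
    Hoare key B S ε (AEM.store i c >>= g) f s Q :=
  Hoare.bind (R := fun b f' s' => b = f ∧ f' = f + 1 ∧ s' = { s with
      ext := Function.update s.ext f ((s.mem.drop i).take c), writes := s.writes + 1 })
    (Hoare.store h ⟨rfl, rfl, rfl⟩) fun _ _ _ ⟨h₁, h₂, h₃⟩ => h₁ ▸ h₂ ▸ h₃ ▸ hQ

theorem Hoare.keepMem_bind {ids : List ℕ} {g : Unit → Code β} (h : ids.length ≤ S)
    (hQ : Hoare key B S ε (g ()) f { s with mem := pick s.mem ids } Q) :
    Hoare key B S ε (AEM.keepMem ids >>= g) f s Q :=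
  Hoare.bind (R := fun _ f' s' => f' = f ∧ s' = { s with mem := pick s.mem ids })
    (Hoare.keepMem h ⟨rfl, rfl⟩) fun _ _ _ ⟨h₂, h₃⟩ => h₂ ▸ h₃ ▸ hQ

theorem Hoare.comparisons_bind {g : (ℕ → ℕ → Bool) → Code β}
    (hQ : Hoare key B S ε (g (leAt key s.mem)) f s Q) :
    Hoare key B S ε (AEM.comparisons >>= g) f s Q :=
  Hoare.bind (R := fun b f' s' => b = leAt key s.mem ∧ f' = f ∧ s' = s)
    (Hoare.comparisons ⟨rfl, rfl, rfl⟩) fun _ _ _ ⟨h₁, h₂, h₃⟩ => h₁ ▸ h₂ ▸ h₃ ▸ hQ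

/-- The failure probability is the average over the branches. Keeping a separate bound for each
branch is what makes exponential moments computable by recursion on the sample. -/
theorem Hoare.randomNat_bind {N : ℕ} {g : ℕ → Code β} (e : ℕ → ENNReal)
    (h : ∀ i ≤ N, Hoare key B S (e i) (g i) f s Q) :
    Hoare key B S ((∑ i ∈ Finset.range (N + 1), e i) / (N + 1 : ℕ)) (randomNat N >>= g) f s Q := by
  unfold Hoare
  have : (randomNat N >>= g) f = .random N fun i => g i f := rfl
  rw [this, exec, PMF.toOuterMeasure_bind_apply, tsum_fintype]
  simp only [PMF.uniformOfFintype_apply, Fintype.card_fin]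
  rw [ENNReal.div_eq_inv_mul, Finset.mul_sum, Finset.sum_range]
  refine Finset.sum_le_sum fun i _ => ?_
  gcongr
  exact h i (by omega)

theorem Hoare.randomNat_bind' {N : ℕ} {g : ℕ → Code β}
    (h : ∀ i ≤ N, Hoare key B S ε (g i) f s Q) :
    Hoare key B S ε (randomNat N >>= g) f s Q := by
  refine (Hoare.randomNat_bind (fun _ => ε) h).mono ?_ fun _ _ _ h => h
  rw [Finset.sum_const, Finset.card_range, nsmul_eq_mul, mul_comm, mul_div_assoc]
  · rw [ENNReal.div_self] <;> simp

end Logic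
/-! ### Lists of records -/

section Lists

variable {α β κ : Type*}

theorem pick_append (l : List α) (a b : List ℕ) : pick l (a ++ b) = pick l a ++ pick l b := by
  simp [pick]

theorem pick_nil (l : List α) : pick l [] = [] := rfl

theorem pick_singleton (l : List α) {i : ℕ} (h : i < l.length) : pick l [i] = [l[i]] := by
  simp [pick, h]

theorem pick_cons (l : List α) {i : ℕ} (ids : List ℕ) (h : i < l.length) :
    pick l (i :: ids) = l[i] :: pick l ids := by
  simp [pick, h]

theorem pick_map (g : α → β) (l : List α) (ids : List ℕ) :
    pick (l.map g) ids = (pick l ids).map g := by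
  simp only [pick, List.map_filterMap, List.getElem?_map]

theorem pick_eq_map (l : List α) (d : α) {ids : List ℕ} (h : ∀ i ∈ ids, i < l.length) :
    pick l ids = ids.map fun i => l.getD i d := by
  induction ids with
  | nil => rfl
  | cons i ids ih =>
    have hi : i < l.length := h i (by simp)
    rw [pick_cons l ids hi, ih fun j hj => h j (by simp [hj])]
    simp [hi]

theorem length_pick (l : List α) {ids : List ℕ} (h : ∀ i ∈ ids, i < l.length) :
    (pick l ids).length = ids.length := by
  induction ids with
  | nil => rfl
  | cons i ids ih =>
    rw [pick_cons l ids (h i (by simp)), List.length_cons, List.length_cons,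
      ih fun j hj => h j (by simp [hj])]

theorem pick_take (l : List α) {ids : List ℕ} (h : ∀ i ∈ ids, i < l.length) (n : ℕ) :
    pick l (ids.take n) = (pick l ids).take n := by
  induction ids generalizing n with
  | nil => simp [pick]
  | cons i ids ih =>
    cases n with
    | zero => simp [pick]
    | succ n =>
      rw [List.take_succ_cons, pick_cons l _ (h i (by simp)), pick_cons l _ (h i (by simp)),
        List.take_succ_cons, ih fun j hj => h j (by simp [hj])]

theorem pick_append_right (l l' : List α) (ids : List ℕ) :
    pick (l ++ l') (ids.map fun i => l.length + i) = pick l' ids := by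
  simp only [pick, List.filterMap_map]
  refine List.filterMap_congr fun i _ => ?_
  rw [Function.comp_apply, List.getElem?_append_right (by omega), Nat.add_sub_cancel_left]

theorem pick_range' (l : List α) (i c : ℕ) : pick l (List.range' i c) = (l.drop i).take c := by
  induction c generalizing i with
  | zero => simp [pick]
  | succ c ih =>
    by_cases hi : i < l.length
    · rw [List.range'_succ, pick_cons _ _ hi, ih, List.drop_eq_getElem_cons hi, List.take_succ_cons]
    · have h : pick l (List.range' (i + 1) c) = [] := by
        rw [ih, List.drop_eq_nil_of_le (by omega), List.take_nil]
      rw [List.drop_eq_nil_of_le (by omega), List.take_nil, List.range'_succ]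
      have : pick l (i :: List.range' (i + 1) c) = pick l (List.range' (i + 1) c) := by
        simp only [pick]
        rw [List.filterMap_cons_none]
        simpa using hi
      rw [this, h]

theorem pick_range (l : List α) (c : ℕ) : pick l (List.range c) = l.take c := by
  rw [List.range_eq_range', pick_range', List.drop_zero]

/-- A program can test only positions. This turns such a test `p` into a test `P` of the records
themselves. -/
theorem pick_filter_range' (l : List α) (p : ℕ → Bool) (P : α → Bool) (i c : ℕ)
    (h : ∀ j, i ≤ j → ∀ hj : j < l.length, p j = P l[j]) :
    pick l ((List.range' i c).filter p) = ((l.drop i).take c).filter P := by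
  induction c generalizing i with
  | zero => simp [pick]
  | succ c ih =>
    have ih' := ih (i + 1) fun j hj => h j (by omega)
    by_cases hi : i < l.length
    · rw [List.range'_succ, List.drop_eq_getElem_cons hi, List.take_succ_cons, List.filter_cons,
        List.filter_cons, ← h i le_rfl hi]
      split_ifs
      · rw [pick_cons _ _ hi, ih']
      · rw [ih']
    · rw [List.drop_eq_nil_of_le (by omega), List.take_nil, List.filter_nil]
      simp only [pick, List.filterMap_eq_nil_iff]
      intro j hj
      simp only [List.mem_filter, List.mem_range'_1] at hj
      simp
      omega

theorem pick_filter_range (l : List α) (p : ℕ → Bool) (P : α → Bool)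
    (h : ∀ j, ∀ hj : j < l.length, p j = P l[j]) :
    pick l ((List.range l.length).filter p) = l.filter P := by
  rw [List.range_eq_range', pick_filter_range' l p P 0 _ fun j _ => h j]
  simp

end Lists

/-! ### Sorted lists and the smallest records of a list -/

section Sorting

variable {α κ : Type*} [LinearOrder κ] (key : α → κ)

/-- The list is sorted by the keys. -/
abbrev Sorted (l : List α) : Prop := l.Pairwise fun x y => key x ≤ key y

/-- The list sorted by the keys. -/
def sortK (l : List α) : List α := l.mergeSort fun x y => decide (key x ≤ key y)

theorem sorted_sortK (l : List α) : Sorted key (sortK key l) := by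
  have := List.pairwise_mergeSort (le := fun x y => decide (key x ≤ key y))
    (fun a b c hab hbc => by
      simp only [decide_eq_true_eq] at *
      exact hab.trans hbc)
    (fun a b => by simpa using le_total _ _) l
  exact this.imp fun h => by simpa using h

theorem sortK_perm (l : List α) : (sortK key l).Perm l := List.mergeSort_perm _ _

/-- Sorting positions by the table of comparisons amounts to sorting the records, since mergesort
commutes with maps that preserve the order relation. -/
theorem pick_mergeSort (l : List α) {ids : List ℕ} (h : ∀ i ∈ ids, i < l.length) :
    pick l (ids.mergeSort (leAt key l)) = sortK key (pick l ids) := by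
  rcases ids with _ | ⟨i₀, ids⟩
  · simp [pick, sortK]
  · have hi₀ : i₀ < l.length := h i₀ (by simp)
    generalize hids : i₀ :: ids = I at h
    have hI : ∀ i ∈ I.mergeSort (leAt key l), i < l.length := fun i hi =>
      h i ((List.mergeSort_perm _ _).mem_iff.1 hi)
    rw [pick_eq_map l l[i₀] hI, pick_eq_map l l[i₀] h, sortK, List.map_mergeSort]
    intro a ha b hb
    have ha' := h a ha
    have hb' := h b hb
    simp [leAt, ha', hb']

/-- `q` consists of the `M` smallest elements of `L`, in sorted order. -/
def IsTop (M : ℕ) (q L : List α) : Prop :=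
  Sorted key q ∧ q.length ≤ M ∧ ∃ rest : List α, (q ++ rest).Perm L ∧
    (∀ x ∈ q, ∀ y ∈ rest, key x ≤ key y) ∧ (rest ≠ [] → q.length = M)

variable {key} {M : ℕ} {q q' L L' A C : List α}

theorem IsTop.length_le (h : IsTop key M q L) : q.length ≤ M := h.2.1

theorem isTop_nil : IsTop key M [] ([] : List α) :=
  ⟨List.Pairwise.nil, by simp, [], by simp, by simp, by simp⟩

theorem IsTop.length_eq (h : IsTop key M q L) : q.length = min M L.length := by
  obtain ⟨h₁, h₂, rest, h₃, h₄, h₅⟩ := h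
  have hl := h₃.length_eq
  rw [List.length_append] at hl
  by_cases hr : rest = []
  · subst hr
    simp at hl
    omega
  · have := h₅ hr
    omega

theorem isTop_sortK (M : ℕ) (L : List α) : IsTop key M ((sortK key L).take M) L := by
  have hs := sorted_sortK key L
  refine ⟨hs.sublist (List.take_sublist _ _), by simp, (sortK key L).drop M, ?_, ?_, ?_⟩
  · rw [List.take_append_drop]
    exact sortK_perm key L
  · intro x hx y hy
    have := List.pairwise_append.1 ((List.take_append_drop M (sortK key L)).symm ▸ hs)
    exact this.2.2 x hx y hy
  · intro h
    have : M < (sortK key L).length := by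
      by_contra hc
      exact h (List.drop_eq_nil_of_le (by omega))
    simp
    omega

theorem isTop_pick_mergeSort (M : ℕ) (l : List α) {ids : List ℕ} (h : ∀ i ∈ ids, i < l.length) :
    IsTop key M (pick l ((ids.mergeSort (leAt key l)).take M)) (pick l ids) := by
  have hI : ∀ i ∈ ids.mergeSort (leAt key l), i < l.length := fun i hi =>
    h i ((List.mergeSort_perm _ _).mem_iff.1 hi)
  rw [pick_take l hI, pick_mergeSort key l h]
  exact isTop_sortK M _

/-- Records discarded from `A` stay discarded. If a selected `x` had a larger key than a discarded
`y`, then all `M` records of `q`, having keys at most that of `y`, would be smaller than `x`. They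
would all have to be in `q'`, which with `x` would then exceed `M` records. -/
theorem IsTop.absorb (h₁ : IsTop key M q A) (h₂ : IsTop key M q' (q ++ C)) :
    IsTop key M q' (A ++ C) := by
  classical
  obtain ⟨-, hq, rest, hp, hle, hlen⟩ := h₁
  obtain ⟨hs', hq', rest', hp', hle', hlen'⟩ := h₂
  refine ⟨hs', hq', rest' ++ rest, ?_, ?_, ?_⟩
  · calc (q' ++ (rest' ++ rest)).Perm ((q' ++ rest') ++ rest) := by simp
      _ |>.Perm ((q ++ C) ++ rest) := hp'.append_right _
      _ |>.Perm ((q ++ rest) ++ C) := by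
        simp only [List.append_assoc]
        exact List.Perm.append_left _ List.perm_append_comm
      _ |>.Perm (A ++ C) := hp.append_right _
  · intro x hx y hy
    rcases List.mem_append.1 hy with hy | hy
    · exact hle' x hx y hy
    · by_contra hc
      push Not at hc
      have hql := hlen (List.ne_nil_of_mem hy)
      have h1 : (q ++ C).countP (fun z => decide (key z < key x)) ≥ M := by
        rw [List.countP_append, ← hql]
        refine le_add_right (le_of_eq ?_)
        symm
        rw [List.countP_eq_length]
        intro z hz
        simpa using (hle z hz y hy).trans_lt hc
      have h2 : rest'.countP (fun z => decide (key z < key x)) = 0 := by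
        rw [List.countP_eq_zero]
        intro z hz
        simpa using hle' x hx z hz
      have h3 : q'.countP (fun z => decide (key z < key x)) < q'.length := by
        refine lt_of_le_of_ne List.countP_le_length fun he => ?_
        rw [List.countP_eq_length] at he
        simpa using he x hx
      have h4 := hp'.countP_eq (fun z => decide (key z < key x))
      rw [List.countP_append] at h4
      omega
  · intro hne
    by_cases hr' : rest' = []
    · have hr : rest ≠ [] := by
        rintro rfl
        simp [hr'] at hne
      have h1 := hlen hr
      have h2 := hp'.length_eq
      simp [hr'] at h2
      omega
    · exact hlen' hr'

/-- Records that lie above `M` records already considered need not be looked at. The counting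
argument of `IsTop.absorb` applies, with `D` in the role of the earlier selection. -/
theorem IsTop.append_right (h : IsTop key M q A) {E : List α}
    (hE : E ≠ [] → ∃ D : List α, D.Subperm A ∧ M ≤ D.length ∧ ∀ x ∈ D, ∀ y ∈ E, key x ≤ key y) :
    IsTop key M q (A ++ E) := by
  classical
  by_cases hE0 : E = []
  · simpa [hE0] using h
  obtain ⟨D, hD, hDM, hDE⟩ := hE hE0
  obtain ⟨hs, hq, rest, hp, hle, hlen⟩ := h
  refine ⟨hs, hq, rest ++ E, ?_, ?_, ?_⟩
  · rw [← List.append_assoc]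
    exact hp.append_right _
  · intro x hx y hy
    rcases List.mem_append.1 hy with hy | hy
    · exact hle x hx y hy
    · by_contra hc
      push Not at hc
      have h1 : M ≤ D.countP (fun z => decide (key z < key x)) := by
        refine hDM.trans (le_of_eq ?_)
        symm
        rw [List.countP_eq_length]
        intro z hz
        simpa using (hDE z hz y hy).trans_lt hc
      have h1' := hD.countP_le (fun z => decide (key z < key x))
      have h2 : rest.countP (fun z => decide (key z < key x)) = 0 := by
        rw [List.countP_eq_zero]
        intro z hz
        simpa using hle x hx z hz
      have h3 : q.countP (fun z => decide (key z < key x)) < q.length := by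
        refine lt_of_le_of_ne List.countP_le_length fun he => ?_
        rw [List.countP_eq_length] at he
        simpa using he x hx
      have h4 := hp.countP_eq (fun z => decide (key z < key x))
      rw [List.countP_append] at h4
      omega
  · intro _
    have h1 := hD.length_le
    have h2 := hp.length_eq
    rw [List.length_append] at h2
    by_cases hr : rest = []
    · simp [hr] at h2
      omega
    · exact hlen hr

end Sorting

/-! ### Arrays in secondary memory -/

section Arrays

variable {ρ : Type*}

/-- The blocks with addresses `as`, all below `f`, hold the list `xs`; all of them are full, except
possibly the last one. -/
def IsArray (B : ℕ) (ext : ℕ → List ρ) (f : ℕ) (as : List ℕ) (xs : List ρ) : Prop :=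
  as.length = ceilDiv xs.length B ∧ (∀ a ∈ as, a < f) ∧
    ∀ i (hi : i < as.length), ext as[i] = (xs.drop (i * B)).take B

/-- From state `s` with free address `f` to `s'` with free address `f'`, no used block has changed,
and at most `r` reads and `w` writes have been made. -/
def Step (f : ℕ) (s : State ρ) (f' : ℕ) (s' : State ρ) (r w : ℕ) : Prop :=
  f ≤ f' ∧ (∀ a < f, s'.ext a = s.ext a) ∧ s'.reads ≤ s.reads + r ∧ s'.writes ≤ s.writes + w

variable {B f f' f'' r w r' w' : ℕ} {s s' s'' : State ρ} {as : List ℕ} {xs : List ρ}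

theorem Step.refl : Step f s f s r w := ⟨le_rfl, fun _ _ => rfl, by omega, by omega⟩

theorem Step.trans (h : Step f s f' s' r w) (h' : Step f' s' f'' s'' r' w') :
    Step f s f'' s'' (r + r') (w + w') :=
  ⟨h.1.trans h'.1, fun a ha => (h'.2.1 a (lt_of_lt_of_le ha h.1)).trans (h.2.1 a ha),
    by have := h.2.2.1; have := h'.2.2.1; omega, by have := h.2.2.2; have := h'.2.2.2; omega⟩

theorem Step.mono (h : Step f s f' s' r w) (hr : r ≤ r') (hw : w ≤ w') : Step f s f' s' r' w' :=
  ⟨h.1, h.2.1, by have := h.2.2.1; omega, by have := h.2.2.2; omega⟩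

theorem IsArray.step (h : IsArray B s.ext f as xs) (hs : Step f s f' s' r w) :
    IsArray B s'.ext f' as xs := by
  refine ⟨h.1, fun a ha => lt_of_lt_of_le (h.2.1 a ha) hs.1, fun i hi => ?_⟩
  rw [hs.2.1 _ (h.2.1 _ (List.getElem_mem hi))]
  exact h.2.2 i hi

theorem ceilDiv_le_iff {n d m : ℕ} (hd : 0 < d) : ceilDiv n d ≤ m ↔ n ≤ m * d := by
  unfold ceilDiv
  rw [Nat.div_le_iff_le_mul_add_pred hd, mul_comm]
  omega

theorem lt_ceilDiv_iff {n d m : ℕ} (hd : 0 < d) : m < ceilDiv n d ↔ m * d < n := by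
  have := ceilDiv_le_iff (n := n) (m := m) hd
  omega

theorem le_ceilDiv_mul (n : ℕ) {d : ℕ} (hd : 0 < d) : n ≤ ceilDiv n d * d :=
  (ceilDiv_le_iff hd).1 le_rfl

theorem ceilDiv_mul_lt (n : ℕ) {d : ℕ} (hd : 0 < d) : ceilDiv n d * d < n + d := by
  have := Nat.div_mul_le_self (n + d - 1) d
  unfold ceilDiv
  omega

theorem ceilDiv_add_mul (n m : ℕ) {d : ℕ} (hd : 0 < d) : ceilDiv (m * d + n) d = m + ceilDiv n d := by
  unfold ceilDiv
  rw [show m * d + n + d - 1 = (n + d - 1) + m * d by omega, Nat.add_mul_div_right _ _ hd, add_comm]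

theorem ceilDiv_zero {d : ℕ} (hd : 0 < d) : ceilDiv 0 d = 0 := by
  have := (ceilDiv_le_iff (n := 0) (m := 0) hd).2 (by omega)
  omega

theorem ceilDiv_le_self (n : ℕ) {d : ℕ} (hd : 0 < d) : ceilDiv n d ≤ n :=
  (ceilDiv_le_iff hd).2 (Nat.le_mul_of_pos_right _ hd)

theorem flatten_map_drop_take (xs : List ρ) (ext : ℕ → List ρ) (as : List ℕ) (b : ℕ)
    (hlen : xs.length ≤ (b + as.length) * B)
    (h : ∀ i (hi : i < as.length), ext as[i] = (xs.drop ((b + i) * B)).take B) :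
    (as.map ext).flatten = xs.drop (b * B) := by
  induction as generalizing b with
  | nil => simpa using hlen
  | cons a as ih =>
    rw [List.map_cons, List.flatten_cons, ih (b + 1)]
    · have h0 := h 0 (by simp)
      simp only [List.getElem_cons_zero, add_zero] at h0
      rw [h0, add_mul, one_mul, ← List.drop_drop, List.take_append_drop]
    · simp only [List.length_cons] at hlen
      refine hlen.trans (le_of_eq ?_)
      ring
    · intro i hi
      have := h (i + 1) (by simpa using hi)
      simp only [List.getElem_cons_succ] at this
      rw [this]
      congr 2
      ring

theorem IsArray.flatten (h : IsArray B s.ext f as xs) (hB : 0 < B) :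
    (as.map s.ext).flatten = xs := by
  have := flatten_map_drop_take xs s.ext as 0 (by
    rw [h.1, zero_add]
    exact le_ceilDiv_mul _ hB) (by simpa using h.2.2)
  simpa using this

theorem IsArray.length_block (h : IsArray B s.ext f as xs) : ∀ a ∈ as, (s.ext a).length ≤ B := by
  intro a ha
  obtain ⟨i, hi, rfl⟩ := List.getElem_of_mem ha
  rw [h.2.2 i hi]
  simp

theorem isArray_nil {ext : ℕ → List ρ} (hB : 0 < B) : IsArray B ext f [] [] :=
  ⟨by simp [ceilDiv_zero hB], by simp, by simp⟩

/-- Concatenation of arrays, the first of which has full blocks only. -/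
theorem IsArray.append {ext : ℕ → List ρ} {as' : List ℕ} {xs' : List ρ} (hB : 0 < B)
    (h : IsArray B ext f as xs)
    (h' : IsArray B ext f as' xs') (hf : B ∣ xs.length) :
    IsArray B ext f (as ++ as') (xs ++ xs') := by
  obtain ⟨m, hm⟩ := hf
  rw [mul_comm] at hm
  have hl : as.length = m := by
    have := ceilDiv_add_mul 0 m hB
    rw [ceilDiv_zero hB] at this
    rw [h.1, hm]
    simpa using this
  refine ⟨?_, ?_, ?_⟩
  · rw [List.length_append, List.length_append, hm, ceilDiv_add_mul _ _ hB, hl, h'.1]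
  · intro a ha
    rcases List.mem_append.1 ha with ha | ha
    · exact h.2.1 a ha
    · exact h'.2.1 a ha
  · intro i hi
    by_cases hi' : i < as.length
    · rw [List.getElem_append_left hi', h.2.2 i hi', List.drop_append_of_le_length,
        List.take_append_of_le_length]
      · rw [List.length_drop, hm]
        have : (i + 1) * B ≤ m * B := Nat.mul_le_mul_right _ (by omega)
        rw [add_mul] at this
        omega
      · rw [hm]
        exact Nat.mul_le_mul_right _ (by omega)
    · rw [List.getElem_append_right (by omega), h'.2.2 _ (by simp at hi; omega), hl]
      congr 1
      have h0 : xs.length ≤ i * B := by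
        rw [hm]
        exact Nat.mul_le_mul_right _ (by omega)
      rw [List.drop_append, List.drop_eq_nil_of_le h0, List.nil_append, hm, Nat.sub_mul]

end Arrays
/-! ### Selection sort -/

section Selection

variable {ρ κ : Type*} [LinearOrder κ] {key : ρ → κ} {B S : ℕ}

theorem storeBlocks_spec (i q t n : ℕ) (f : ℕ) (s : State ρ) :
    Hoare key B S 0 ((List.range' t n).mapM' fun t => store (i + t * B) (min B (q - t * B))) f s
      fun out f' s' => out = List.range' f n ∧ f' = f + n ∧ s'.mem = s.mem ∧
        Step f s f' s' 0 n ∧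
        ∀ j < n, s'.ext (f + j) = (s.mem.drop (i + (t + j) * B)).take (min B (q - (t + j) * B)) := by
  induction n generalizing t f s with
  | zero => exact Hoare.ret ⟨rfl, rfl, rfl, Step.refl, by simp⟩
  | succ n ih =>
    rw [List.range'_succ]
    change Hoare key B S 0 (store _ _ >>= fun b => List.mapM' _ _ >>= fun bs => pure (b :: bs)) f s _
    refine Hoare.store_bind (min_le_left _ _) ?_
    refine (ih _ _ _).bind ?_
    rintro out f' s' ⟨rfl, rfl, hm, hs, hj⟩
    refine Hoare.ret ⟨by rw [List.range'_succ], by omega, hm, ?_, ?_⟩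
    · refine ⟨by omega, fun a ha => ?_, hs.2.2.1, ?_⟩
      · rw [hs.2.1 a (by omega)]
        exact Function.update_of_ne (by omega) _ _
      · have := hs.2.2.2
        simp only at this
        omega
    · intro j hjn
      rcases j with _ | j
      · rw [add_zero, hs.2.1 _ (by omega)]
        simp
      · have := hj j (by omega)
        rw [show f + (j + 1) = f + 1 + j by omega, this, show t + (j + 1) = t + 1 + j by omega]

theorem storeSegment_spec (i q : ℕ) (f : ℕ) (s : State ρ) (hq : i + q ≤ s.mem.length) :
    Hoare key B S 0 (storeSegment B i q) f s
      fun out f' s' => s'.mem = s.mem ∧ Step f s f' s' 0 out.length ∧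
        IsArray B s'.ext f' out ((s.mem.drop i).take q) := by
  unfold storeSegment
  rw [List.range_eq_range']
  refine (storeBlocks_spec i q 0 (ceilDiv q B) f s).imp ?_
  rintro out f' s' ⟨rfl, rfl, hm, hs, hj⟩
  refine ⟨hm, by simpa using hs, ?_, ?_, ?_⟩
  · simp
    congr 1
    omega
  · intro a ha
    simp at ha
    omega
  · intro j hjn
    simp only [List.length_range'] at hjn
    simp only [List.getElem_range', one_mul]
    rw [hj j hjn, List.drop_take, List.take_take, List.drop_drop, zero_add]

variable (key) in
/-- The key of `x` is larger than the keys of the records in `hd`. -/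
def above (hd : List ρ) (x : ρ) : Bool := hd.all fun y => !decide (key x ≤ key y)

/-- The loop invariant: the queue `q` is the selection from `A`, the part of the input above `hd`
that has been scanned. The capacity is used exactly: one record of `hd`, a queue of `M`, and the
block just read. -/
theorem selectScan_spec {M : ℕ} (hS : M + B + 1 ≤ S) (hd : List ρ) (hhd : hd.length ≤ 1)
    (as : List ℕ) : ∀ (q A : List ρ) (f : ℕ) (s : State ρ), s.mem = hd ++ q → IsTop key M q A →
    (∀ x ∈ q, above key hd x) → (∀ a ∈ as, (s.ext a).length ≤ B) →
    Hoare key B S 0 (selectScan M hd.length q.length as) f s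
      fun b f' s' => ∃ q', s'.mem = hd ++ q' ∧ b = q'.length ∧
        IsTop key M q' (A ++ (as.map s.ext).flatten.filter (above key hd)) ∧
        f' = f ∧ s'.ext = s.ext ∧ s'.reads = s.reads + as.length ∧ s'.writes = s.writes := by
  induction as with
  | nil =>
    intro q A f s hm hq _ _
    exact Hoare.ret ⟨q, hm, rfl, by simpa using hq, rfl, rfl, rfl, rfl⟩
  | cons a as ih =>
    intro q A f s hm hq hqa hlen
    have hqM := hq.length_le
    have ha := hlen a (by simp)
    unfold selectScan
    refine Hoare.readBlock_bind (by rw [hm, List.length_append]; omega) ?_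
    refine Hoare.comparisons_bind ?_
    dsimp only
    set blk := s.ext a with hblk
    set mem := s.mem ++ blk with hmem
    have hmem' : mem = hd ++ (q ++ blk) := by rw [hmem, hm, List.append_assoc]
    set cand := (List.range' hd.length (q.length + blk.length)).filter fun p =>
      hd.length == 0 || !(leAt key mem p 0) with hcand
    have hcv : ∀ i ∈ cand, i < mem.length := by
      intro i hi
      simp only [hcand, List.mem_filter, List.mem_range'_1] at hi
      rw [hmem']
      simp only [List.length_append]
      omega
    have hpc : pick mem cand = q ++ blk.filter (above key hd) := by
      rw [hcand, pick_filter_range' mem _ (above key hd)]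
      · rw [hmem', List.drop_left, List.take_of_length_le (by simp), List.filter_append,
          List.filter_eq_self.2 hqa]
      · intro j hj hjm
        rcases hd with _ | ⟨y, _ | ⟨z, hd⟩⟩
        · simp [above]
        · have h0 : 0 < mem.length := by omega
          have : mem[0] = y := by simp [hmem']
          simp [above, leAt, hjm, h0, this]
        · simp at hhd
    have htop := isTop_pick_mergeSort (key := key) M mem hcv
    set ids := (cand.mergeSort (leAt key mem)).take M with hids
    have hiv : ∀ i ∈ ids, i < mem.length := fun i hi =>
      hcv i ((List.mergeSort_perm _ _).mem_iff.1 (List.mem_of_mem_take hi))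
    have hidl : ids.length = (pick mem ids).length := (length_pick mem hiv).symm
    have hidM : ids.length ≤ M := by simp [hids]
    rw [hpc] at htop
    refine Hoare.keepMem_bind (by simp; omega) ?_
    have hpk : pick mem (List.range hd.length ++ ids) = hd ++ pick mem ids := by
      rw [pick_append, pick_range, hmem', List.take_left]
    dsimp only
    rw [hpk, hidl]
    refine (ih (pick mem ids) (A ++ blk.filter (above key hd)) f _ rfl (hq.absorb htop) ?_ ?_).imp ?_
    · intro x hx
      obtain ⟨-, -, rest, hp, -⟩ := htop
      have : x ∈ q ++ blk.filter (above key hd) := hp.mem_iff.1 (List.mem_append_left _ hx)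
      rcases List.mem_append.1 this with h | h
      · exact hqa x h
      · exact (List.mem_filter.1 h).2
    · exact fun a' ha' => hlen a' (by simp [ha'])
    · rintro b f' s' ⟨q', h1, h2, h3, h4, h5, h6, h7⟩
      refine ⟨q', h1, h2, ?_, h4, h5, ?_, h7⟩
      · simpa [List.filter_append] using h3
      · rw [h6]
        simp
        omega

/-- A phase resumes strictly above the last key that was output, so repeated keys could be lost
between phases but not within one. Hence distinctness is required only for two or more phases: the
mergesort uses a single phase on samples, which may contain a record several times. -/
theorem selectPhases_spec {M : ℕ} (hB : 0 < B) (hM : 0 < M) (hBM : B ∣ M) (hS : M + B + 1 ≤ S)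
    (as : List ℕ) (xs : List ρ) (p : ℕ) (hnd : 2 ≤ p → (xs.map key).Nodup) :
    ∀ (hd : List ρ) (f : ℕ) (s : State ρ), hd.length ≤ 1 → s.mem = hd →
    IsArray B s.ext f as xs →
    p = ceilDiv (xs.filter (above key hd)).length M →
    Hoare key B S 0 (selectPhases M B as p hd.length) f s
      fun out f' s' => ∃ zs : List ρ, zs.Perm (xs.filter (above key hd)) ∧ Sorted key zs ∧
        IsArray B s'.ext f' out zs ∧ s'.mem = [] ∧ Step f s f' s' (p * as.length) out.length := by
  induction p with
  | zero =>
    intro hd f s _ _ has hp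
    unfold selectPhases
    refine Hoare.keepMem_bind (by simp) (Hoare.ret ⟨[], ?_, List.Pairwise.nil, isArray_nil hB, rfl, ?_⟩)
    · have := (ceilDiv_le_iff (n := (xs.filter (above key hd)).length) (m := 0) hM).1 hp.ge
      have : xs.filter (above key hd) = [] := List.length_eq_zero_iff.1 (by omega)
      rw [this]
    · exact ⟨le_rfl, fun _ _ => rfl, by simp, by simp⟩
  | succ p ih =>
    intro hd f s hhd hm has hp
    unfold selectPhases
    have h1 := selectScan_spec (key := key) hS hd hhd as [] [] f s (by simpa using hm) isTop_nil
      (by simp) has.length_block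
    refine h1.bind ?_
    rintro b f₁ s₁ ⟨q, hm₁, rfl, hq, rfl, he₁, hr₁, hw₁⟩
    rw [has.flatten hB, List.nil_append] at hq
    have hRpos : 0 < (xs.filter (above key hd)).length := by
      have := (lt_ceilDiv_iff (n := (xs.filter (above key hd)).length) (m := 0) hM).1 (by omega)
      omega
    have hqlen := hq.length_eq
    have hqpos : 0 < q.length := by omega
    refine (storeSegment_spec hd.length q.length f₁ s₁ (by rw [hm₁]; simp)).bind ?_
    rintro out f₂ s₂ ⟨hm₂, hst₂, hout⟩
    rw [hm₁, List.drop_left, List.take_length] at hout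
    have hst₁ : Step f₁ s f₁ s₁ as.length 0 :=
      ⟨le_rfl, fun a _ => by rw [he₁], hr₁.le, hw₁.le⟩
    refine Hoare.keepMem_bind (by simp; omega) ?_
    set y := q[q.length - 1] with hy
    have hmem₃ : pick s₂.mem [hd.length + q.length - 1] = [y] := by
      rw [hm₂, hm₁, pick_singleton _ (by simp; omega)]
      rw [List.getElem_append_right (by omega)]
      congr 2
      omega
    rw [hmem₃]
    obtain ⟨hqs, hqM, rest, hperm, hle, hfull⟩ := hq
    have hyq : y ∈ q := List.getElem_mem _
    have hqy : ∀ x ∈ q, key x ≤ key y := by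
      intro x hx
      obtain ⟨i, hi, rfl⟩ := List.getElem_of_mem hx
      rcases Nat.lt_or_ge i (q.length - 1) with h | h
      · exact List.pairwise_iff_getElem.1 hqs _ _ _ _ h
      · have : i = q.length - 1 := by omega
        subst this
        exact le_rfl
    have hya : above key hd y := (List.mem_filter.1 (hperm.mem_iff.1 (List.mem_append_left _ hyq))).2
    -- What the next phases must output is exactly what this phase left over. After the last phase
    -- nothing is left, and the claim is neither needed nor available without distinct keys.
    have hR' : (xs.filter (above key [y])).Perm rest ∨ p = 0 := by
      rcases Nat.eq_zero_or_pos p with h0 | h0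
      · exact Or.inr h0
      left
      have e1 : xs.filter (above key [y]) = (xs.filter (above key hd)).filter (above key [y]) := by
        rw [List.filter_filter]
        refine List.filter_congr fun x _ => ?_
        rw [Bool.eq_iff_iff]
        simp only [above, List.all_eq_true, Bool.and_eq_true] at hya ⊢
        refine ⟨fun h => ⟨h, fun z hz => ?_⟩, fun h => h.1⟩
        have h2 := h y (by simp)
        have h3 := hya z hz
        simp only [Bool.not_eq_true', decide_eq_false_iff_not, not_le] at h2 h3 ⊢
        exact h3.trans h2
      have hnd' : ((q ++ rest).map key).Nodup := by
        rw [(hperm.map key).nodup_iff]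
        exact (hnd (by omega)).sublist (List.filter_sublist.map key)
      rw [List.map_append, List.nodup_append] at hnd'
      have e2 := (hperm.filter (above key [y])).symm
      have e3 : q.filter (above key [y]) = [] := by
        rw [List.filter_eq_nil_iff]
        intro z hz
        simpa [above] using hqy z hz
      have e4 : rest.filter (above key [y]) = rest := by
        rw [List.filter_eq_self]
        intro z hz
        have h1 := hle y hyq z hz
        have h2 := hnd'.2.2 (key y) (List.mem_map_of_mem hyq) (key z) (List.mem_map_of_mem hz)
        simp [above]
        exact lt_of_le_of_ne h1 h2
      rw [List.filter_append, e3, e4, List.nil_append] at e2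
      rw [e1]
      exact e2
    have hlenq := hperm.length_eq
    rw [List.length_append] at hlenq
    have hst : Step f₁ s f₂ s₂ as.length out.length := by simpa using hst₁.trans hst₂
    by_cases hp0 : p = 0
    · subst hp0
      have hrest : rest = [] := by
        by_contra hne
        have h1 := hfull hne
        have h2 := (ceilDiv_le_iff (n := (xs.filter (above key hd)).length) (m := 1) hM).1
          (by omega)
        have := List.length_pos_iff.2 hne
        omega
      unfold selectPhases
      refine Hoare.bind (R := fun b f' s' => b = [] ∧ f' = f₂ ∧ s' = { s₂ with mem := [] })
        (Hoare.keepMem_bind (by simp) (Hoare.ret ⟨rfl, rfl, rfl⟩)) ?_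
      rintro _ _ _ ⟨rfl, rfl, rfl⟩
      refine Hoare.ret ⟨q, ?_, hqs, ?_, rfl, ?_⟩
      · simpa [hrest] using hperm
      · rw [List.append_nil]
        exact hout
      · rw [List.append_nil, zero_add, one_mul]
        exact hst
    · have hR := hR'.resolve_right hp0
      have hne : rest ≠ [] := by
        rintro rfl
        have h2 := (lt_ceilDiv_iff (n := (xs.filter (above key hd)).length) (m := 1) hM).1
          (by omega)
        simp at hlenq
        omega
      have hqM' := hfull hne
      have has₃ : IsArray B s₂.ext f₂ as xs := has.step hst
      have hp' : p = ceilDiv (xs.filter (above key [y])).length M := by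
        have h1 := ceilDiv_add_mul rest.length 1 hM
        rw [one_mul, ← hqM', hlenq, hqM', ← hp, ← hR.length_eq] at h1
        omega
      refine (ih (fun h => hnd (by omega)) [y] f₂ { s₂ with mem := [y] } (by simp) rfl has₃ hp').bind ?_
      rintro out' f₄ s₄ ⟨zs, hz₁, hz₂, hz₃, hz₄, hz₅⟩
      refine Hoare.ret ⟨q ++ zs, ?_, ?_, ?_, hz₄, ?_⟩
      · exact ((hz₁.trans hR).append_left q).trans hperm
      · exact List.pairwise_append.2 ⟨hqs, hz₂, fun x hx z hz =>
          hle x hx z ((hz₁.trans hR).mem_iff.1 hz)⟩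
      · exact (hout.step (s := s₂) hz₅).append hB hz₃ (hqM' ▸ hBM)
      · have := hst.trans (s' := s₂) hz₅
        refine this.mono (le_of_eq (by ring)) (by simp)

theorem selectionSort_spec {M : ℕ} (hB : 0 < B) (hM : 0 < M) (hBM : B ∣ M) (hS : M + B + 1 ≤ S)
    (as : List ℕ) (xs : List ρ) (hnd : (xs.map key).Nodup) (f : ℕ) (s : State ρ)
    (hm : s.mem = []) (has : IsArray B s.ext f as xs) :
    Hoare key B S 0 (selectionSort M B as xs.length) f s
      fun out f' s' => ∃ zs : List ρ, zs.Perm xs ∧ Sorted key zs ∧ IsArray B s'.ext f' out zs ∧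
        s'.mem = [] ∧ Step f s f' s' (ceilDiv xs.length M * as.length) out.length := by
  have h0 : xs.filter (above key []) = xs := List.filter_eq_self.2 (by simp [above])
  have := selectPhases_spec hB hM hBM hS as xs (ceilDiv xs.length M) (fun _ => hnd) [] f s (by simp)
    hm has (by rw [h0])
  rw [h0] at this
  exact this

theorem selectPhases_one_spec {M : ℕ} (hB : 0 < B) (hM : 0 < M) (hBM : B ∣ M) (hS : M + B + 1 ≤ S)
    (as : List ℕ) (xs : List ρ) (hx : 0 < xs.length) (hx' : xs.length ≤ M) (f : ℕ) (s : State ρ)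
    (hm : s.mem = []) (has : IsArray B s.ext f as xs) :
    Hoare key B S 0 (selectPhases M B as 1 0) f s
      fun out f' s' => ∃ zs : List ρ, zs.Perm xs ∧ Sorted key zs ∧ IsArray B s'.ext f' out zs ∧
        s'.mem = [] ∧ Step f s f' s' as.length out.length := by
  have h0 : xs.filter (above key []) = xs := List.filter_eq_self.2 (by simp [above])
  have h1 : 1 = ceilDiv xs.length M := by
    have h2 := (ceilDiv_le_iff (n := xs.length) (m := 1) hM).2 (by omega)
    have h3 := (lt_ceilDiv_iff (n := xs.length) (m := 0) hM).2 (by omega)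
    omega
  have := selectPhases_spec hB hM hBM hS as xs 1 (fun h => by omega) [] f s (by simp)
    hm has (by rw [h0]; exact h1)
  rw [h0, one_mul] at this
  exact this

end Selection
/-! ### Copying -/

section Gather

variable {ρ κ : Type*} [LinearOrder κ] {key : ρ → κ} {B S : ℕ}

/-- The list `D` has been output: its full blocks have been written from address `f₀` on, and the
remaining `q` records are buffered. -/
def Gathered (B f₀ : ℕ) (D : List ρ) (q : ℕ) (out : List ℕ) (f : ℕ) (s : State ρ) : Prop :=
  out = List.range' f₀ out.length ∧ f = f₀ + out.length ∧ q < B ∧ D.length = out.length * B + q ∧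
    ∀ i < out.length, s.ext (f₀ + i) = (D.drop (i * B)).take B

/-- The buffer is the part of the output `D` after its last full block. A selected record is
duplicated in front of the input block, so at most `q + 1 + blk.length ≤ 2 * B` records are held. -/
theorem gatherBlock_spec (hS : 2 * B ≤ S) (f₀ : ℕ) (blk : List ρ)
    (hblk : blk.length ≤ B) (ps : List ℕ) : (∀ p ∈ ps, p < blk.length) →
    ∀ (q : ℕ) (out : List ℕ) (D : List ρ) (f : ℕ) (s : State ρ), Gathered B f₀ D q out f s →
    s.mem = D.drop (out.length * B) ++ blk →
    Hoare key B S 0 (gatherBlock B blk.length ps q out) f s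
      fun r f' s' => Gathered B f₀ (D ++ pick blk ps) r.1 r.2 f' s' ∧
        s'.mem = (D ++ pick blk ps).drop (r.2.length * B) ∧ out.length ≤ r.2.length ∧
        Step f s f' s' 0 (r.2.length - out.length) := by
  induction ps with
  | nil =>
    intro _ q out D f s hg hm
    unfold gatherBlock
    refine Hoare.keepMem_bind (by simp; have := hg.2.2.1; omega) (Hoare.ret ?_)
    have hq : (D.drop (out.length * B)).length = q := by
      rw [List.length_drop, hg.2.2.2.1]
      omega
    rw [pick_nil, List.append_nil]
    refine ⟨hg, ?_, le_rfl, Step.refl⟩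
    change pick s.mem (List.range q) = _
    rw [hm, pick_range, ← hq, List.take_left]
  | cons p ps ih =>
    intro hps q out D f s hg hm
    obtain ⟨ho, hf, hqB, hD, hext⟩ := hg
    have hp := hps p (by simp)
    have hq : (D.drop (out.length * B)).length = q := by
      rw [List.length_drop, hD]
      omega
    unfold gatherBlock
    refine Hoare.keepMem_bind (by simp; omega) ?_
    have hmem : pick s.mem (List.range q ++ [q + p] ++ List.range' q blk.length) =
        D.drop (out.length * B) ++ [blk[p]] ++ blk := by
      rw [pick_append, pick_append, pick_range, pick_range', hm, ← hq, List.take_left,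
        List.drop_left, List.take_length]
      congr 2
      rw [pick_singleton _ (by simp; omega), List.getElem_append_right (by omega)]
      simp
    rw [hmem]
    have hDp : D ++ pick blk (p :: ps) = (D ++ [blk[p]]) ++ pick blk ps := by
      rw [pick_cons _ _ hp]
      simp
    have hdrop : (D ++ [blk[p]]).drop (out.length * B) = D.drop (out.length * B) ++ [blk[p]] := by
      rw [List.drop_append_of_le_length (by omega)]
    have hext' : ∀ i < out.length, (D.drop (i * B)).take B = ((D ++ [blk[p]]).drop (i * B)).take B := by
      intro i hi
      have : (i + 1) * B ≤ out.length * B := Nat.mul_le_mul_right _ (by omega)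
      rw [add_mul] at this
      rw [List.drop_append_of_le_length (by omega), List.take_append_of_le_length]
      rw [List.length_drop]
      omega
    split_ifs with hqB'
    · refine Hoare.store_bind le_rfl ?_
      dsimp only
      refine Hoare.keepMem_bind (by simp; omega) ?_
      dsimp only
      have hl : (D.drop (out.length * B) ++ [blk[p]]).length = B := by
        rw [List.length_append, hq, List.length_singleton, hqB']
      have hst : ((D.drop (out.length * B) ++ [blk[p]] ++ blk).drop 0).take B =
          D.drop (out.length * B) ++ [blk[p]] := by
        rw [List.drop_zero, List.take_append_of_le_length hl.ge, List.take_of_length_le hl.le]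
      have hm' : pick (D.drop (out.length * B) ++ [blk[p]] ++ blk) (List.range' B blk.length) = blk := by
        rw [pick_range']
        conv_lhs => enter [2, 1]; rw [← hl]
        rw [List.drop_left, List.take_length]
      rw [hst, hm']
      have hfull : (D ++ [blk[p]]).length = (out ++ [f]).length * B := by
        simp only [List.length_append, List.length_singleton]
        rw [hD, add_mul]
        omega
      refine (ih (fun p hp => hps p (by simp [hp])) 0 (out ++ [f]) (D ++ [blk[p]]) (f + 1) _
        ⟨?_, ?_, by omega, by rw [hfull, add_zero], ?_⟩ ?_).imp ?_
      · rw [List.length_append, List.length_singleton, List.range'_concat, ← ho, hf, one_mul]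
      · simp
        omega
      · intro i hi
        simp only [List.length_append, List.length_singleton] at hi
        rcases Nat.lt_or_ge i out.length with h | h
        · rw [← hext' i h, ← hext i h]
          exact Function.update_of_ne (by omega) _ _
        · have : i = out.length := by omega
          subst this
          rw [← hf, hdrop, List.take_of_length_le hl.le]
          exact Function.update_self _ _ _
      · rw [← hfull, List.drop_length, List.nil_append]
      · rintro r f' s' ⟨h1, h2, h3, h4⟩
        rw [hDp]
        simp only [List.length_append, List.length_singleton] at h3
        refine ⟨h1, h2, by omega, ?_⟩
        refine ⟨by have := h4.1; omega, fun a ha => ?_, h4.2.2.1, ?_⟩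
        · rw [h4.2.1 a (by omega)]
          exact Function.update_of_ne (by omega) _ _
        · have := h4.2.2.2
          simp only [List.length_append, List.length_singleton] at this
          omega
    · refine (ih (fun p hp => hps p (by simp [hp])) (q + 1) out (D ++ [blk[p]]) f _
        ⟨ho, hf, by omega, ?_, ?_⟩ ?_).imp ?_
      · rw [List.length_append, hD, List.length_singleton]
        omega
      · intro i hi
        rw [← hext' i hi]
        exact hext i hi
      · rw [hdrop]
      · rintro r f' s' ⟨h1, h2, h3, h4⟩
        rw [hDp]
        exact ⟨h1, h2, h3, h4⟩

theorem gatherLoop_spec (hS : 2 * B ≤ S) (f₀ : ℕ) (sel : ℕ → ℕ → List ℕ) (as : List ℕ)  :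
    ∀ (b q : ℕ) (out : List ℕ) (D : List ρ) (f : ℕ) (s : State ρ), Gathered B f₀ D q out f s →
    s.mem = D.drop (out.length * B) → (∀ a ∈ as, a < f) → (∀ a ∈ as, (s.ext a).length ≤ B) →
    (∀ e ∈ as.zipIdx b, ∀ p ∈ sel e.2 (s.ext e.1).length, p < (s.ext e.1).length) →
    Hoare key B S 0 (gatherLoop B sel as b q out) f s
      fun out' f' s' => ∃ E : List ρ,
        E = D ++ (as.zipIdx b).flatMap (fun e => pick (s.ext e.1) (sel e.2 (s.ext e.1).length)) ∧
        out' = List.range' f₀ (ceilDiv E.length B) ∧ IsArray B s'.ext f' out' E ∧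
        s'.mem = [] ∧ out.length ≤ out'.length ∧
        Step f s f' s' as.length (out'.length - out.length) := by
  induction as with
  | nil =>
    intro b q out D f s hg hm _ _ _
    obtain ⟨ho, hf, hqB, hD, hext⟩ := hg
    have hB : 0 < B := by omega
    unfold gatherLoop
    have hc := ceilDiv_add_mul q out.length hB
    split_ifs with hq
    · subst hq
      rw [ceilDiv_zero hB, ← hD] at hc
      refine Hoare.ret ⟨D, by simp, ?_, ⟨?_, ?_, ?_⟩, ?_, le_rfl, Step.refl⟩
      · rw [hc]
        exact ho
      · omega
      · intro a ha
        rw [ho] at ha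
        simp at ha
        omega
      · intro i hi
        rw [← hext i hi]
        congr 1
        conv_lhs => enter [1]; rw [ho]
        simp
      · rw [hm, List.drop_eq_nil_of_le (by omega)]
    · refine Hoare.store_bind (by omega) (Hoare.keepMem_bind (by simp) (Hoare.ret ?_))
      have hc1 : ceilDiv q B = 1 := by
        have h1 := (ceilDiv_le_iff (n := q) (m := 1) hB).2 (by omega)
        have h2 := (lt_ceilDiv_iff (n := q) (m := 0) hB).2 (by omega)
        omega
      rw [hc1, ← hD] at hc
      have hlast : (D.drop (out.length * B)).length = q := by
        rw [List.length_drop, hD]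
        omega
      refine ⟨D, by simp, ?_, ⟨?_, ?_, ?_⟩, rfl, by simp, ?_⟩
      · rw [hc, List.range'_concat, ← ho, hf, one_mul]
      · simp [hc]
      · intro a ha
        rw [ho] at ha
        simp at ha
        omega
      · intro i hi
        simp only [List.length_append, List.length_singleton] at hi
        have hget : (out ++ [f])[i]'(by simpa using hi) = f₀ + i := by
          rcases Nat.lt_or_ge i out.length with h | h
          · rw [List.getElem_append_left h]
            conv_lhs => enter [1]; rw [ho]
            simp
          · rw [List.getElem_append_right h]
            simp
            omega
        rw [hget]
        rcases Nat.lt_or_ge i out.length with h | h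
        · rw [← hext i h]
          exact Function.update_of_ne (by omega) _ _
        · have : i = out.length := by omega
          subst this
          rw [← hf]
          dsimp only
          rw [Function.update_self, hm, List.drop_zero, List.take_of_length_le hlast.le,
            List.take_of_length_le (by omega)]
      · refine ⟨by omega, fun a ha => ?_, by simp, by simp⟩
        exact Function.update_of_ne (by omega) _ _
  | cons a as ih =>
    intro b q out D f s hg hm hlt hlen hsel
    have hq : (D.drop (out.length * B)).length = q := by
      rw [List.length_drop, hg.2.2.2.1]
      omega
    have hqB := hg.2.2.1
    have hal := hlen a (by simp)
    unfold gatherLoop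
    refine Hoare.readBlock_bind (by rw [hm, hq]; omega) ?_
    refine (gatherBlock_spec hS f₀ (s.ext a) hal (sel b (s.ext a).length)
      (hsel (a, b) (by simp [List.zipIdx_cons])) q out D f
      { s with mem := s.mem ++ s.ext a, reads := s.reads + 1 } hg (congrArg (· ++ s.ext a) hm)).bind ?_
    rintro r f₁ s₁ ⟨hg₁, hm₁, hle, hst⟩
    have hex : ∀ a' ∈ as, s₁.ext a' = s.ext a' := fun a' ha' => hst.2.1 a' (hlt a' (by simp [ha']))
    refine (ih (b + 1) r.1 r.2 _ f₁ s₁ hg₁ hm₁ ?_ ?_ ?_).imp ?_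
    · exact fun a' ha' => lt_of_lt_of_le (hlt a' (by simp [ha'])) hst.1
    · intro a' ha'
      rw [hex a' ha']
      exact hlen a' (by simp [ha'])
    · intro e he
      rw [hex e.1 (List.fst_mem_of_mem_zipIdx he)]
      exact hsel e (by rw [List.zipIdx_cons]; exact List.mem_cons_of_mem _ he)
    · rintro out' f' s' ⟨E, h1, h2, h3, h4, h5, h6⟩
      refine ⟨E, ?_, h2, h3, h4, hle.trans h5, ?_⟩
      · rw [h1, List.zipIdx_cons, List.flatMap_cons, List.append_assoc]
        congr 2
        refine List.flatMap_congr fun e he => ?_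
        rw [hex _ (List.fst_mem_of_mem_zipIdx he)]
      · have hst' : Step f s f₁ s₁ 1 (r.2.length - out.length) :=
          ⟨hst.1, hst.2.1, by have := hst.2.2.1; simp only at this; omega, hst.2.2.2⟩
        refine (hst'.trans h6).mono ?_ ?_
        · simp
          omega
        · omega

theorem compact_spec (hB : 0 < B) (hS : 2 * B ≤ S) (as : List ℕ) (f : ℕ) (s : State ρ)
    (hm : s.mem = []) (hlt : ∀ a ∈ as, a < f) (hlen : ∀ a ∈ as, (s.ext a).length ≤ B) :
    Hoare key B S 0 (compact B as) f s
      fun out f' s' => out = List.range' f (ceilDiv (as.flatMap s.ext).length B) ∧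
        IsArray B s'.ext f' out (as.flatMap s.ext) ∧ s'.mem = [] ∧
        Step f s f' s' as.length out.length := by
  refine (gatherLoop_spec hS f (fun _ cnt => List.range cnt) as 0 0 [] [] f s
    ⟨by simp, by simp, hB, by simp, by simp⟩ (by simpa using hm) hlt hlen (by simp)).imp ?_
  rintro out f' s' ⟨E, h1, h2, h3, h4, h5, h6⟩
  have : E = as.flatMap s.ext := by
    rw [h1, List.nil_append]
    simp only [pick_range, List.take_length]
    conv_rhs => rw [← List.zipIdx_map_fst 0 as, List.flatMap_map]
  subst this
  exact ⟨h2, h3, h4, by simpa using h6⟩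

/-- Block numbers increase weakly along a sorted list of positions, so the positions in block `b`
form a prefix of those in blocks from `b` on. One scan of the blocks therefore meets the positions
in order. -/
theorem filter_le_sorted (g : ℕ → ℕ) (hg : Monotone g) (b : ℕ) (pos : List ℕ)
    (h : pos.Pairwise (· ≤ ·)) :
    pos.filter (fun p => decide (b ≤ g p)) =
      pos.filter (fun p => g p == b) ++ pos.filter (fun p => decide (b + 1 ≤ g p)) := by
  induction pos with
  | nil => rfl
  | cons p pos ih =>
    obtain ⟨h1, h2⟩ := List.pairwise_cons.1 h
    have ih' := ih h2
    rcases lt_trichotomy (g p) b with hp | hp | hp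
    · rw [List.filter_cons_of_neg (by simpa using hp), List.filter_cons_of_neg (by simpa using hp.ne),
        List.filter_cons_of_neg (by simpa using hp.le), ih']
    · rw [List.filter_cons_of_pos (by simp [hp]), List.filter_cons_of_pos (by simp [hp]),
        List.filter_cons_of_neg (by simp [hp]), ih', List.cons_append]
    · have hall : ∀ x ∈ p :: pos, b < g x := by
        intro x hx
        rcases List.mem_cons.1 hx with rfl | hx
        · exact hp
        · exact lt_of_lt_of_le hp (hg (h1 x hx))
      rw [List.filter_eq_self.2 (fun x hx => by simpa using (hall x hx).le),
        List.filter_eq_nil_iff.2 (fun x hx => by simpa using (hall x hx).ne'),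
        List.filter_eq_self.2 (fun x hx => by simpa using hall x hx), List.nil_append]

theorem flatMap_pick_blocks (hB : 0 < B) (ext : ℕ → List ρ) (xs : List ρ) (pos : List ℕ)
    (hpos : ∀ p ∈ pos, p < xs.length) (hsort : pos.Pairwise (· ≤ ·)) (as : List ℕ) (b : ℕ)
    (hlen : xs.length ≤ (b + as.length) * B)
    (h : ∀ i (hi : i < as.length), ext as[i] = (xs.drop ((b + i) * B)).take B) :
    (as.zipIdx b).flatMap
        (fun e => pick (ext e.1) ((pos.filter fun p => p / B == e.2).map fun p => p % B)) =
      pick xs (pos.filter fun p => decide (b ≤ p / B)) := by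
  induction as generalizing b with
  | nil =>
    have : pos.filter (fun p => decide (b ≤ p / B)) = [] := by
      rw [List.filter_eq_nil_iff]
      intro p hp
      have h1 := hpos p hp
      simp only [List.length_nil, add_zero] at hlen
      have : p / B < b := (Nat.div_lt_iff_lt_mul hB).2 (by omega)
      simpa using this
    rw [this]
    rfl
  | cons a as ih =>
    rw [List.zipIdx_cons, List.flatMap_cons, ih (b + 1),
      filter_le_sorted (· / B) (fun x y hxy => Nat.div_le_div_right hxy) b pos hsort, pick_append]
    · congr 1
      have h0 := h 0 (by simp)
      simp only [List.getElem_cons_zero, add_zero] at h0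
      rw [h0]
      simp only [pick, List.filterMap_map]
      refine List.filterMap_congr fun p hp => ?_
      simp only [List.mem_filter, beq_iff_eq] at hp
      have h1 := Nat.div_add_mod p B
      rw [hp.2] at h1
      rw [Function.comp_apply, List.getElem?_take_of_lt (Nat.mod_lt _ hB), List.getElem?_drop,
        mul_comm b, h1]
    · simp only [List.length_cons] at hlen
      refine hlen.trans (le_of_eq ?_)
      ring
    · intro i hi
      have := h (i + 1) (by simpa using hi)
      simp only [List.getElem_cons_succ] at this
      rw [this]
      congr 2
      ring

theorem gatherPositions_spec (hB : 0 < B) (hS : 2 * B ≤ S) (as pos : List ℕ) (xs : List ρ)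
    (hpos : ∀ p ∈ pos, p < xs.length) (hsort : pos.Pairwise (· ≤ ·)) (f : ℕ) (s : State ρ)
    (hm : s.mem = []) (has : IsArray B s.ext f as xs) :
    Hoare key B S 0 (gatherPositions B as pos) f s
      fun out f' s' => IsArray B s'.ext f' out (pick xs pos) ∧ s'.mem = [] ∧
        Step f s f' s' as.length out.length := by
  unfold gatherPositions
  refine (gatherLoop_spec hS f _ as 0 0 [] [] f s
    ⟨by simp, by simp, hB, by simp, by simp⟩ (by simpa using hm) has.2.1 has.length_block ?_).imp ?_
  · intro e he p hp
    obtain ⟨x, i⟩ := e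
    obtain ⟨hi, hx⟩ := List.mem_zipIdx' he
    simp only [List.mem_map, List.mem_filter, beq_iff_eq] at hp
    obtain ⟨p, ⟨hp, hpi⟩, rfl⟩ := hp
    have h1 := Nat.div_add_mod p B
    have h2 := Nat.mod_lt p hB
    have h3 := hpos p hp
    dsimp only
    rw [hx, has.2.2 i (by omega), List.length_take, List.length_drop, mul_comm i, ← hpi]
    omega
  · rintro out f' s' ⟨E, h1, h2, h3, h4, h5, h6⟩
    have h7 := flatMap_pick_blocks hB s.ext xs pos hpos hsort as 0
      (by rw [zero_add, has.1]; exact le_ceilDiv_mul _ hB) (by simpa using has.2.2)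
    have : E = pick xs pos := by
      rw [h1, List.nil_append, h7]
      simp
    subst this
    exact ⟨h3, h4, by simpa using h6⟩

end Gather
/-! ### Binary mergesort -/

section Merge

variable {ρ κ : Type*} [LinearOrder κ] {key : ρ → κ} {B S : ℕ}

/-- The hypothesis `hinj` allows a record to occur repeatedly but not two records with equal keys.
This suits samples drawn with replacement, and still makes the sorted order unique. -/
theorem eq_of_perm_of_sorted {l l' : List ρ} (hp : l.Perm l') (h : Sorted key l)
    (h' : Sorted key l') (hinj : ∀ x ∈ l, ∀ y ∈ l, key x = key y → x = y) : l = l' := by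
  refine hp.eq_of_pairwise ?_ h h'
  intro a b ha hb h1 h2
  exact hinj a ha b (hp.mem_iff.2 hb) (le_antisymm h1 h2)

/-- It suffices to remember how many records of a run have been output: up to copies of the same
record, these are the first ones of the run. -/
theorem drop_perm_of_sorted {T R Z : List ρ} (hp : (T ++ R).Perm Z) (hZ : Sorted key Z)
    (hT : Sorted key T) (hTR : ∀ x ∈ T, ∀ y ∈ R, key x ≤ key y)
    (hinj : ∀ x ∈ Z, ∀ y ∈ Z, key x = key y → x = y) : (Z.drop T.length).Perm R := by
  have h1 : T ++ sortK key R = Z := by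
    refine eq_of_perm_of_sorted (((sortK_perm key R).append_left T).trans hp) ?_ hZ ?_
    · exact List.pairwise_append.2 ⟨hT, sorted_sortK key R, fun x hx y hy =>
        hTR x hx y ((sortK_perm key R).mem_iff.1 hy)⟩
    · intro x hx y hy
      have hm := fun z => (((sortK_perm key R).append_left T).trans hp).mem_iff (a := z)
      exact hinj x ((hm x).1 hx) y ((hm y).1 hy)
  rw [← h1, List.drop_left]
  exact sortK_perm key R

theorem leAt_map {α : Type*} (g : α → ρ) (l : List α) :
    leAt key (l.map g) = leAt (key ∘ g) l := by
  funext i j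
  simp only [leAt, List.getElem?_map]
  rcases l[i]? with _ | x <;> rcases l[j]? with _ | y <;> rfl

/-- The list `T` pairs each record in memory with its run. The machine holds the first components
and the program the second ones, and a single selection on the pairs describes both. -/
theorem absorb_spec (hS : 2 * B ≤ S) (d : ℕ) (tag : Bool) (T : List (ρ × Bool)) (a f : ℕ)
    (s : State ρ) (hm : s.mem = T.map Prod.fst) (hT : T.length ≤ B) (ha : (s.ext a).length ≤ B) :
    Hoare key B S 0 (absorb B d tag (T.map Prod.snd) a) f s fun tags f' s' =>
      ∃ T' : List (ρ × Bool), tags = T'.map Prod.snd ∧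
        s' = { s with mem := T'.map Prod.fst, reads := s.reads + 1 } ∧ f' = f ∧
        IsTop (key ∘ Prod.fst) B T' (T ++ ((s.ext a).drop d).map fun x => (x, tag)) := by
  unfold absorb
  refine Hoare.readBlock_bind (by rw [hm, List.length_map]; omega) (Hoare.comparisons_bind ?_)
  dsimp only
  set W : List (ρ × Bool) := T ++ (s.ext a).map fun x => (x, tag) with hW
  have hmem : s.mem ++ s.ext a = W.map Prod.fst := by
    rw [hm, hW, List.map_append, List.map_map]
    simp [Function.comp_def]
  rw [hmem, leAt_map, List.length_map]
  set base := List.range T.length ++ List.range' (T.length + d) ((s.ext a).length - d) with hbase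
  have hbv : ∀ i ∈ base, i < W.length := by
    intro i hi
    simp only [hbase, List.mem_append, List.mem_range, List.mem_range'_1] at hi
    simp only [hW, List.length_append, List.length_map]
    omega
  have htop := isTop_pick_mergeSort (key := key ∘ Prod.fst) B W hbv
  set ids := (base.mergeSort (leAt (key ∘ Prod.fst) W)).take B with hids
  have hiv : ∀ i ∈ ids, i < W.length := fun i hi =>
    hbv i ((List.mergeSort_perm _ _).mem_iff.1 (List.mem_of_mem_take hi))
  have hpb : pick W base = T ++ ((s.ext a).drop d).map fun x => (x, tag) := by
    rw [hbase, pick_append, pick_range, pick_range', hW, List.take_left, ← List.drop_drop,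
      List.drop_left, ← List.map_drop, List.take_of_length_le (by simp)]
  rw [hpb] at htop
  refine Hoare.keepMem_bind (by simp [hids]; omega) (Hoare.ret ⟨pick W ids, ?_, ?_, rfl, htop⟩)
  · clear_value ids
    clear htop hids
    induction ids with
    | nil => rfl
    | cons i ids ih =>
      have hi := hiv i (by simp)
      rw [pick_cons _ _ hi, List.map_cons, List.map_cons, ih fun j hj => hiv j (by simp [hj])]
      congr 1
      rcases Nat.lt_or_ge i T.length with h | h
      · simp [hW, h]
      · have : (T.map Prod.snd).length ≤ i := by simpa using h
        rw [List.getD_eq_default _ _ this]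
        simp [hW, List.getElem_append_right h]
  · rw [pick_map]

/-- Although at most two blocks are read, the selection is correct for the whole remaining run: a
position `c` inside a block and the following block cover the next `B` records, and by
`IsTop.append_right` later ones cannot matter. -/
theorem absorbRun_spec (hB : 0 < B) (hS : 2 * B ≤ S) (c : ℕ) (tag : Bool) (as : List ℕ)
    (X : List ρ) (hX : Sorted key X) (T A : List (ρ × Bool)) (f : ℕ) (s : State ρ)
    (hm : s.mem = T.map Prod.fst) (hT : IsTop (key ∘ Prod.fst) B T A)
    (has : IsArray B s.ext f as X) :
    Hoare key B S 0 (absorbRun B c tag as (T.map Prod.snd)) f s fun tags f' s' =>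
      ∃ T' : List (ρ × Bool), tags = T'.map Prod.snd ∧ s'.mem = T'.map Prod.fst ∧
        IsTop (key ∘ Prod.fst) B T' (A ++ (X.drop c).map fun x => (x, tag)) ∧
        f' = f ∧ s'.ext = s.ext ∧ Step f s f' s' 2 0 := by
  have hdm := Nat.div_add_mod c B
  have hmod := Nat.mod_lt c hB
  have hXl : X.length ≤ as.length * B := by
    rw [has.1]
    exact le_ceilDiv_mul _ hB
  have hcB : B * (c / B) = c / B * B := mul_comm _ _
  unfold absorbRun
  have hblock : ∀ i (hi : i < as.length), s.ext as[i] = (X.drop (i * B)).take B := has.2.2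
  rcases hd : as.drop (c / B) with _ | ⟨a, _ | ⟨a', rest⟩⟩
  · have h1 := List.drop_eq_nil_iff.1 hd
    have h2 : as.length * B ≤ c / B * B := Nat.mul_le_mul_right _ h1
    refine Hoare.ret ⟨T, rfl, hm, ?_, rfl, rfl, Step.refl⟩
    rw [List.drop_eq_nil_of_le (by omega)]
    simpa using hT
  · have hl := congrArg List.length hd
    simp only [List.length_drop, List.length_cons, List.length_nil] at hl
    have hlt : c / B < as.length := by omega
    have ha : a = as[c / B] := by
      have := List.drop_eq_getElem_cons hlt
      rw [hd] at this
      exact (List.cons.inj this).1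
    have hb := hblock _ hlt
    rw [← ha] at hb
    refine (absorb_spec hS (c % B) tag T a f s hm hT.length_le (by rw [hb]; simp)).imp ?_
    rintro tags f' s' ⟨T', h1, rfl, rfl, h4⟩
    refine ⟨T', h1, rfl, ?_, rfl, rfl, le_rfl, fun _ _ => rfl, by simp, by simp⟩
    have h5 : as.length * B = c / B * B + B := by
      rw [show as.length = c / B + 1 by omega, add_mul, one_mul]
    rw [hb, List.take_of_length_le (by rw [List.length_drop]; omega), List.drop_drop,
      show c / B * B + c % B = c by omega] at h4
    exact hT.absorb h4
  · have hl := congrArg List.length hd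
    simp only [List.length_drop, List.length_cons] at hl
    have hlt : c / B + 1 < as.length := by omega
    have h0 := List.drop_eq_getElem_cons (show c / B < as.length by omega)
    rw [hd] at h0
    have ha : a = as[c / B] := (List.cons.inj h0).1
    have h0' := (List.cons.inj h0).2
    rw [List.drop_eq_getElem_cons hlt] at h0'
    have ha' : a' = as[c / B + 1] := (List.cons.inj h0').1
    have hb := hblock _ (show c / B < as.length by omega)
    have hb' := hblock _ hlt
    rw [← ha] at hb
    rw [← ha'] at hb'
    refine (absorb_spec hS (c % B) tag T a f s hm hT.length_le (by rw [hb]; simp)).bind ?_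
    rintro tags f₁ s₁ ⟨T₁, rfl, rfl, rfl, h4⟩
    refine (absorb_spec hS 0 tag T₁ a' f₁ _ rfl h4.length_le (by dsimp only; rw [hb']; simp)).imp ?_
    rintro tags f₂ s₂ ⟨T₂, h1, rfl, rfl, h5⟩
    refine ⟨T₂, h1, rfl, ?_, rfl, rfl, le_rfl, fun _ _ => rfl, by simp, by simp⟩
    dsimp only at h5
    have hE1 : (s.ext a).drop (c % B) = (X.drop c).take (B - c % B) := by
      rw [hb, List.drop_take, List.drop_drop, show c / B * B + c % B = c by omega]
    have hE2 : (s.ext a').drop 0 = ((X.drop c).drop (B - c % B)).take B := by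
      rw [hb', List.drop_zero, List.drop_drop, add_mul, one_mul,
        show c + (B - c % B) = c / B * B + B by omega]
    rw [hE1] at h4
    rw [hE2] at h5
    have h6 := (hT.absorb h4).absorb h5
    set E := X.drop c with hE
    have hEs : Sorted key E := hX.sublist (List.drop_sublist _ _)
    set u := B - c % B
    -- If the run continues beyond the second block, then that block is full and its `B` records lie
    -- below everything unread.
    have h7 := h6.append_right (E := ((E.drop u).drop B).map fun x => (x, tag)) (by
      intro hne
      refine ⟨((E.drop u).take B).map fun x => (x, tag), ?_, ?_, ?_⟩
      · exact (List.sublist_append_right _ _).subperm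
      · have : (E.drop u).drop B ≠ [] := by simpa using hne
        have := List.length_pos_iff.2 this
        rw [List.length_drop] at this
        simp only [List.length_map, List.length_take]
        omega
      · intro x hx y hy
        obtain ⟨x₀, hx₀, rfl⟩ := List.mem_map.1 hx
        obtain ⟨y₀, hy₀, rfl⟩ := List.mem_map.1 hy
        have hs' : Sorted key ((E.drop u).take B ++ (E.drop u).drop B) := by
          rw [List.take_append_drop]
          exact hEs.sublist (List.drop_sublist _ _)
        exact (List.pairwise_append.1 hs').2.2 x₀ hx₀ y₀ hy₀)
    rw [List.append_assoc, List.append_assoc, ← List.map_append, List.take_append_drop,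
      ← List.map_append, List.take_append_drop] at h7
    exact h7

/-- No records are kept between output blocks; instead up to two blocks of each run are read again.
This costs four reads per write and makes the state of the merge just the pair `c₁`, `c₂`. -/
theorem mergeRuns_spec (hB : 0 < B) (hS : 2 * B ≤ S) (xs ys : List ℕ) (X Y : List ρ)
    (hX : Sorted key X) (hY : Sorted key Y)
    (hiX : ∀ x ∈ X, ∀ y ∈ X, key x = key y → x = y)
    (hiY : ∀ x ∈ Y, ∀ y ∈ Y, key x = key y → x = y) (t : ℕ) :
    ∀ (c₁ c₂ f : ℕ) (s : State ρ), s.mem = [] → IsArray B s.ext f xs X → IsArray B s.ext f ys Y →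
    t = ceilDiv ((X.drop c₁ ++ Y.drop c₂).length) B →
    Hoare key B S 0 (mergeRuns B xs ys t c₁ c₂) f s fun out f' s' =>
      ∃ Z : List ρ, Z.Perm (X.drop c₁ ++ Y.drop c₂) ∧ Sorted key Z ∧ IsArray B s'.ext f' out Z ∧
        s'.mem = [] ∧ Step f s f' s' (4 * t) t := by
  induction t with
  | zero =>
    intro c₁ c₂ f s hm _ _ ht
    have h0 : X.drop c₁ ++ Y.drop c₂ = [] := by
      have := (ceilDiv_le_iff (n := (X.drop c₁ ++ Y.drop c₂).length) (m := 0) hB).1 ht.ge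
      exact List.length_eq_zero_iff.1 (by omega)
    exact Hoare.ret ⟨[], by rw [h0], List.Pairwise.nil, isArray_nil hB, hm, Step.refl⟩
  | succ t ih =>
    intro c₁ c₂ f s hm hxs hys ht
    unfold mergeRuns
    refine (absorbRun_spec hB hS c₁ true xs X hX [] [] f s hm isTop_nil hxs).bind ?_
    rintro tags₁ f₁ s₁ ⟨T₁, rfl, hm₁, htop₁, rfl, he₁, hst₁⟩
    refine (absorbRun_spec hB hS c₂ false ys Y hY T₁ _ f₁ s₁ hm₁ htop₁ (by rw [he₁]; exact hys)).bind ?_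
    rintro tags f₂ s₂ ⟨T, rfl, hm₂, htop, rfl, he₂, hst₂⟩
    rw [List.nil_append] at htop
    have hTB := htop.length_le
    have hTl := htop.length_eq
    rw [List.length_append, List.length_map, List.length_map, ← List.length_append] at hTl
    refine Hoare.store_bind (by simpa using hTB) (Hoare.keepMem_bind (by simp) ?_)
    dsimp only
    rw [List.drop_zero, hm₂, List.length_map, List.take_of_length_le (by simp)]
    obtain ⟨hTs, -, R, hperm, hTR, hfull⟩ := htop
    -- Restricted to one tag, the split of all remaining records into output and rest is a split of
    -- one run. Hence the counts of the tags give the new positions in the runs.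
    have hpart : ∀ b : Bool, ∀ (Z : List ρ), Sorted key Z →
        (∀ x ∈ Z, ∀ y ∈ Z, key x = key y → x = y) →
        (((X.drop c₁).map (fun x => (x, true)) ++ (Y.drop c₂).map (fun x => (x, false))).filter
          (fun e => e.2 == b)).map Prod.fst = Z →
        (Z.drop ((T.map Prod.snd).count b)).Perm ((R.filter (fun e => e.2 == b)).map Prod.fst) := by
      intro b Z hZ hiZ hZe
      have h1 := (hperm.filter (fun e => e.2 == b)).map Prod.fst
      rw [hZe, List.filter_append, List.map_append] at h1
      have h2 : (T.map Prod.snd).count b = ((T.filter (fun e => e.2 == b)).map Prod.fst).length := by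
        rw [List.length_map, List.count, List.countP_map, List.countP_eq_length_filter]
        rfl
      rw [h2]
      refine drop_perm_of_sorted h1 hZ ?_ ?_ hiZ
      · rw [Sorted, List.pairwise_map]
        exact List.Pairwise.filter _ hTs
      · intro x hx y hy
        obtain ⟨x₀, hx₀, rfl⟩ := List.mem_map.1 hx
        obtain ⟨y₀, hy₀, rfl⟩ := List.mem_map.1 hy
        exact hTR x₀ (List.mem_filter.1 hx₀).1 y₀ (List.mem_filter.1 hy₀).1
    have hp1 := hpart true (X.drop c₁) (hX.sublist (List.drop_sublist _ _))
      (fun x hx y hy => hiX x (List.mem_of_mem_drop hx) y (List.mem_of_mem_drop hy))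
      (by rw [List.filter_append, List.filter_map, List.filter_map]; simp [Function.comp_def])
    have hp2 := hpart false (Y.drop c₂) (hY.sublist (List.drop_sublist _ _))
      (fun x hx y hy => hiY x (List.mem_of_mem_drop hx) y (List.mem_of_mem_drop hy))
      (by rw [List.filter_append, List.filter_map, List.filter_map]; simp [Function.comp_def])
    rw [List.drop_drop] at hp1 hp2
    set d₁ := c₁ + (T.map Prod.snd).count true
    set d₂ := c₂ + (T.map Prod.snd).count false
    have hR : (R.map Prod.fst).Perm (X.drop d₁ ++ Y.drop d₂) := by
      refine List.Perm.trans ?_ (hp1.append hp2).symm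
      rw [← List.map_append]
      refine List.Perm.map _ ?_
      have := List.filter_append_perm (fun e : ρ × Bool => e.2 == true) R
      refine this.symm.trans (List.Perm.append_left _ ?_)
      refine List.Perm.of_eq (List.filter_congr ?_)
      rintro ⟨x, b⟩ _
      cases b <;> rfl
    have hall : (T.map Prod.fst ++ R.map Prod.fst).Perm (X.drop c₁ ++ Y.drop c₂) := by
      have := hperm.map Prod.fst
      simpa [Function.comp_def] using this
    set s₃ : State ρ := {
      mem := pick (T.map Prod.fst) []
      ext := Function.update s₂.ext f₂ (T.map Prod.fst)
      reads := s₂.reads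
      writes := s₂.writes + 1 } with hs₃
    have hst₃ : Step f₂ s (f₂ + 1) s₃ 4 1 := by
      have := hst₁.trans hst₂
      refine ⟨by omega, fun a ha => ?_, this.2.2.1, Nat.add_le_add_right this.2.2.2 1⟩
      rw [← this.2.1 a ha]
      exact Function.update_of_ne ha.ne _ _
    have hlen := hall.length_eq
    have hlen' := hR.length_eq
    simp only [List.length_append, List.length_map] at hlen hlen' hTl ht
    have ht' : t = ceilDiv (X.drop d₁ ++ Y.drop d₂).length B := by
      simp only [List.length_append]
      rw [← hlen']
      by_cases hR0 : R = []
      · subst hR0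
        simp only [List.length_nil, ceilDiv_zero hB]
        have := (ceilDiv_le_iff (n := T.length) (m := 1) hB).2 (by omega)
        simp only [List.length_nil, add_zero] at hlen
        rw [hlen] at this
        omega
      · have h1 := hfull hR0
        have h2 := ceilDiv_add_mul R.length 1 hB
        rw [one_mul] at h2
        rw [← hlen, h1, h2] at ht
        omega
    refine (ih d₁ d₂ (f₂ + 1) s₃ rfl (hxs.step hst₃) (hys.step hst₃) ht').bind ?_
    rintro rest f₄ s₄ ⟨Z, hZp, hZs, hZa, hZm, hZst⟩
    have hZR := hZp.trans hR.symm
    refine Hoare.ret ⟨T.map Prod.fst ++ Z, (hZR.append_left _).trans hall, ?_, ?_, hZm, ?_⟩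
    · refine List.pairwise_append.2 ⟨by rw [List.pairwise_map]; exact hTs, hZs, ?_⟩
      intro x hx y hy
      obtain ⟨x₀, hx₀, rfl⟩ := List.mem_map.1 hx
      obtain ⟨y₀, hy₀, rfl⟩ := List.mem_map.1 (hZR.mem_iff.1 hy)
      exact hTR x₀ hx₀ y₀ hy₀
    · have hTpos : 0 < T.length := by
        have := (lt_ceilDiv_iff (n := (X.drop c₁).length + (Y.drop c₂).length) (m := 0) hB).1
          (by omega)
        omega
      have hblk : IsArray B s₄.ext f₄ [f₂] (T.map Prod.fst) := by
        refine ⟨?_, ?_, ?_⟩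
        · have h1 := (ceilDiv_le_iff (n := T.length) (m := 1) hB).2 (by omega)
          have h2 := (lt_ceilDiv_iff (n := T.length) (m := 0) hB).2 (by omega)
          simp only [List.length_map, List.length_singleton]
          omega
        · have := hZst.1
          simp
          omega
        · intro i hi
          simp only [List.length_singleton] at hi
          have : i = 0 := by omega
          subst this
          simp only [List.getElem_cons_zero, zero_mul, List.drop_zero]
          rw [hZst.2.1 _ (by omega), List.take_of_length_le (by simpa using hTB)]
          exact Function.update_self _ _ _
      by_cases hR0 : R = []
      · have hZ0 : Z = [] := by
          rw [hR0] at hZR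
          simpa using hZR
        have hr0 : rest = [] := by
          have := hZa.1
          rw [hZ0, List.length_nil, ceilDiv_zero hB] at this
          exact List.length_eq_zero_iff.1 this
        rw [hZ0, hr0, List.append_nil]
        exact hblk
      · exact hblk.append hB hZa (by rw [List.length_map, hfull hR0])
    · exact (hst₃.trans hZst).mono (by omega) (by omega)

theorem IsArray.take {ext : ℕ → List ρ} {f : ℕ} {as : List ℕ} {xs : List ρ} (hB : 0 < B)
    (h : IsArray B ext f as xs) {m : ℕ} (hm : m ≤ as.length) (hm' : m * B ≤ xs.length) :
    IsArray B ext f (as.take m) (xs.take (m * B)) := by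
  refine ⟨?_, fun a ha => h.2.1 a (List.mem_of_mem_take ha), fun i hi => ?_⟩
  · rw [List.length_take, List.length_take, min_eq_left hm, min_eq_left hm']
    have := ceilDiv_add_mul 0 m hB
    rw [ceilDiv_zero hB] at this
    simpa using this.symm
  · simp only [List.length_take] at hi
    rw [List.getElem_take, h.2.2 i (by omega), List.drop_take, List.take_take]
    congr 1
    have : (i + 1) * B ≤ m * B := Nat.mul_le_mul_right _ (by omega)
    rw [add_mul] at this
    omega

theorem IsArray.drop {ext : ℕ → List ρ} {f : ℕ} {as : List ℕ} {xs : List ρ} (hB : 0 < B)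
    (h : IsArray B ext f as xs) {m : ℕ} (hm' : m * B ≤ xs.length) :
    IsArray B ext f (as.drop m) (xs.drop (m * B)) := by
  refine ⟨?_, fun a ha => h.2.1 a (List.mem_of_mem_drop ha), fun i hi => ?_⟩
  · rw [List.length_drop, List.length_drop, h.1]
    have := ceilDiv_add_mul (xs.length - m * B) m hB
    rw [show m * B + (xs.length - m * B) = xs.length by omega] at this
    omega
  · simp only [List.length_drop] at hi
    rw [List.getElem_drop, h.2.2 _ (by omega), List.drop_drop, add_mul]

/-- Cutting at a block boundary keeps both halves arrays. Merging `b` blocks costs `b` writes and `4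
* b` reads, and halving `b` lowers `Nat.clog 2 b`, so the cost is linear in `b * (Nat.clog 2 b +
1)`. Depth `as.length` suffices because both halves have fewer blocks. -/
theorem ramMergeSort_spec {M : ℕ} (hB : 0 < B) (hM : 0 < M) (hBM : B ∣ M) (hS : M + B + 1 ≤ S)
    (fuel : ℕ) :
    ∀ (as : List ℕ) (xs : List ρ) (f : ℕ) (s : State ρ), as.length ≤ fuel → 0 < xs.length →
    (∀ x ∈ xs, ∀ y ∈ xs, key x = key y → x = y) → s.mem = [] → IsArray B s.ext f as xs →
    Hoare key B S 0 (ramMergeSort M B fuel as xs.length) f s fun out f' s' =>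
      ∃ Z : List ρ, Z.Perm xs ∧ Sorted key Z ∧ IsArray B s'.ext f' out Z ∧ s'.mem = [] ∧
        Step f s f' s' (4 * (as.length * (Nat.clog 2 as.length + 1)))
          (as.length * (Nat.clog 2 as.length + 1)) := by
  obtain ⟨μ, rfl⟩ := hBM
  have hμ : 0 < μ := Nat.pos_of_mul_pos_left hM
  have hMB : B * μ / B = μ := Nat.mul_div_cancel_left _ hB
  have hB2 : 2 * B ≤ S := by
    have : B * 1 ≤ B * μ := Nat.mul_le_mul_left _ hμ
    omega
  induction fuel with
  | zero =>
    intro as xs f s hf hx _ _ has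
    have := (lt_ceilDiv_iff (n := xs.length) (m := 0) hB).2 (by omega)
    have := has.1
    omega
  | succ fuel ih =>
    intro as xs f s hf hx hinj hm has
    have hb0 : 0 < as.length := by
      have := (lt_ceilDiv_iff (n := xs.length) (m := 0) hB).2 (by omega)
      have := has.1
      omega
    have hxl : xs.length ≤ as.length * B := by
      rw [has.1]
      exact le_ceilDiv_mul _ hB
    unfold ramMergeSort
    rw [hMB]
    split_ifs with hle
    · have hxM : xs.length ≤ B * μ := by
        rw [mul_comm B]
        exact hxl.trans (Nat.mul_le_mul_right _ hle)
      refine (selectPhases_one_spec hB hM (dvd_mul_right _ _) hS as xs hx hxM f s hm has).imp ?_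
      rintro out f' s' ⟨zs, h1, h2, h3, h4, h5⟩
      have hout : out.length = as.length := by rw [h3.1, has.1, h1.length_eq]
      refine ⟨zs, h1, h2, h3, h4, h5.mono ?_ ?_⟩
      · nlinarith
      · rw [hout]
        nlinarith
    · push Not at hle
      set h := as.length / 2 with hh
      have hh1 : 1 ≤ h := by omega
      have hhB : h * B < xs.length := by
        have := (lt_ceilDiv_iff (n := xs.length) (m := h) hB).1 (by rw [← has.1]; omega)
        exact this
      have ha1 := has.take hB (show h ≤ as.length by omega) hhB.le
      have ha2 := has.drop hB hhB.le
      have hl1 : (xs.take (h * B)).length = h * B := by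
        rw [List.length_take]
        omega
      have hl2 : (xs.drop (h * B)).length = xs.length - h * B := List.length_drop
      dsimp only
      rw [← hl2]
      conv => enter [5, 1, 5]; rw [← hl1]
      refine (ih (as.take h) (xs.take (h * B)) f s (by simp; omega)
        (by rw [hl1]; exact Nat.mul_pos hh1 hB)
        (fun x hx y hy => hinj x (List.mem_of_mem_take hx) y (List.mem_of_mem_take hy)) hm ha1).bind ?_
      rintro out₁ f₁ s₁ ⟨Z₁, hp₁, hs₁, har₁, hm₁, hst₁⟩
      refine (ih (as.drop h) (xs.drop (h * B)) f₁ s₁ (by simp; omega) (by omega)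
        (fun x hx y hy => hinj x (List.mem_of_mem_drop hx) y (List.mem_of_mem_drop hy)) hm₁
        (ha2.step hst₁)).bind ?_
      rintro out₂ f₂ s₂ ⟨Z₂, hp₂, hs₂, har₂, hm₂, hst₂⟩
      have hp12 := hp₁.append hp₂
      rw [List.take_append_drop] at hp12
      refine (mergeRuns_spec hB hB2 out₁ out₂ Z₁ Z₂ hs₁ hs₂ ?_ ?_ (ceilDiv xs.length B) 0 0 f₂ s₂ hm₂
        (har₁.step hst₂) har₂ ?_).imp ?_
      · intro x hx y hy
        exact hinj x (hp12.mem_iff.1 (List.mem_append_left _ hx)) y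
          (hp12.mem_iff.1 (List.mem_append_left _ hy))
      · intro x hx y hy
        exact hinj x (hp12.mem_iff.1 (List.mem_append_right _ hx)) y
          (hp12.mem_iff.1 (List.mem_append_right _ hy))
      · rw [List.drop_zero, List.drop_zero, hp12.length_eq]
      · rintro out f' s' ⟨Z, h1, h2, h3, h4, h5⟩
        rw [List.drop_zero, List.drop_zero] at h1
        have hc : Nat.clog 2 as.length = Nat.clog 2 ((as.length + 1) / 2) + 1 :=
          Nat.clog_of_two_le (by norm_num) (by omega)
        have hc1 : Nat.clog 2 (as.take h).length + 1 ≤ Nat.clog 2 as.length := by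
          rw [hc]
          have := Nat.clog_mono_right 2 (show (as.take h).length ≤ (as.length + 1) / 2 by
            rw [List.length_take]; omega)
          omega
        have hc2 : Nat.clog 2 (as.drop h).length + 1 ≤ Nat.clog 2 as.length := by
          rw [hc]
          have := Nat.clog_mono_right 2 (show (as.drop h).length ≤ (as.length + 1) / 2 by
            rw [List.length_drop]; omega)
          omega
        have hcost : (as.take h).length * (Nat.clog 2 (as.take h).length + 1) +
            (as.drop h).length * (Nat.clog 2 (as.drop h).length + 1) + as.length ≤
            as.length * (Nat.clog 2 as.length + 1) := by
          have e1 := Nat.mul_le_mul_left (as.take h).length hc1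
          have e2 := Nat.mul_le_mul_left (as.drop h).length hc2
          have e3 : (as.take h).length + (as.drop h).length = as.length := by
            rw [← List.length_append, List.take_append_drop]
          have e4 : (as.take h).length * Nat.clog 2 as.length +
              (as.drop h).length * Nat.clog 2 as.length = as.length * Nat.clog 2 as.length := by
            rw [← add_mul, e3]
          rw [mul_add as.length]
          omega
        rw [← has.1] at h5
        exact ⟨Z, h1.trans hp12, h2, h3, h4, ((hst₁.trans hst₂).trans h5).mono (by omega) (by omega)⟩

end Merge
/-! ### Partitioning -/

section PartitionLists

variable {α β : Type*}

theorem pick_drop (l : List α) (k : ℕ) (ids : List ℕ) :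
    pick (l.drop k) ids = pick l (ids.map fun i => k + i) := by
  simp only [pick, List.filterMap_map]
  refine List.filterMap_congr fun i _ => ?_
  simp

theorem pick_take_left (l : List α) (k : ℕ) {ids : List ℕ} (h : ∀ i ∈ ids, i < k) :
    pick (l.take k) ids = pick l ids := by
  refine List.filterMap_congr fun i hi => ?_
  rw [List.getElem?_take_of_lt (h i hi)]

theorem map_pick (l : List α) (g : α → β) (g' : ℕ → β) {ids : List ℕ} (h : ∀ i ∈ ids, i < l.length)
    (hg : ∀ i ∈ ids, ∀ hi : i < l.length, g' i = g l[i]) : (pick l ids).map g = ids.map g' := by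
  induction ids with
  | nil => rfl
  | cons i ids ih =>
    have hi := h i (by simp)
    rw [pick_cons _ _ hi, List.map_cons, List.map_cons, ih (fun j hj => h j (by simp [hj]))
      (fun j hj => hg j (by simp [hj])), hg i (by simp) hi]

theorem filter_pick (l : List α) (P : α → Bool) (p : ℕ → Bool) {ids : List ℕ}
    (h : ∀ i ∈ ids, i < l.length) (hp : ∀ i, ∀ hi : i < l.length, p i = P l[i]) :
    (pick l ids).filter P = pick l (ids.filter p) := by
  induction ids with
  | nil => rfl
  | cons i ids ih =>
    have hi := h i (by simp)
    have ih' := ih fun j hj => h j (by simp [hj])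
    rw [pick_cons _ _ hi, List.filter_cons, List.filter_cons, ← hp i hi]
    split_ifs
    · rw [pick_cons _ _ hi, ih']
    · exact ih'

theorem countP_range (l : List α) (P : α → Bool) (p : ℕ → Bool) {h : ℕ} (hl : h ≤ l.length)
    (hp : ∀ i, ∀ hi : i < l.length, p i = P l[i]) :
    (List.range h).countP p = (l.take h).countP P := by
  rw [List.countP_eq_length_filter, List.countP_eq_length_filter, List.range_eq_range']
  have := pick_filter_range' l p P 0 h fun j _ hj => hp j hj
  rw [List.drop_zero] at this
  rw [← this, length_pick]
  intro i hi
  have := List.mem_range'_1.1 (List.mem_filter.1 hi).1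
  omega

theorem filter_range_Ico (lo hi N : ℕ) :
    (List.range N).filter (fun p => decide (lo ≤ p ∧ p < hi)) =
      List.range' lo (min hi N - lo) := by
  induction N with
  | zero => simp
  | succ N ih =>
    rw [List.range_succ, List.filter_append, ih]
    by_cases h : lo ≤ N ∧ N < hi
    · rw [show min hi (N + 1) - lo = (min hi N - lo) + 1 by omega, List.range'_concat]
      simp [h]
      omega
    · rw [show min hi (N + 1) - lo = min hi N - lo by omega]
      simp
      omega

/-- The records of the list with tag `j`. -/
def tagged (T : List (α × ℕ)) (j : ℕ) : List α := (T.filter fun e => e.2 == j).map Prod.fst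

theorem tagged_append (T T' : List (α × ℕ)) (j : ℕ) :
    tagged (T ++ T') j = tagged T j ++ tagged T' j := by
  simp [tagged]

theorem length_tagged (T : List (α × ℕ)) (j : ℕ) :
    (tagged T j).length = (T.map Prod.snd).count j := by
  rw [tagged, List.length_map, List.count, List.countP_map, List.countP_eq_length_filter]
  rfl

theorem length_eq_sum_tagged (T : List (α × ℕ)) (j₀ j₁ : ℕ) (h : ∀ e ∈ T, j₀ ≤ e.2 ∧ e.2 < j₁) :
    T.length = ∑ j ∈ Finset.Ico j₀ j₁, (tagged T j).length := by
  induction T with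
  | nil => simp [tagged]
  | cons e T ih =>
    rw [List.length_cons, ih fun e' he' => h e' (by simp [he'])]
    have he := h e (by simp)
    have : ∀ j, (tagged (e :: T) j).length = (tagged T j).length + if e.2 = j then 1 else 0 := by
      intro j
      simp only [tagged, List.filter_cons, List.length_map, beq_iff_eq]
      split_ifs <;> simp
    simp only [this, Finset.sum_add_distrib]
    rw [Finset.sum_ite_eq, if_pos (Finset.mem_Ico.2 he)]

end PartitionLists

/-! ### Loading splitters and emptying buffers -/

section Partition

variable {ρ κ : Type*} [LinearOrder κ] {key : ρ → κ} {B S : ℕ}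

theorem loadRange_spec (lo hi W : ℕ) (hW : W + B ≤ S) (sp : List ρ) (as : List ℕ) :
    ∀ (b : ℕ) (H : List ρ) (f : ℕ) (s : State ρ), s.mem = H →
    (∀ i (hi : i < as.length), s.ext as[i] = (sp.drop ((b + i) * B)).take B) →
    (H ++ pick sp ((List.range' (b * B) (as.length * B)).filter
      fun p => decide (lo ≤ p ∧ p < hi))).length ≤ W →
    Hoare key B S 0 (loadRange B lo hi as b H.length) f s fun h f' s' =>
      h = s'.mem.length ∧ s'.mem = H ++ pick sp ((List.range' (b * B) (as.length * B)).filter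
        fun p => decide (lo ≤ p ∧ p < hi)) ∧ Step f s f' s' as.length 0 := by
  induction as with
  | nil =>
    intro b H f s hm _ _
    exact Hoare.ret ⟨by rw [hm], by simp [hm, pick], Step.refl⟩
  | cons a as ih =>
    intro b H f s hm hext hlen
    have h0 := hext 0 (by simp)
    simp only [List.getElem_cons_zero, add_zero] at h0
    have hHW : H.length ≤ W := by
      rw [List.length_append] at hlen
      omega
    unfold loadRange
    refine Hoare.readBlock_bind (by rw [hm, h0, List.length_take]; omega) ?_
    dsimp only
    set ids := (List.range (s.ext a).length).filter
      fun i => decide (lo ≤ b * B + i ∧ b * B + i < hi) with hids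
    have hiv : ∀ i ∈ ids, i < (s.ext a).length := by
      intro i hi
      exact List.mem_range.1 (List.mem_filter.1 hi).1
    have hidB : ids.length ≤ B := by
      refine (List.length_filter_le _ _).trans ?_
      rw [h0]
      simp
    have hpk : pick (s.ext a) ids = pick sp ((List.range' (b * B) B).filter
        fun p => decide (lo ≤ p ∧ p < hi)) := by
      have e1 : (List.range' (b * B) B).filter (fun p => decide (lo ≤ p ∧ p < hi)) =
          ((List.range B).filter fun i => decide (lo ≤ b * B + i ∧ b * B + i < hi)).map
            fun i => b * B + i := by
        rw [List.range'_eq_map_range, List.filter_map]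
        rfl
      have e2 : pick (s.ext a) ids = pick (s.ext a)
          ((List.range B).filter fun i => decide (lo ≤ b * B + i ∧ b * B + i < hi)) := by
        have hle : (s.ext a).length ≤ B := by
          rw [h0]
          simp
        obtain ⟨c, hc⟩ := Nat.exists_eq_add_of_le hle
        have hr : List.range B = List.range (s.ext a).length ++
            (List.range c).map fun x => (s.ext a).length + x := by
          conv_lhs => rw [hc, List.range_add]
        have : pick (s.ext a) (((List.range c).map fun x => (s.ext a).length + x).filter
            fun i => decide (lo ≤ b * B + i ∧ b * B + i < hi)) = [] := by
          simp only [pick, List.filterMap_eq_nil_iff, List.mem_filter, List.mem_map]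
          rintro i ⟨⟨j, -, rfl⟩, -⟩
          simp
        rw [hr, List.filter_append, pick_append, this, List.append_nil]
      rw [e2, e1, ← pick_drop, h0, pick_take_left]
      intro i hi
      exact List.mem_range.1 (List.mem_filter.1 hi).1
    have hsplit : List.range' (b * B) ((a :: as).length * B) =
        List.range' (b * B) B ++ List.range' ((b + 1) * B) (as.length * B) := by
      rw [List.length_cons, add_mul, one_mul, add_comm (as.length * B), add_mul, one_mul]
      have := List.range'_append (s := b * B) (m := B) (n := as.length * B) (step := 1)
      rw [one_mul] at this
      exact this.symm
    rw [hsplit, List.filter_append, pick_append, ← hpk, ← List.append_assoc] at hlen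
    refine Hoare.keepMem_bind (by simp; omega) ?_
    have hmem : pick (s.mem ++ s.ext a) (List.range H.length ++ ids.map fun i => H.length + i) =
        H ++ pick (s.ext a) ids := by
      rw [pick_append, pick_range, hm, List.take_left, pick_append_right]
    dsimp only
    rw [hmem]
    have hl : H.length + ids.length = (H ++ pick (s.ext a) ids).length := by
      rw [List.length_append, length_pick _ hiv]
    rw [hl]
    refine (ih (b + 1) (H ++ pick (s.ext a) ids) f
      { s with mem := H ++ pick (s.ext a) ids, reads := s.reads + 1 } rfl ?_ hlen).imp ?_
    · intro i hi
      have := hext (i + 1) (by simpa using hi)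
      simp only [List.getElem_cons_succ] at this
      dsimp only
      rw [this]
      congr 2
      ring
    · rintro h f' s' ⟨h1, h2, h3⟩
      refine ⟨h1, ?_, ?_⟩
      · rw [h2, hsplit, List.filter_append, pick_append, hpk, List.append_assoc]
      · refine ⟨h3.1, h3.2.1, ?_, h3.2.2.2⟩
        have := h3.2.2.1
        simp only [List.length_cons] at this ⊢
        omega

/-- Each bucket of `js` emits at most one block. As in the merge, `T` pairs the buffered records
with the tags known to the program. During a scan `need` is `B`, so that only full blocks are
written; at the end of a round it is `1`. -/
theorem flush_spec (need : ℕ) (H : List ρ) (js : List ℕ) : js.Nodup →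
    ∀ (T : List (ρ × ℕ)) (log : List (ℕ × ℕ × ℕ)) (f : ℕ) (s : State ρ),
    s.mem = H ++ T.map Prod.fst → H.length + T.length ≤ S →
    Hoare key B S 0 (flush B need H.length js (T.map Prod.snd) log) f s fun r f' s' =>
      ∃ (T' : List (ρ × ℕ)) (new : List (ℕ × ℕ × ℕ)), r = (T'.map Prod.snd, log ++ new) ∧
        s'.mem = H ++ T'.map Prod.fst ∧ T'.length ≤ T.length ∧ (∀ e ∈ T', e ∈ T) ∧
        Step f s f' s' 0 new.length ∧ (∀ e ∈ new, e.1 ∈ js) ∧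
        ∀ j, if j ∈ js ∧ need ≤ (tagged T j).length then
          ∃ a, (new.filter fun e => e.1 == j) = [(j, a, ((tagged T j).take B).length)] ∧
            s'.ext a = (tagged T j).take B ∧ a < f' ∧ tagged T' j = (tagged T j).drop B
          else (new.filter fun e => e.1 == j) = [] ∧ tagged T' j = tagged T j := by
  induction js with
  | nil =>
    intro _ T log f s hm _
    exact Hoare.ret ⟨T, [], by simp, hm, le_rfl, fun _ h => h, Step.refl, by simp, by simp⟩
  | cons j js ih =>
    intro hnd T log f s hm hS
    obtain ⟨hj, hnd'⟩ := List.nodup_cons.1 hnd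
    unfold flush
    rw [← length_tagged]
    split_ifs with hc
    · dsimp only
      rw [List.length_map]
      set I := (List.range T.length).filter fun i => (T.map Prod.snd)[i]? == some j with hI
      set sel := I.take B with hsel
      set rest := (List.range T.length).filter fun i => !(sel.contains i) with hrest
      have hp : ∀ j', ∀ i, ∀ hi : i < T.length,
          ((T.map Prod.snd)[i]? == some j') = (T[i].2 == j') := by
        intro j' i hi
        simp [hi]
      have hIv : ∀ i ∈ I, i < T.length := fun i hi => List.mem_range.1 (List.mem_filter.1 hi).1
      have hselv : ∀ i ∈ sel, i < T.length := fun i hi => hIv i (List.mem_of_mem_take hi)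
      have hrestv : ∀ i ∈ rest, i < T.length := fun i hi =>
        List.mem_range.1 (List.mem_filter.1 hi).1
      have hpI : pick T I = T.filter fun e => e.2 == j := pick_filter_range T _ _ (hp j)
      have hpsel : (pick T sel).map Prod.fst = (tagged T j).take B := by
        rw [hsel, pick_take T hIv, hpI, List.map_take]
        rfl
      have hsell : sel.length = ((tagged T j).take B).length := by
        rw [← hpsel, List.length_map, length_pick T hselv]
      have hIn : I.Nodup := List.nodup_range.filter _
      have hselI : ∀ i ∈ sel, ((T.map Prod.snd)[i]? == some j) = true := fun i hi =>
        (List.mem_filter.1 (List.mem_of_mem_take hi)).2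
      have htr : ∀ j', tagged (pick T rest) j' =
          if j' = j then (tagged T j).drop B else tagged T j' := by
        intro j'
        rw [tagged, filter_pick T _ _ hrestv (hp j'), hrest, List.filter_filter]
        split_ifs with hjj
        · subst hjj
          have e1 : (List.range T.length).filter
              (fun i => (T.map Prod.snd)[i]? == some j' && !(sel.contains i)) =
              I.filter fun i => !(sel.contains i) := by
            rw [hI, List.filter_filter]
            refine List.filter_congr fun i _ => ?_
            rw [Bool.and_comm]
          have e2 : I.filter (fun i => !(sel.contains i)) = I.drop B := by
            have hdis := List.nodup_append.1 ((List.take_append_drop B I).symm ▸ hIn)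
            conv_lhs => rw [← List.take_append_drop B I]
            rw [List.filter_append, List.filter_eq_nil_iff.2, List.nil_append, List.filter_eq_self.2]
            · intro i hi
              simp only [Bool.not_eq_true', List.contains_eq_mem, decide_eq_false_iff_not]
              intro hi'
              exact hdis.2.2 i hi' i hi rfl
            · intro i hi
              simpa using hi
          have e3 : pick T (I.drop B) = (pick T I).drop B := by
            have h1 := pick_append T (I.take B) (I.drop B)
            rw [List.take_append_drop] at h1
            have h2 : (pick T (I.take B)) = (pick T I).take B := pick_take T hIv B
            rw [h2] at h1
            conv at h1 => lhs; rw [← List.take_append_drop B (pick T I)]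
            exact (List.append_cancel_left h1).symm
          rw [e1, e2, e3, hpI, List.map_drop]
          rfl
        · have e1 : (List.range T.length).filter
              (fun i => (T.map Prod.snd)[i]? == some j' && !(sel.contains i)) =
              (List.range T.length).filter fun i => (T.map Prod.snd)[i]? == some j' := by
            refine List.filter_congr fun i _ => ?_
            by_cases hi : i ∈ sel
            · have h1 := hselI i hi
              simp only [beq_iff_eq] at h1
              rw [h1]
              have : ¬ j = j' := fun h => hjj h.symm
              simp [this]
            · simp [hi]
          rw [e1, pick_filter_range T _ (fun e => e.2 == j') (hp j')]
          rfl
      -- The positions in `sel` are distinct and disjoint from `rest`, so the rearrangement does not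
      -- enlarge the memory contents.
      have hsr : sel.length + rest.length ≤ T.length := by
        have h1 : sel.Sublist ((List.range T.length).filter fun i => sel.contains i) := by
          have h2 : sel.Sublist (List.range T.length) :=
            (List.take_sublist _ _).trans List.filter_sublist
          have h3 := h2.filter fun i => sel.contains i
          rwa [List.filter_eq_self.2 (fun i hi => by simpa using hi)] at h3
        have h2 := List.length_eq_length_filter_add (l := List.range T.length)
          fun i => sel.contains i
        have h3 := h1.length_le
        rw [List.length_range, ← hrest] at h2
        omega
      have hrl : rest.length = (pick T rest).length := (length_pick T hrestv).symm
      refine Hoare.keepMem_bind (by simp; omega) ?_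
      have hmem : pick s.mem (List.range H.length ++ (sel ++ rest).map fun i => H.length + i) =
          H ++ ((tagged T j).take B ++ (pick T rest).map Prod.fst) := by
        rw [pick_append, pick_range, hm, List.take_left, pick_append_right, pick_map, pick_append,
          List.map_append, hpsel]
      rw [hmem]
      refine Hoare.store_bind (by simp [hsel]) ?_
      dsimp only
      rw [List.drop_left, hsell, List.take_left]
      refine Hoare.keepMem_bind (by simp; omega) ?_
      have hmem' : pick (H ++ ((tagged T j).take B ++ (pick T rest).map Prod.fst))
          (List.range H.length ++ List.range' (H.length + ((tagged T j).take B).length) rest.length) =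
          H ++ (pick T rest).map Prod.fst := by
        rw [pick_append, pick_range, List.take_left, pick_range', ← List.append_assoc,
          ← List.length_append, List.drop_left, List.take_of_length_le (by simp [hrl])]
      dsimp only
      rw [hmem']
      have htags : (rest.map fun i => (T.map Prod.snd).getD i 0) = (pick T rest).map Prod.snd := by
        rw [map_pick T Prod.snd _ hrestv]
        intro i _ hi
        simp [hi]
      rw [htags]
      refine (ih hnd' (pick T rest) _ (f + 1) _ rfl (by omega)).imp ?_
      rintro r f' s' ⟨T', new, h1, h2, h3, h4, h5, h6, h7⟩
      have hmemrest : ∀ e ∈ pick T rest, e ∈ T := by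
        intro e he
        simp only [pick, List.mem_filterMap] at he
        obtain ⟨i, -, he⟩ := he
        exact List.mem_of_getElem? he
      refine ⟨T', (j, f, ((tagged T j).take B).length) :: new, ?_, h2, by omega,
        fun e he => hmemrest e (h4 e he), ?_, ?_, ?_⟩
      · rw [h1]
        simp
      · refine ⟨by have := h5.1; omega, fun a ha => ?_, h5.2.2.1, ?_⟩
        · rw [h5.2.1 a (by omega)]
          exact Function.update_of_ne (by omega) _ _
        · have := h5.2.2.2
          simp only [List.length_cons] at this ⊢
          omega
      · intro e he
        rcases List.mem_cons.1 he with rfl | he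
        · simp
        · exact List.mem_cons_of_mem _ (h6 e he)
      · intro j'
        have h8 := h7 j'
        rw [htr j'] at h8
        by_cases hjj : j' = j
        · subst hjj
          rw [if_neg (fun h => hj h.1)] at h8
          rw [if_pos ⟨by simp, hc⟩]
          refine ⟨f, ?_, ?_, h5.1, by rw [h8.2, if_pos rfl]⟩
          · rw [List.filter_cons_of_pos (by simp), h8.1]
          · rw [h5.2.1 f (by omega)]
            exact Function.update_self _ _ _
        · rw [if_neg hjj] at h8
          have hne : ¬ j = j' := fun h => hjj h.symm
          rw [List.filter_cons_of_neg (by simpa using hne)]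
          simpa [hjj] using h8
    · refine (ih hnd' T log f s hm hS).imp ?_
      rintro r f' s' ⟨T', new, h1, h2, h3, h4, h5, h6, h7⟩
      refine ⟨T', new, h1, h2, h3, h4, h5, fun e he => List.mem_cons_of_mem _ (h6 e he), ?_⟩
      intro j'
      have h8 := h7 j'
      by_cases hjj : j' = j
      · subst hjj
        rw [if_neg (fun h => hc h.2)]
        rw [if_neg (fun h => hc h.2)] at h8
        exact h8
      · simpa [hjj] using h8

end Partition
-- Rounds of the partitioning and the resulting buckets
section Partition

variable {ρ κ : Type*} [LinearOrder κ] {key : ρ → κ} {B S : ℕ}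

theorem bucketBlocks_append (log log' : List (ℕ × ℕ × ℕ)) (j : ℕ) :
    bucketBlocks (log ++ log') j = bucketBlocks log j ++ bucketBlocks log' j := by
  simp [bucketBlocks]

theorem bucketSize_append (log log' : List (ℕ × ℕ × ℕ)) (j : ℕ) :
    bucketSize (log ++ log') j = bucketSize log j + bucketSize log' j := by
  simp [bucketSize]

/-- The records of the buckets `j₀, …, j₁ - 1` have been distributed: bucket `j` consists of the
list `P j`, the full blocks of which have been written, and the rest is buffered. -/
def Distributed (B j₀ j₁ : ℕ) (P : ℕ → List ρ) (T : List (ρ × ℕ)) (log : List (ℕ × ℕ × ℕ))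
    (f : ℕ) (ext : ℕ → List ρ) : Prop :=
  (∀ j, ∃ D, IsArray B ext f (bucketBlocks log j) D ∧ B ∣ D.length ∧
    bucketSize log j = D.length ∧ D ++ tagged T j = P j) ∧
  (∀ e ∈ T, j₀ ≤ e.2 ∧ e.2 < j₁) ∧ ∀ e ∈ log, j₀ ≤ e.1 ∧ e.1 < j₁

/-- The records of `X` in bucket `j`, if this is one of the buckets `j₀, …, j₁ - 1`. -/
def bucketPart (j₀ j₁ : ℕ) (bk : ρ → ℕ) (X : List ρ) (j : ℕ) : List ρ :=
  if j₀ ≤ j ∧ j < j₁ then X.filter fun x => bk x == j else []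

theorem tagged_new (j₀ j₁ : ℕ) (bk : ρ → ℕ) (X : List ρ) (j : ℕ) :
    tagged ((X.filter fun x => decide (j₀ ≤ bk x ∧ bk x < j₁)).map fun x => (x, bk x)) j =
      bucketPart j₀ j₁ bk X j := by
  unfold tagged bucketPart
  rw [List.filter_map, List.map_map, List.filter_filter]
  have : (Prod.fst ∘ fun x => (x, bk x)) = (id : ρ → ρ) := rfl
  rw [this, List.map_id]
  split_ifs with h
  · refine List.filter_congr fun x _ => ?_
    rw [Bool.eq_iff_iff]
    simp only [Function.comp_apply, Bool.and_eq_true, beq_iff_eq, decide_eq_true_eq]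
    refine ⟨fun h => h.1, ?_⟩
    rintro rfl
    exact ⟨rfl, h⟩
  · rw [List.filter_eq_nil_iff]
    intro x _
    simp only [Function.comp_apply, Bool.and_eq_true, beq_iff_eq, decide_eq_true_eq, not_and]
    rintro rfl
    simpa using h

theorem isArray_singleton {ext : ℕ → List ρ} {f a : ℕ} {l : List ρ} (hB : 0 < B) (ha : a < f)
    (he : ext a = l) (hl : l.length ≤ B) (hl0 : 0 < l.length) : IsArray B ext f [a] l := by
  refine ⟨?_, by simpa using ha, ?_⟩
  · have h1 := (ceilDiv_le_iff (n := l.length) (m := 1) hB).2 (by omega)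
    have h2 := (lt_ceilDiv_iff (n := l.length) (m := 0) hB).2 (by omega)
    simp only [List.length_singleton]
    omega
  · intro i hi
    simp only [List.length_singleton] at hi
    have : i = 0 := by omega
    subst this
    simpa [he] using hl

/-- A buffer never stays full between blocks. The record saved in each buffer makes room for a
splitter, so splitters and buffers together fit. -/
theorem length_buffer_le {j₀ j₁ : ℕ} (T : List (ρ × ℕ)) (h : ∀ e ∈ T, j₀ ≤ e.2 ∧ e.2 < j₁)
    (hT : ∀ j, (tagged T j).length < B) : T.length ≤ (j₁ - j₀) * (B - 1) := by
  rw [length_eq_sum_tagged T j₀ j₁ h]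
  calc _ ≤ ∑ _j ∈ Finset.Ico j₀ j₁, (B - 1) := Finset.sum_le_sum fun j _ => by
        have := hT j
        omega
    _ = _ := by simp

variable (key) in
/-- The bucket of `x` among the buckets defined by the sorted splitters `sp`. -/
def bucketOf (sp : List ρ) (x : ρ) : ℕ := sp.countP fun t => decide (key t ≤ key x)

/-- The invariant is `Distributed` together with buffers shorter than `B`. A new block adds at most
`B` records to a bucket, giving fewer than `2 * B`; writing one block brings the buffer below `B`
again. -/
theorem bucketScan_spec (hB : 0 < B) (j₀ j₁ : ℕ) (H : List ρ)
    (hcap : H.length + (j₁ - j₀) * (B - 1) + B ≤ S) (as : List ℕ) :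
    ∀ (T : List (ρ × ℕ)) (log : List (ℕ × ℕ × ℕ)) (X : List ρ) (f : ℕ) (s : State ρ),
    s.mem = H ++ T.map Prod.fst →
    Distributed B j₀ j₁ (bucketPart j₀ j₁ (fun x => (j₀ - 1) + bucketOf key H x) X) T log f s.ext →
    (∀ j, (tagged T j).length < B) → (∀ a ∈ as, a < f) → (∀ a ∈ as, (s.ext a).length ≤ B) →
    Hoare key B S 0 (bucketScan B j₀ j₁ H.length as (T.map Prod.snd) log) f s fun r f' s' =>
      ∃ (T' : List (ρ × ℕ)) (w : ℕ), r.1 = T'.map Prod.snd ∧ s'.mem = H ++ T'.map Prod.fst ∧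
        Distributed B j₀ j₁ (bucketPart j₀ j₁ (fun x => (j₀ - 1) + bucketOf key H x)
          (X ++ (as.map s.ext).flatten)) T' r.2 f' s'.ext ∧ (∀ j, (tagged T' j).length < B) ∧
        r.2.length = log.length + w ∧ Step f s f' s' as.length w := by
  set bk : ρ → ℕ := fun x => (j₀ - 1) + bucketOf key H x with hbk
  induction as with
  | nil =>
    intro T log X f s hm hd hT _ _
    exact Hoare.ret ⟨T, 0, rfl, hm, by simpa using hd, hT, rfl, Step.refl⟩
  | cons a as ih =>
    intro T log X f s hm hd hT has hlen
    have hal := hlen a (by simp)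
    have hTl := length_buffer_le T hd.2.1 hT
    unfold bucketScan
    refine Hoare.readBlock_bind (by rw [hm, List.length_append, List.length_map]; omega)
      (Hoare.comparisons_bind ?_)
    dsimp only
    rw [List.length_map]
    set blk := s.ext a with hblk
    set mem := s.mem ++ blk with hmem
    have hmem' : mem = H ++ (T.map Prod.fst ++ blk) := by rw [hmem, hm, List.append_assoc]
    have hml : mem.length = H.length + T.length + blk.length := by
      rw [hmem']
      simp
      omega
    have hb : ∀ i, ∀ hi : i < blk.length, (j₀ - 1) + (List.range H.length).countP
        (fun t => leAt key mem t (H.length + T.length + i)) = bk blk[i] := by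
      intro i hi
      rw [hbk]
      dsimp only
      congr 1
      have hx : H.length + T.length + i < mem.length := by omega
      have hmi : mem[H.length + T.length + i] = blk[i] := by
        simp only [hmem']
        rw [List.getElem_append_right (by omega), List.getElem_append_right (by simp; omega)]
        congr 1
        simp
        omega
      rw [countP_range mem (fun t => decide (key t ≤ key blk[i])) _ (by omega)]
      · rw [hmem', List.take_left]
        rfl
      · intro t ht
        simp [leAt, ht, hx, hmi]
    set bucket := fun i => (j₀ - 1) + (List.range H.length).countP
        (fun t => leAt key mem t (H.length + T.length + i)) with hbucket
    set new := (List.range blk.length).filter fun i => decide (j₀ ≤ bucket i ∧ bucket i < j₁)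
      with hnew
    have hnv : ∀ i ∈ new, i < blk.length := fun i hi => List.mem_range.1 (List.mem_filter.1 hi).1
    have hpn : pick blk new = blk.filter fun x => decide (j₀ ≤ bk x ∧ bk x < j₁) := by
      refine pick_filter_range blk _ (fun x => decide (j₀ ≤ bk x ∧ bk x < j₁)) ?_
      intro i hi
      have : bucket i = bk blk[i] := hb i hi
      rw [this]
    have hnl : new.length ≤ blk.length := by
      rw [hnew]
      exact (List.length_filter_le _ _).trans (by simp)
    refine Hoare.keepMem_bind (by simp; omega) ?_
    set N : List (ρ × ℕ) := (blk.filter fun x => decide (j₀ ≤ bk x ∧ bk x < j₁)).map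
      fun x => (x, bk x) with hN
    have hpk : pick mem (List.range (H.length + T.length) ++
        new.map fun i => H.length + T.length + i) = H ++ (T ++ N).map Prod.fst := by
      have e1 : mem = (H ++ T.map Prod.fst) ++ blk := by rw [hmem, hm]
      have e2 : H.length + T.length = (H ++ T.map Prod.fst).length := by simp
      rw [e1, e2, pick_append, pick_range, List.take_left, pick_append_right, hpn, List.append_assoc,
        List.map_append, hN, List.map_map]
      simp [Function.comp_def]
    have htg : T.map Prod.snd ++ new.map bucket = (T ++ N).map Prod.snd := by
      rw [List.map_append, hN, List.map_map, ← hpn]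
      congr 1
      symm
      exact map_pick blk _ _ hnv fun i _ hi => hb i hi
    dsimp only
    rw [hpk, htg]
    have hNl : N.length ≤ B := by
      rw [hN, List.length_map]
      exact (List.length_filter_le _ _).trans hal
    have htag : ∀ j, tagged (T ++ N) j = tagged T j ++ bucketPart j₀ j₁ bk blk j := fun j => by
      rw [tagged_append, tagged_new]
    have hPart : ∀ j, bucketPart j₀ j₁ bk (X ++ blk) j =
        bucketPart j₀ j₁ bk X j ++ bucketPart j₀ j₁ bk blk j := by
      intro j
      unfold bucketPart
      split_ifs <;> simp
    have hpl : ∀ j, (bucketPart j₀ j₁ bk blk j).length ≤ B := by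
      intro j
      unfold bucketPart
      split_ifs
      · exact (List.length_filter_le _ _).trans hal
      · simp
    refine (flush_spec B H (List.range' j₀ (j₁ - j₀)) List.nodup_range' (T ++ N) log f _ rfl
      (by rw [List.length_append]; omega)).bind ?_
    rintro r f₁ s₁ ⟨T₁, nw, rfl, hm₁, hl₁, hsub₁, hst₁, hnj, hspec⟩
    have hst₁' : Step f s f₁ s₁ 1 nw.length :=
      ⟨hst₁.1, hst₁.2.1, by have := hst₁.2.2.1; simp only at this; omega, hst₁.2.2.2⟩
    have hspec' : ∀ j, (B ≤ (tagged (T ++ N) j).length ∧ ∃ a',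
          (nw.filter fun e => e.1 == j) = [(j, a', ((tagged (T ++ N) j).take B).length)] ∧
          s₁.ext a' = (tagged (T ++ N) j).take B ∧ a' < f₁ ∧
          tagged T₁ j = (tagged (T ++ N) j).drop B) ∨
        ((tagged (T ++ N) j).length < B ∧ (nw.filter fun e => e.1 == j) = [] ∧
          tagged T₁ j = tagged (T ++ N) j) := by
      intro j
      have h := hspec j
      split_ifs at h with hc
      · exact Or.inl ⟨hc.2, h⟩
      · rcases Nat.lt_or_ge (tagged (T ++ N) j).length B with hlt | hge
        · exact Or.inr ⟨hlt, h⟩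
        -- A bucket outside the current round receives no records, so its buffer cannot have reached
        -- `B`.
        · exfalso
          refine hc ⟨?_, hge⟩
          rw [List.mem_range'_1]
          by_contra hj
          have h1 : bucketPart j₀ j₁ bk blk j = [] := if_neg (by omega)
          have h2 := htag j
          rw [h1, List.append_nil] at h2
          have := hT j
          rw [h2] at hge
          omega
    have hd₁ : Distributed B j₀ j₁ (bucketPart j₀ j₁ bk (X ++ blk)) T₁ (log ++ nw) f₁ s₁.ext := by
      refine ⟨fun j => ?_, ?_, ?_⟩
      · obtain ⟨D, hD1, hD2, hD3, hD4⟩ := hd.1 j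
        have hD1' := hD1.step hst₁'
        rw [hPart j, ← hD4, List.append_assoc, ← htag j]
        rw [bucketBlocks_append, bucketSize_append]
        rcases hspec' j with ⟨hge, a', h1, h2, h3, h4⟩ | ⟨hlt, h1, h2⟩
        · have hl : ((tagged (T ++ N) j).take B).length = B := by
            rw [List.length_take]
            omega
          refine ⟨D ++ (tagged (T ++ N) j).take B, ?_, ?_, ?_, ?_⟩
          · have : bucketBlocks nw j = [a'] := by simp [bucketBlocks, h1]
            rw [this]
            exact hD1'.append hB (isArray_singleton hB h3 h2 hl.le (by omega)) hD2
          · rw [List.length_append, hl]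
            exact hD2.add (dvd_refl B)
          · rw [hD3, List.length_append]
            simp [bucketSize, h1]
          · rw [h4, List.append_assoc, List.take_append_drop]
        · refine ⟨D, ?_, hD2, ?_, by rw [h2]⟩
          · simpa [bucketBlocks, h1] using hD1'
          · simpa [bucketSize, h1] using hD3
      · intro e he
        rcases List.mem_append.1 (hsub₁ e he) with he | he
        · exact hd.2.1 e he
        · rw [hN, List.mem_map] at he
          obtain ⟨x, hx, rfl⟩ := he
          simpa using (List.mem_filter.1 hx).2
      · intro e he
        rcases List.mem_append.1 he with he | he
        · exact hd.2.2 e he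
        · have := List.mem_range'_1.1 (hnj e he)
          omega
    have hT₁ : ∀ j, (tagged T₁ j).length < B := by
      intro j
      have h5 := hT j
      have h6 := hpl j
      have h7 := congrArg List.length (htag j)
      rw [List.length_append] at h7
      rcases hspec' j with ⟨hge, a', h1, h2, h3, h4⟩ | ⟨hlt, h1, h2⟩
      · rw [h4, List.length_drop]
        omega
      · rw [h2]
        exact hlt
    have hex : ∀ a' ∈ as, s₁.ext a' = s.ext a' := fun a' ha' => hst₁.2.1 a' (has a' (by simp [ha']))
    refine (ih T₁ (log ++ nw) (X ++ blk) f₁ s₁ hm₁ hd₁ hT₁ ?_ ?_).imp ?_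
    · exact fun a' ha' => lt_of_lt_of_le (has a' (by simp [ha'])) hst₁.1
    · intro a' ha'
      rw [hex a' ha']
      exact hlen a' (by simp [ha'])
    · rintro r f' s' ⟨T', w, h1, h2, h3, h4, h5, h6⟩
      refine ⟨T', nw.length + w, h1, h2, ?_, h4, ?_, ?_⟩
      · rw [List.map_congr_left hex] at h3
        simpa using h3
      · rw [h5, List.length_append]
        omega
      · refine (hst₁'.trans h6).mono ?_ le_rfl
        simp
        omega

theorem countP_eq_length_of_sorted {A R : List ρ} (h : Sorted key (A ++ R)) (x : ρ)
    (hR : 0 < bucketOf key R x) : bucketOf key A x = A.length := by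
  unfold bucketOf at *
  obtain ⟨y, hy, hyx⟩ := List.countP_pos_iff.1 hR
  rw [List.countP_eq_length]
  intro z hz
  have h1 := (List.pairwise_append.1 h).2.2 z hz y hy
  simp only [decide_eq_true_eq] at hyx ⊢
  exact h1.trans hyx

theorem bucketOf_append (A R : List ρ) (x : ρ) :
    bucketOf key (A ++ R) x = bucketOf key A x + bucketOf key R x := List.countP_append

theorem bucketOf_le (A : List ρ) (x : ρ) : bucketOf key A x ≤ A.length := List.countP_le_length

/-- A round sees only the splitters from position `j₀ - 1` to `j₁ - 1`. As the splitters are sorted,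
a record at or above one of them is at or above all earlier ones, so in the buckets of this round
the missing earlier splitters count `j₀ - 1` and the missing later ones count nothing. The splitter
kept from the round before separates bucket `j₀` from lower buckets; for `j₀ = 0` there is none, in
accordance with truncated subtraction. -/
theorem localBucket_eq_iff {sp : List ρ} (hsp : Sorted key sp) {j₀ j₁ j : ℕ} (h₁ : j₁ ≤ sp.length + 1)
    (hj₀ : j₀ ≤ j) (hj₁ : j < j₁) (x : ρ) :
    (j₀ - 1) + bucketOf key ((sp.take j₁).drop (j₀ - 1)) x = j ↔ bucketOf key sp x = j := by
  set A := sp.take (j₀ - 1) with hA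
  set H := (sp.take j₁).drop (j₀ - 1) with hH
  set C := sp.drop j₁ with hC
  have hAH : A ++ H = sp.take j₁ := by
    have : A = (sp.take j₁).take (j₀ - 1) := by
      rw [hA, List.take_take, min_eq_left (by omega)]
    rw [this, hH, List.take_append_drop]
  have hall : sp = A ++ (H ++ C) := by
    rw [← List.append_assoc, hAH, hC, List.take_append_drop]
  have hAl : A.length = j₀ - 1 := by
    rw [hA, List.length_take]
    omega
  have hHl : H.length = min j₁ sp.length - (j₀ - 1) := by
    rw [hH, List.length_drop, List.length_take]
  have hCl : C.length = sp.length - j₁ := List.length_drop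
  have hs1 : Sorted key (A ++ (H ++ C)) := hall ▸ hsp
  have hs2 : Sorted key (H ++ C) := (List.pairwise_append.1 hs1).2.1
  have e1 : bucketOf key sp x = bucketOf key A x + (bucketOf key H x + bucketOf key C x) := by
    conv_lhs => rw [hall]
    rw [bucketOf_append, bucketOf_append]
  have k1 := countP_eq_length_of_sorted hs1 x
  have k2 := countP_eq_length_of_sorted hs2 x
  rw [bucketOf_append] at k1
  have l1 := bucketOf_le (key := key) A x
  have l2 := bucketOf_le (key := key) H x
  have l3 := bucketOf_le (key := key) C x
  rw [e1]
  rcases Nat.eq_zero_or_pos (bucketOf key C x) with hc0 | hc0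
  · rcases Nat.eq_zero_or_pos (bucketOf key H x) with hh0 | hh0
    · rw [hc0, hh0]
      omega
    · have := k1 (by omega)
      omega
  · have h1 := k1 (by omega)
    have h2 := k2 hc0
    omega

/-- The list of blocks and sizes `log` describes the buckets `j₀, …, j₁ - 1` of the records `xs`
with respect to the splitters `sp`. -/
def IsPartition (key : ρ → κ) (B : ℕ) (ext : ℕ → List ρ) (f : ℕ) (sp xs : List ρ) (j₀ j₁ : ℕ)
    (log : List (ℕ × ℕ × ℕ)) : Prop :=
  (∀ j, j₀ ≤ j → j < j₁ →
    IsArray B ext f (bucketBlocks log j) (xs.filter fun x => bucketOf key sp x == j) ∧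
    bucketSize log j = (xs.filter fun x => bucketOf key sp x == j).length) ∧
  ∀ e ∈ log, j₀ ≤ e.1 ∧ e.1 < j₁

theorem IsPartition.step {f f' r w : ℕ} {s s' : State ρ} {sp xs : List ρ} {j₀ j₁ : ℕ}
    {log : List (ℕ × ℕ × ℕ)} (h : IsPartition key B s.ext f sp xs j₀ j₁ log)
    (hs : Step f s f' s' r w) : IsPartition key B s'.ext f' sp xs j₀ j₁ log :=
  ⟨fun j h₀ h₁ => ⟨(h.1 j h₀ h₁).1.step hs, (h.1 j h₀ h₁).2⟩, h.2⟩

/-- With `μ` buckets the memory holds at most `μ + 1` splitters, `μ * (B - 1)` buffered records and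
one block of `B`, together `μ * B + B + 1`. -/
theorem partitionRound_spec (hB : 0 < B) (splitters as : List ℕ) (sp xs : List ρ)
    (hsp : Sorted key sp) (j₀ j₁ μ : ℕ) (h₁ : j₁ ≤ sp.length + 1) (hμ : j₁ ≤ j₀ + μ)
    (hcap : μ * B + B + 1 ≤ S)
    (f : ℕ) (s : State ρ) (hm : s.mem = []) (hsa : IsArray B s.ext f splitters sp)
    (has : IsArray B s.ext f as xs) :
    Hoare key B S 0 (partitionRound B splitters as j₀ j₁) f s fun log f' s' =>
      IsPartition key B s'.ext f' sp xs j₀ j₁ log ∧ s'.mem = [] ∧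
        Step f s f' s' (splitters.length + as.length) log.length := by
  unfold partitionRound
  have hload : pick sp ((List.range' (0 * B) (splitters.length * B)).filter
      fun p => decide (j₀ - 1 ≤ p ∧ p < j₁)) = (sp.take j₁).drop (j₀ - 1) := by
    rw [zero_mul, ← List.range_eq_range', filter_range_Ico, pick_range', List.drop_take]
    have hl : sp.length ≤ splitters.length * B := by
      rw [hsa.1]
      exact le_ceilDiv_mul _ hB
    rcases Nat.lt_or_ge (splitters.length * B) j₁ with h | h
    · rw [List.take_of_length_le, List.take_of_length_le] <;> rw [List.length_drop] <;> omega
    · rw [min_eq_left h]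
  have hHl : ((sp.take j₁).drop (j₀ - 1)).length ≤ μ + 1 := by
    rw [List.length_drop, List.length_take]
    omega
  have hMB : μ ≤ μ * B := Nat.le_mul_of_pos_right _ hB
  refine (loadRange_spec (j₀ - 1) j₁ (μ + 1) (by omega) sp splitters 0 [] f s hm
    (by simpa using hsa.2.2) (by rw [List.nil_append, hload]; exact hHl)).bind ?_
  rintro h f₁ s₁ ⟨rfl, hm₁, hst₁⟩
  rw [List.nil_append, hload] at hm₁
  rw [hm₁]
  set H := (sp.take j₁).drop (j₀ - 1) with hH
  have hcap' : H.length + (j₁ - j₀) * (B - 1) + B ≤ S := by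
    have h1 : (j₁ - j₀) * (B - 1) ≤ μ * (B - 1) := Nat.mul_le_mul_right _ (by omega)
    have h2 : μ * (B - 1) + μ = μ * B := by
      obtain ⟨b, rfl⟩ := Nat.exists_eq_add_of_le' hB
      simp [mul_add]
    omega
  have hd0 : Distributed B j₀ j₁ (bucketPart j₀ j₁ (fun x => (j₀ - 1) + bucketOf key H x) [])
      [] [] f₁ s₁.ext := by
    refine ⟨fun j => ⟨[], ?_, ?_, ?_, ?_⟩, by simp, by simp⟩
    · simpa [bucketBlocks] using isArray_nil hB
    · simp
    · simp [bucketSize]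
    · simp [bucketPart, tagged]
  have has₁ := has.step hst₁
  refine (bucketScan_spec (key := key) hB j₀ j₁ H hcap' as [] [] [] f₁ s₁ (by simpa using hm₁) hd0
    (by simpa [tagged] using hB) has₁.2.1 has₁.length_block).bind ?_
  rintro ⟨tags, log⟩ f₂ s₂ ⟨T, w, h1, hm₂, hd, hT, hw, hst₂⟩
  dsimp only at h1 hd hw ⊢
  subst h1
  rw [has₁.flatten hB, List.nil_append] at hd
  have hTl := length_buffer_le T hd.2.1 hT
  refine (flush_spec 1 H (List.range' j₀ (j₁ - j₀)) List.nodup_range' T log f₂ s₂ hm₂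
    (by omega)).bind ?_
  rintro r f₃ s₃ ⟨T₃, nw, rfl, hm₃, hl₃, hsub₃, hst₃, hnj, hspec⟩
  refine Hoare.keepMem_bind (by simp) (Hoare.ret ⟨⟨?_, ?_⟩, rfl, ?_⟩)
  · intro j hj₀ hj₁
    obtain ⟨D, hD1, hD2, hD3, hD4⟩ := hd.1 j
    have hD1' := hD1.step hst₃
    have hpart : xs.filter (fun x => bucketOf key sp x == j) = D ++ tagged T j := by
      rw [hD4, bucketPart, if_pos ⟨hj₀, hj₁⟩]
      refine List.filter_congr fun x _ => ?_
      rw [Bool.eq_iff_iff]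
      simp only [beq_iff_eq]
      exact (localBucket_eq_iff hsp h₁ hj₀ hj₁ x).symm
    rw [hpart, bucketBlocks_append, bucketSize_append]
    have h := hspec j
    have hTj := hT j
    split_ifs at h with hc
    · obtain ⟨a, h1, h2, h3, h4⟩ := h
      have hl : (tagged T j).take B = tagged T j := List.take_of_length_le hTj.le
      rw [hl] at h1 h2
      constructor
      · have : bucketBlocks nw j = [a] := by simp [bucketBlocks, h1]
        rw [this]
        exact hD1'.append hB (isArray_singleton hB h3 h2 hTj.le hc.2) hD2
      · rw [hD3, List.length_append]
        simp [bucketSize, h1]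
    · have h0 : tagged T j = [] := by
        by_contra hne
        refine hc ⟨?_, List.length_pos_iff.2 hne⟩
        rw [List.mem_range'_1]
        omega
      rw [h0, List.append_nil]
      constructor
      · simpa [bucketBlocks, h.1] using hD1'
      · simpa [bucketSize, h.1] using hD3
  · intro e he
    rcases List.mem_append.1 he with he | he
    · exact hd.2.2 e he
    · have := List.mem_range'_1.1 (hnj e he)
      omega
  · have hst := (hst₁.trans hst₂).trans hst₃
    refine (show Step f s f₃ s₃ _ _ from hst).mono (by omega) ?_
    rw [List.length_append]
    simp only [List.length_nil] at hw
    omega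

theorem bucketBlocks_eq_nil {log : List (ℕ × ℕ × ℕ)} {j : ℕ} (h : ∀ e ∈ log, e.1 ≠ j) :
    bucketBlocks log j = [] := by
  simp only [bucketBlocks, List.map_eq_nil_iff, List.filter_eq_nil_iff, beq_iff_eq]
  exact h

theorem bucketSize_eq_zero {log : List (ℕ × ℕ × ℕ)} {j : ℕ} (h : ∀ e ∈ log, e.1 ≠ j) :
    bucketSize log j = 0 := by
  have : log.filter (fun e => e.1 == j) = [] := by
    simp only [List.filter_eq_nil_iff, beq_iff_eq]
    exact h
  simp [bucketSize, this]

theorem partitionRounds_spec (hB : 0 < B) (splitters as : List ℕ) (sp xs : List ρ)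
    (hsp : Sorted key sp) (μ l : ℕ) (hl : l ≤ sp.length + 1) (hcap : μ * B + B + 1 ≤ S) (n : ℕ) :
    ∀ (r₀ f : ℕ) (s : State ρ), s.mem = [] → IsArray B s.ext f splitters sp →
    IsArray B s.ext f as xs →
    Hoare key B S 0 ((List.range' r₀ n).mapM' fun r =>
        partitionRound B splitters as (r * μ) (min ((r + 1) * μ) l)) f s fun logs f' s' =>
      IsPartition key B s'.ext f' sp xs (r₀ * μ) (min ((r₀ + n) * μ) l) logs.flatten ∧
        s'.mem = [] ∧
        Step f s f' s' (n * (splitters.length + as.length)) logs.flatten.length := by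
  induction n with
  | zero =>
    intro r₀ f s hm _ _
    exact Hoare.ret ⟨⟨fun j h₀ h₁ => by rw [add_zero] at h₁; omega, by simp⟩, hm, Step.refl⟩
  | succ n ih =>
    intro r₀ f s hm hsa has
    rw [List.range'_succ]
    change Hoare key B S 0 (partitionRound _ _ _ _ _ >>= fun b => List.mapM' _ _ >>=
      fun bs => pure (b :: bs)) f s _
    refine (partitionRound_spec hB splitters as sp xs hsp (r₀ * μ) (min ((r₀ + 1) * μ) l) μ
      ((min_le_right _ _).trans hl) ((min_le_left _ _).trans (by rw [add_mul]; omega)) hcap f s hm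
      hsa has).bind ?_
    rintro log f₁ s₁ ⟨hp₁, hm₁, hst₁⟩
    refine (ih (r₀ + 1) f₁ s₁ hm₁ (hsa.step hst₁) (has.step hst₁)).bind ?_
    rintro logs f₂ s₂ ⟨hp₂, hm₂, hst₂⟩
    have hp₁' := hp₁.step hst₂
    rw [show r₀ + 1 + n = r₀ + (n + 1) by omega] at hp₂
    have hmono : (r₀ + 1) * μ ≤ (r₀ + (n + 1)) * μ := Nat.mul_le_mul_right _ (by omega)
    have hmono' : r₀ * μ ≤ (r₀ + 1) * μ := Nat.mul_le_mul_right _ (by omega)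
    refine Hoare.ret ⟨⟨fun j h₀ h₁ => ?_, ?_⟩, hm₂, ?_⟩
    · rw [List.flatten_cons, bucketBlocks_append, bucketSize_append]
      rcases Nat.lt_or_ge j ((r₀ + 1) * μ) with hj | hj
      · have hne : ∀ e ∈ logs.flatten, e.1 ≠ j := fun e he h => by
          have := hp₂.2 e he
          omega
        rw [bucketBlocks_eq_nil hne, bucketSize_eq_zero hne, List.append_nil, add_zero]
        exact hp₁'.1 j h₀ (by omega)
      · have hne : ∀ e ∈ log, e.1 ≠ j := fun e he h => by
          have := hp₁.2 e he
          omega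
        rw [bucketBlocks_eq_nil hne, bucketSize_eq_zero hne, List.nil_append, zero_add]
        exact hp₂.1 j hj h₁
    · intro e he
      rw [List.flatten_cons] at he
      rcases List.mem_append.1 he with he | he
      · have := hp₁.2 e he
        omega
      · have := hp₂.2 e he
        omega
    · rw [List.flatten_cons, List.length_append]
      exact (hst₁.trans hst₂).mono (le_of_eq (by ring)) le_rfl

theorem partition_spec {M : ℕ} (hB : 0 < B) (hBM : B ∣ M) (hcap : M + B + 1 ≤ S) (k : ℕ)
    (splitters as : List ℕ) (sp xs : List ρ)
    (hsp : Sorted key sp) (l : ℕ) (hl : l ≤ sp.length + 1) (hlk : l ≤ k * (M / B)) (f : ℕ)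
    (s : State ρ) (hm : s.mem = []) (hsa : IsArray B s.ext f splitters sp)
    (has : IsArray B s.ext f as xs) :
    Hoare key B S 0 (partition k M B splitters as l) f s fun log f' s' =>
      IsPartition key B s'.ext f' sp xs 0 l log ∧ s'.mem = [] ∧
        Step f s f' s' (k * (splitters.length + as.length)) log.length := by
  unfold partition
  rw [List.range_eq_range']
  refine (partitionRounds_spec hB splitters as sp xs hsp (M / B) l hl
    (by rw [Nat.div_mul_cancel hBM]; exact hcap) k 0 f s hm hsa has).bind ?_
  rintro logs f₁ s₁ ⟨hp, hm₁, hst⟩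
  rw [zero_mul, zero_add, min_eq_right hlk] at hp
  exact Hoare.ret ⟨hp, hm₁, hst⟩

/-- Each bucket has at most one block that is not full, so `l` buckets waste at most `l` blocks. -/
theorem IsPartition.log_length {ext : ℕ → List ρ} {f : ℕ} {sp xs : List ρ} {l : ℕ}
    {log : List (ℕ × ℕ × ℕ)} (hB : 0 < B) (h : IsPartition key B ext f sp xs 0 l log) :
    log.length * B ≤ xs.length + l * B := by
  have h1 := length_eq_sum_tagged (log.map fun e => (e.2, e.1)) 0 l (by
    intro e he
    obtain ⟨e₀, he₀, rfl⟩ := List.mem_map.1 he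
    exact h.2 e₀ he₀)
  have h2 : ∀ j ∈ Finset.Ico 0 l, (tagged (log.map fun e => (e.2, e.1)) j).length * B ≤
      (xs.filter fun x => bucketOf key sp x == j).length + B := by
    intro j hj
    have hj' := Finset.mem_Ico.1 hj
    have h3 := (h.1 j hj'.1 hj'.2).1.1
    have h4 : (tagged (log.map fun e => (e.2, e.1)) j).length = (bucketBlocks log j).length := by
      simp only [tagged, bucketBlocks, List.length_map, List.filter_map]
      rfl
    rw [h4, h3]
    exact (ceilDiv_mul_lt _ hB).le
  have h5 : ∑ j ∈ Finset.Ico 0 l, (xs.filter fun x => bucketOf key sp x == j).length ≤ xs.length := by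
    have h6 := length_eq_sum_tagged
      ((xs.filter fun x => decide (bucketOf key sp x < l)).map fun x => (x, bucketOf key sp x)) 0 l
      (by
        intro e he
        obtain ⟨x, hx, rfl⟩ := List.mem_map.1 he
        simpa using (List.mem_filter.1 hx).2)
    have h7 : ((xs.filter fun x => decide (bucketOf key sp x < l)).map
        fun x => (x, bucketOf key sp x)).length ≤ xs.length := by
      rw [List.length_map]
      exact List.length_filter_le _ _
    rw [h6] at h7
    refine le_trans (le_of_eq (Finset.sum_congr rfl fun j hj => ?_)) h7
    have := tagged_new 0 l (bucketOf key sp) xs j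
    simp only [zero_le, true_and] at this
    rw [this, bucketPart, if_pos (by simpa using hj)]
  rw [List.length_map] at h1
  rw [h1, Finset.sum_mul]
  calc _ ≤ ∑ j ∈ Finset.Ico 0 l, ((xs.filter fun x => bucketOf key sp x == j).length + B) :=
        Finset.sum_le_sum h2
    _ ≤ _ := by
      rw [Finset.sum_add_distrib]
      simp only [Finset.sum_const, Nat.card_Ico, smul_eq_mul, Nat.sub_zero]
      omega

end Partition
/-! ### Random samples -/

section Random

variable {ρ κ : Type*} [LinearOrder κ] {key : ρ → κ} {B S : ℕ}

theorem Hoare.of_one_le {β : Type} {ε : ENNReal} {p : Code β} {f : ℕ} {s : State ρ}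
    {Q : β → ℕ → State ρ → Prop} (h : 1 ≤ ε) : Hoare key B S ε p f s Q := by
  refine le_trans ?_ h
  rw [PMF.toOuterMeasure_apply]
  calc _ ≤ ∑' x, (exec key B S (p f) s) x := ENNReal.tsum_le_tsum fun x => Set.indicator_le_self _ _ _
    _ = 1 := (exec key B S (p f) s).tsum_coe

theorem randomList_spec (N m f : ℕ) (s : State ρ) :
    Hoare key B S 0 (randomList N m) f s fun b f' s' =>
      f' = f ∧ s' = s ∧ b.length = m ∧ ∀ p ∈ b, p ≤ N := by
  induction m with
  | zero => exact Hoare.ret ⟨rfl, rfl, rfl, by simp⟩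
  | succ m ih =>
    unfold randomList
    refine Hoare.randomNat_bind' fun i hi => ih.bind ?_
    rintro b f' s' ⟨rfl, rfl, hl, hb⟩
    refine Hoare.ret ⟨rfl, rfl, by simp [hl], ?_⟩
    intro p hp
    rcases List.mem_cons.1 hp with rfl | hp
    · exact hi
    · exact hb p hp

theorem sum_ite_eq_countP (A : ℕ → Bool) (z : ℝ) (k : ℕ) :
    ∑ i ∈ Finset.range k, (if A i then z else 1) = k - (1 - z) * (List.range k).countP A := by
  induction k with
  | zero => simp
  | succ k ih =>
    rw [Finset.sum_range_succ, ih, List.range_succ, List.countP_append, List.countP_singleton]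
    split_ifs <;> push_cast <;> ring

/-- The lower tail of the number of samples that hit a given set. -/
theorem randomList_tail (N : ℕ) (A : ℕ → Bool) (z : ℝ) (hz : 0 < z) (hz1 : z ≤ 1) (m : ℕ) :
    ∀ (t f : ℕ) (s : State ρ),
    Hoare key B S (ENNReal.ofReal
      ((1 - (1 - z) * (List.range (N + 1)).countP A / (N + 1 : ℕ)) ^ m * z⁻¹ ^ t))
      (randomList N m) f s fun b _ _ => t < b.countP A := by
  -- Here `q` is the mean of the variable that is `z` on a hit and `1` otherwise. The bound `q ^ m *
  -- z⁻¹ ^ t` is Markov's inequality for `z` to the number of hits; the induction conditions on the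
  -- first sample instead of using independence explicitly.
  set q : ℝ := 1 - (1 - z) * (List.range (N + 1)).countP A / (N + 1 : ℕ) with hq
  have hN : (0 : ℝ) < (N + 1 : ℕ) := by positivity
  have hq0 : 0 ≤ q := by
    have h1 : ((List.range (N + 1)).countP A : ℝ) ≤ (N + 1 : ℕ) := by
      exact_mod_cast (List.countP_le_length (p := A) (l := List.range (N + 1))).trans (by simp)
    have h2 : (1 - z) * (List.range (N + 1)).countP A / (N + 1 : ℕ) ≤ 1 := by
      rw [div_le_one hN]
      nlinarith
    linarith
  induction m with
  | zero =>
    intro t f s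
    refine Hoare.of_one_le ?_
    rw [← ENNReal.ofReal_one]
    refine ENNReal.ofReal_le_ofReal ?_
    rw [pow_zero, one_mul]
    exact one_le_pow₀ ((one_le_inv₀ hz).2 hz1)
  | succ m ih =>
    intro t f s
    unfold randomList
    have hc : 0 ≤ q ^ m * z⁻¹ ^ t := by positivity
    refine (Hoare.randomNat_bind (fun i => ENNReal.ofReal (q ^ m * z⁻¹ ^ t * if A i then z else 1))
      fun i _ => ?_).mono ?_ fun _ _ _ h => h
    · by_cases hA : A i
      -- After a hit the remaining samples need one hit less, which gains the factor `z`. For `t =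
      -- 0` the hit alone already ensures success.
      · rcases t with _ | t
        · refine ((randomList_spec N m f s).bind fun b f' s' _ => Hoare.ret ?_)
          simp [hA]
        · refine Hoare.mono (ε₁ := ENNReal.ofReal (q ^ m * z⁻¹ ^ t)) ?_ ?_ fun _ _ _ h => h
          · have := (ih t f s).bind' (ε₂ := 0) (g := fun rest => (pure (i :: rest) : Code (List ℕ)))
              (Q := fun b _ _ => t + 1 < b.countP A)
              fun b f' s' hb => Hoare.ret (by simpa [hA] using hb)
            simpa using this
          · refine ENNReal.ofReal_le_ofReal (le_of_eq ?_)
            rw [if_pos hA, pow_succ]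
            field_simp
      · refine Hoare.mono (ε₁ := ENNReal.ofReal (q ^ m * z⁻¹ ^ t)) ?_ ?_ fun _ _ _ h => h
        · have := (ih t f s).bind' (ε₂ := 0) (g := fun rest => (pure (i :: rest) : Code (List ℕ)))
            (Q := fun b _ _ => t < b.countP A)
            fun b f' s' hb => Hoare.ret (by simpa [hA] using hb)
          simpa using this
        · rw [if_neg hA, mul_one]
    · rw [← ENNReal.ofReal_sum_of_nonneg, ← Finset.mul_sum, sum_ite_eq_countP,
        ← ENNReal.ofReal_natCast, ← ENNReal.ofReal_div_of_pos hN]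
      · refine ENNReal.ofReal_le_ofReal (le_of_eq ?_)
        rw [pow_succ, hq]
        field_simp
      · intro i _
        split_ifs <;> positivity

end Random

/-! ### Ranks -/

section Rank

variable {ρ κ : Type*} [LinearOrder κ] {key : ρ → κ}

/-- A property inherited by smaller keys holds on an initial segment of a sorted list, so comparing
an index with the count decides it there. -/
theorem lt_countP_iff_of_sorted {L : List ρ} (hL : Sorted key L) (P : ρ → Bool)
    (hP : ∀ x y, key x ≤ key y → P y = true → P x = true) (i : ℕ) (hi : i < L.length) :
    i < L.countP P ↔ P L[i] = true := by
  induction L generalizing i with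
  | nil => simp at hi
  | cons y L ih =>
    obtain ⟨h1, h2⟩ := List.pairwise_cons.1 hL
    by_cases hy : P y = true
    · rw [List.countP_cons_of_pos hy]
      rcases i with _ | i
      · simp [hy]
      · simp only [List.getElem_cons_succ]
        rw [← ih h2 i (by simpa using hi)]
        omega
    · have hall : ∀ z ∈ y :: L, ¬ P z = true := by
        intro z hz hPz
        rcases List.mem_cons.1 hz with rfl | hz
        · exact hy hPz
        · exact hy (hP y z (h1 z hz) hPz)
      rw [List.countP_eq_zero.2 hall]
      constructor
      · intro h
        omega
      · intro h
        exact absurd h (hall _ (List.getElem_mem hi))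

variable (key) in
/-- The number of records of `xs` with keys smaller than that of `x`. -/
def rank (xs : List ρ) (x : ρ) : ℕ := xs.countP fun y => decide (key y < key x)

theorem rank_le_rank {xs : List ρ} {x y : ρ} (h : key x ≤ key y) : rank key xs x ≤ rank key xs y :=
  List.countP_mono_left fun z _ hz => by
    simp only [decide_eq_true_eq] at hz ⊢
    exact hz.trans_le h

theorem rank_lt_rank {xs : List ρ} {x y : ρ} (hx : x ∈ xs) (h : key x < key y) :
    rank key xs x < rank key xs y := by
  have h1 : xs.countP (fun z => decide (key z < key x)) +
      xs.countP (fun z => decide (key z = key x)) ≤ rank key xs y := by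
    unfold rank
    clear hx
    induction xs with
    | nil => simp
    | cons z zs ih =>
      simp only [List.countP_cons]
      rcases lt_trichotomy (key z) (key x) with h1 | h1 | h1
      · have h2 := h1.trans h
        simp [h1, h2, h1.ne]
        omega
      · simp [h1, h]
        omega
      · simp [h1.ne', not_lt.2 h1.le]
        omega
  have h2 : 0 < xs.countP (fun z => decide (key z = key x)) :=
    List.countP_pos_iff.2 ⟨x, hx, by simp⟩
  unfold rank at *
  omega

theorem rank_le_rank_iff {xs : List ρ} {x y : ρ} (hy : y ∈ xs) :
    rank key xs x ≤ rank key xs y ↔ key x ≤ key y := by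
  refine ⟨fun h => ?_, rank_le_rank⟩
  by_contra hc
  exact absurd (rank_lt_rank hy (not_le.1 hc)) (by omega)

theorem rank_lt_length {xs : List ρ} {x : ρ} (hx : x ∈ xs) : rank key xs x < xs.length := by
  refine lt_of_le_of_ne List.countP_le_length fun he => ?_
  rw [rank, List.countP_eq_length] at he
  simpa using he x hx

/-- With distinct keys the rank is injective, and it takes values in a set of the same size as the
list. Sets of ranks can therefore be counted as sets of integers. -/
theorem map_rank_perm {xs : List ρ} (hnd : (xs.map key).Nodup) :
    (xs.map (rank key xs)).Perm (List.range xs.length) := by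
  have hn : (xs.map (rank key xs)).Nodup := by
    rw [List.nodup_map_iff_inj_on hnd.of_map]
    intro x hx y hy h
    refine List.inj_on_of_nodup_map hnd hx hy (le_antisymm ?_ ?_)
    · exact (rank_le_rank_iff hy).1 h.le
    · exact (rank_le_rank_iff hx).1 h.ge
  refine List.Subperm.perm_of_length_le (List.subperm_of_subset hn ?_) (by simp)
  intro r hr
  obtain ⟨x, hx, rfl⟩ := List.mem_map.1 hr
  exact List.mem_range.2 (rank_lt_length hx)

theorem countP_rank {xs : List ρ} (hnd : (xs.map key).Nodup) {u v : ℕ} (hv : v ≤ xs.length) :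
    xs.countP (fun x => decide (u ≤ rank key xs x ∧ rank key xs x < v)) = v - u := by
  have h1 : xs.countP (fun x => decide (u ≤ rank key xs x ∧ rank key xs x < v)) =
      (xs.map (rank key xs)).countP fun r => decide (u ≤ r ∧ r < v) := by
    rw [List.countP_map]
    rfl
  rw [h1, (map_rank_perm hnd).countP_eq, List.countP_eq_length_filter, filter_range_Ico,
    List.length_range', min_eq_left hv]

/-- The number of records in the buckets before bucket `j`. -/
def bucketStart (key : ρ → κ) (xs sp : List ρ) (j : ℕ) : ℕ :=
  if j = 0 then 0 else
    match sp[j - 1]? with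
    | some t => rank key xs t
    | none => xs.length

theorem bucketStart_succ (xs sp : List ρ) {j : ℕ} (hj : j < sp.length) :
    bucketStart key xs sp (j + 1) = rank key xs sp[j] := by
  simp [bucketStart, hj]

theorem bucketStart_of_le (xs sp : List ρ) {j : ℕ} (hj : sp.length < j) :
    bucketStart key xs sp j = xs.length := by
  have : sp.length ≤ j - 1 := by omega
  simp [bucketStart, this]
  omega

theorem bucketStart_le (xs sp : List ρ) (j : ℕ) : bucketStart key xs sp j ≤ xs.length := by
  rcases j with _ | j
  · simp [bucketStart]
  · rcases Nat.lt_or_ge j sp.length with h | h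
    · rw [bucketStart_succ _ _ h]
      exact List.countP_le_length
    · rw [bucketStart_of_le _ _ (by omega)]

/-- A bucket is an interval of ranks, bounded by the ranks of its two splitters. Its size is hence
the difference of these ranks, also when neighbouring splitters coincide. -/
theorem length_bucket {xs sp : List ρ} (hnd : (xs.map key).Nodup) (hsp : Sorted key sp)
    {j : ℕ} (hj : j ≤ sp.length) :
    (xs.filter fun x => bucketOf key sp x == j).length =
      bucketStart key xs sp (j + 1) - bucketStart key xs sp j := by
  rw [← countP_rank hnd (bucketStart_le xs sp (j + 1)), List.countP_eq_length_filter]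
  congr 1
  refine List.filter_congr fun x hx => ?_
  rw [Bool.eq_iff_iff]
  simp only [beq_iff_eq, decide_eq_true_eq]
  have key1 : ∀ i (hi : i < sp.length), i < bucketOf key sp x ↔ rank key xs sp[i] ≤ rank key xs x := by
    intro i hi
    rw [rank_le_rank_iff hx, bucketOf, lt_countP_iff_of_sorted hsp _ _ i hi]
    · simp
    · intro a b hab hb
      simp only [decide_eq_true_eq] at hb ⊢
      exact hab.trans hb
  have hle := bucketOf_le (key := key) sp x
  have hup : bucketOf key sp x ≤ j ↔ rank key xs x < bucketStart key xs sp (j + 1) := by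
    rcases Nat.lt_or_ge j sp.length with h | h
    · rw [bucketStart_succ _ _ h]
      have := key1 j h
      omega
    · rw [bucketStart_of_le _ _ (by omega)]
      have := rank_lt_length (key := key) hx
      omega
  have hlo : j ≤ bucketOf key sp x ↔ bucketStart key xs sp j ≤ rank key xs x := by
    rcases j with _ | j
    · simp [bucketStart]
    · rw [bucketStart_succ _ _ (by omega), ← key1 j (by omega)]
      omega
  rw [← hlo, ← hup]
  omega

theorem rank_getElem_of_sorted {xs srt : List ρ} (hnd : (xs.map key).Nodup) (hp : srt.Perm xs)
    (hs : Sorted key srt) {i : ℕ} (hi : i < srt.length) : rank key xs srt[i] = i := by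
  have hnd' : (srt.map key).Nodup := (hp.map key).nodup_iff.2 hnd
  have h1 : rank key xs srt[i] = srt.countP fun y => decide (key y < key srt[i]) :=
    (hp.countP_eq _).symm
  have h2 : ∀ i' (hi' : i' < srt.length), i' < srt.countP (fun y => decide (key y < key srt[i])) ↔
      key srt[i'] < key srt[i] := by
    intro i' hi'
    rw [lt_countP_iff_of_sorted hs _ _ i' hi']
    · simp
    · intro a b hab hb
      simp only [decide_eq_true_eq] at hb ⊢
      exact hab.trans_lt hb
  have h3 := h2 i hi
  simp only [lt_self_iff_false, iff_false] at h3
  rw [h1]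
  rcases Nat.eq_zero_or_pos i with h0 | h0
  · omega
  · have h4 := (h2 (i - 1) (by omega)).2 (by
      refine lt_of_le_of_ne (List.pairwise_iff_getElem.1 hs _ _ _ _ (by omega)) fun he => ?_
      have h5 := (List.nodup_iff_injective_get.1 hnd').eq_iff (a := ⟨i - 1, by simp; omega⟩)
        (b := ⟨i, by simpa using hi⟩)
      simp only [List.get_eq_getElem, List.getElem_map, Fin.mk.injEq] at h5
      have := h5.1 he
      omega)
    omega

/-- The splitters chosen from the sorted sample `srt`. -/
def splittersOf (srt : List ρ) (l : ℕ) : List ρ :=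
  pick srt ((List.range' 1 (l - 1)).map fun i => i * srt.length / l)

theorem splitter_index_lt {m l i : ℕ} (hm : 0 < m) (hi : i < l) : i * m / l < m := by
  rw [Nat.div_lt_iff_lt_mul (by omega), mul_comm]
  exact Nat.mul_lt_mul_of_pos_left hi hm

theorem length_splittersOf (srt : List ρ) (l : ℕ) (hm : 0 < srt.length) :
    (splittersOf srt l).length = l - 1 := by
  rw [splittersOf, length_pick, List.length_map, List.length_range']
  intro i hi
  obtain ⟨j, hj, rfl⟩ := List.mem_map.1 hi
  have := List.mem_range'_1.1 hj
  exact splitter_index_lt hm (by omega)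

theorem getElem_splittersOf (srt : List ρ) (l : ℕ) (hm : 0 < srt.length) {j : ℕ}
    (hj : j < (splittersOf srt l).length) :
    (splittersOf srt l)[j] = srt[(j + 1) * srt.length / l]'(splitter_index_lt hm (by
      rw [length_splittersOf srt l hm] at hj
      omega)) := by
  have hv : ∀ i ∈ (List.range' 1 (l - 1)).map (fun i => i * srt.length / l), i < srt.length := by
    intro i hi
    obtain ⟨j, hj, rfl⟩ := List.mem_map.1 hi
    have := List.mem_range'_1.1 hj
    exact splitter_index_lt hm (by omega)
  have hj' := hj
  rw [length_splittersOf srt l hm] at hj'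
  have hx := splitter_index_lt (l := l) hm (show j + 1 < l by omega)
  have h1 : splittersOf srt l = ((List.range' 1 (l - 1)).map fun i => i * srt.length / l).map
      fun i => srt.getD i srt[0] := pick_eq_map srt srt[0] hv
  have h2 : (splittersOf srt l)[j]? = some (srt[(j + 1) * srt.length / l]'hx) := by
    rw [h1]
    have e : 1 + j = j + 1 := by omega
    simp [hj', e, hx]
  rw [List.getElem?_eq_getElem hj] at h2
  exact Option.some.inj h2

theorem sorted_splittersOf {srt : List ρ} (hs : Sorted key srt) (l : ℕ) (hm : 0 < srt.length) :
    Sorted key (splittersOf srt l) := by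
  rw [Sorted, List.pairwise_iff_getElem]
  intro i j hi hj hij
  rw [getElem_splittersOf srt l hm hi, getElem_splittersOf srt l hm hj]
  have hle : (i + 1) * srt.length / l ≤ (j + 1) * srt.length / l :=
    Nat.div_le_div_right (Nat.mul_le_mul_right _ (by omega))
  rcases hle.lt_or_eq with h | h
  · exact List.pairwise_iff_getElem.1 hs _ _ _ _ h
  · simp only [h, le_refl]

/-- If every record is in the sample, then the buckets have almost equal sizes. -/
theorem balanced_of_full {xs srt : List ρ} (hnd : (xs.map key).Nodup) (hp : srt.Perm xs)
    (hs : Sorted key srt) {l : ℕ} (hl : 2 ≤ l) (hln : 2 * (l - 1) ≤ xs.length) {j : ℕ} (hj : j < l) :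
    2 * l * (xs.filter fun x => bucketOf key (splittersOf srt l) x == j).length ≤ 3 * xs.length := by
  have hm : 0 < srt.length := by
    rw [hp.length_eq]
    omega
  have hsl := length_splittersOf srt l hm
  rw [length_bucket hnd (sorted_splittersOf hs l hm) (by omega)]
  -- The sorted sample is the sorted input, so the `i`-th splitter has rank `⌊i n / l⌋`. Then `l`
  -- times a bucket size is at most `n + l - 1`, and `2 * (l - 1) ≤ n` gives the factor `3 / 2`.
  have hU : ∀ i ≤ l, bucketStart key xs (splittersOf srt l) i = i * xs.length / l := by
    intro i hi
    rcases i with _ | i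
    · simp [bucketStart]
    · rcases Nat.lt_or_ge i (l - 1) with h | h
      · rw [bucketStart_succ _ _ (by omega), getElem_splittersOf srt l hm,
          rank_getElem_of_sorted hnd hp hs, hp.length_eq]
      · rw [bucketStart_of_le _ _ (by omega)]
        have : i + 1 = l := by omega
        rw [this, Nat.mul_div_cancel_left _ (by omega)]
  rw [hU j (by omega), hU (j + 1) (by omega)]
  have h1 := Nat.div_mul_le_self ((j + 1) * xs.length) l
  have h2 := Nat.lt_div_mul_add (a := j * xs.length) (b := l) (by omega)
  have h3 : l * ((j + 1) * xs.length / l - j * xs.length / l) + j * xs.length / l * l ≤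
      (j + 1) * xs.length / l * l ∨ (j + 1) * xs.length / l - j * xs.length / l = 0 := by
    rcases le_total (j * xs.length / l) ((j + 1) * xs.length / l) with h | h
    · left
      rw [mul_comm l, ← add_mul, Nat.sub_add_cancel h]
    · right
      omega
  rw [mul_assoc]
  rcases h3 with h3 | h3
  · rw [add_mul, one_mul] at h1 h3
    rw [add_mul, one_mul]
    omega
  · rw [h3]
    omega

/-- If every window of `w` consecutive ranks contains more than `t` of the `l * t` samples, then the
buckets have at most `w` records. -/
theorem balanced_of_windows {xs srt : List ρ} (hnd : (xs.map key).Nodup)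
    (hs : Sorted key srt) {l t w : ℕ} (hl : 2 ≤ l) (ht : 0 < t) (hlen : srt.length = l * t)
    (hw : ∀ r, r + w ≤ xs.length →
      t < srt.countP fun x => decide (r ≤ rank key xs x ∧ rank key xs x < r + w))
    {j : ℕ} (hj : j < l) :
    (xs.filter fun x => bucketOf key (splittersOf srt l) x == j).length ≤ w := by
  have hm : 0 < srt.length := by
    rw [hlen]
    exact Nat.mul_pos (by omega) ht
  have hsl := length_splittersOf srt l hm
  rw [length_bucket hnd (sorted_splittersOf hs l hm) (by omega)]
  by_contra hc
  push Not at hc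
  have hidx : ∀ i, i * srt.length / l = i * t := by
    intro i
    rw [hlen, mul_left_comm, Nat.mul_div_cancel_left _ (by omega)]
  have hit : ∀ i < l, i * t < srt.length := by
    intro i hi
    rw [hlen]
    exact Nat.mul_lt_mul_of_pos_right hi ht
  have hU : ∀ i (hi : i + 1 < l), bucketStart key xs (splittersOf srt l) (i + 1) =
      rank key xs (srt[(i + 1) * t]'(hit _ hi)) := by
    intro i hi
    rw [bucketStart_succ _ _ (by omega), getElem_splittersOf srt l hm]
    simp only [hidx]
  set u := bucketStart key xs (splittersOf srt l) j with hu
  set v := bucketStart key xs (splittersOf srt l) (j + 1) with hv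
  have hvn : v ≤ xs.length := bucketStart_le _ _ _
  -- For `j > 0` the window starts just above the lower splitter. That splitter belongs to the
  -- bucket and has rank below `r`, so an oversized bucket still has room for `w` ranks.
  set r := if j = 0 then 0 else u + 1 with hr
  have hrv : r + w ≤ v := by
    rw [hr]
    split_ifs <;> omega
  have hwr := hw r (hrv.trans hvn)
  have hupper : srt.countP (fun x => decide (rank key xs x < v)) ≤ (j + 1) * t := by
    rcases Nat.lt_or_ge (j + 1) l with h | h
    · by_contra hcc
      push Not at hcc
      have := (lt_countP_iff_of_sorted hs _ (fun x y hxy hy => by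
        simp only [decide_eq_true_eq] at hy ⊢
        exact (rank_le_rank hxy).trans_lt hy) _ (hit _ h)).1 hcc
      rw [hv, hU j h] at this
      simp at this
    · refine List.countP_le_length.trans (le_of_eq ?_)
      rw [hlen, show j + 1 = l by omega]
  -- The splitter at index `j * t` and all samples before it have rank below `r`. At most `(j + 1) *
  -- t` samples have rank below `v`, so at most `t` remain for the window, against `hw`.
  have hlower : j * t + (if j = 0 then 0 else 1) ≤ srt.countP (fun x => decide (rank key xs x < r)) := by
    rcases j with _ | j
    · simp
    · rw [if_neg (by omega)]
      have := (lt_countP_iff_of_sorted hs (fun x => decide (rank key xs x < r)) (fun x y hxy hy => by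
        simp only [decide_eq_true_eq] at hy ⊢
        exact (rank_le_rank hxy).trans_lt hy) _ (hit _ hj)).2 (by
          rw [hr, if_neg (by omega), hu, hU j hj]
          simp)
      omega
  have hsum : srt.countP (fun x => decide (r ≤ rank key xs x ∧ rank key xs x < r + w)) +
      srt.countP (fun x => decide (rank key xs x < r)) ≤
      srt.countP (fun x => decide (rank key xs x < v)) := by
    clear hwr hlower hupper
    generalize srt = L
    induction L with
    | nil => simp
    | cons z L ih =>
      simp only [List.countP_cons, Bool.decide_and] at ih ⊢
      rcases Nat.lt_or_ge (rank key xs z) r with h1 | h1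
      · have h2 : rank key xs z < v := by omega
        simp [h1, h2, not_le.2 h1]
        omega
      · rcases Nat.lt_or_ge (rank key xs z) (r + w) with h2 | h2
        · have h3 : rank key xs z < v := by omega
          simp [h1, h2, h3, not_lt.2 h1]
          omega
        · simp [h1, not_lt.2 h1, not_lt.2 h2]
          omega
  rw [add_mul, one_mul] at hupper
  split_ifs at hlower <;> omega

end Rank
/-! ### Choosing the splitters -/

section Splitters

variable {ρ κ : Type*} [LinearOrder κ] {key : ρ → κ} {B S : ℕ}

/-- Rounding `3n/(2l)` down costs less than one rank, so `n ≥ 10 l` gives `l w / n ≥ 1.5 - 0.1 =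
1.4`. With `z = 0.7` the bound per unit of `t` is `exp (-0.3 * 1.4) / 0.7`, which is at most `0.665
/ 0.7 = 0.95`. -/
theorem tail_le {n l t w : ℕ} (hl : 2 ≤ l) (hn : 10 * l ≤ n) (hw : w = 3 * n / (2 * l))
    (hwn : w ≤ n) :
    (1 - (1 - 0.7) * (w : ℝ) / n) ^ (l * t) * (0.7 : ℝ)⁻¹ ^ t ≤ 0.95 ^ t := by
  have hn' : (0 : ℝ) < n := by exact_mod_cast (show 0 < n by omega)
  have h1 : 3 * n < 2 * l * (w + 1) := by
    rw [hw]
    exact Nat.lt_mul_div_succ _ (by omega)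
  have h1' : 3 * (n : ℝ) < 2 * l * (w + 1) := by exact_mod_cast h1
  have hn2 : 10 * (l : ℝ) ≤ n := by exact_mod_cast hn
  have hwn' : (w : ℝ) ≤ n := by exact_mod_cast hwn
  set x : ℝ := w / n with hx
  have hx1 : x ≤ 1 := by
    rw [hx, div_le_one hn']
    exact hwn'
  have hx0 : 0 ≤ x := by positivity
  have hlx : 1.4 ≤ l * x := by
    rw [hx, ← mul_div_assoc, le_div_iff₀ hn']
    linarith
  have hq : 1 - (1 - 0.7) * (w : ℝ) / n = 1 - 0.3 * x := by
    rw [hx]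
    ring
  rw [hq, pow_mul, ← mul_pow]
  refine pow_le_pow_left₀ ?_ ?_ t
  · have : 0 ≤ 1 - 0.3 * x := by linarith
    positivity
  · have h2 : (1 - 0.3 * x) ^ l ≤ Real.exp (-0.42) := by
      calc (1 - 0.3 * x) ^ l ≤ Real.exp (-(0.3 * x)) ^ l := by
            refine pow_le_pow_left₀ (by linarith) ?_ l
            have := Real.add_one_le_exp (-(0.3 * x))
            linarith
        _ = Real.exp (l * -(0.3 * x)) := (Real.exp_nat_mul _ _).symm
        _ ≤ _ := Real.exp_le_exp.2 (by linarith)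
    have h3 : Real.exp (-0.42) ≤ 0.665 := by
      rw [Real.exp_neg, inv_le_comm₀ (Real.exp_pos _) (by norm_num)]
      have := Real.quadratic_le_exp_of_nonneg (show (0 : ℝ) ≤ 0.42 by norm_num)
      refine le_trans ?_ this
      norm_num
    calc (1 - 0.3 * x) ^ l * (0.7 : ℝ)⁻¹ ≤ 0.665 * (0.7 : ℝ)⁻¹ := by
          gcongr
          exact h2.trans h3
      _ ≤ 0.95 := by norm_num

theorem samplePositions_spec (n m f : ℕ) (s : State ρ) :
    Hoare key B S 0 (samplePositions n m) f s fun pos f' s' =>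
      f' = f ∧ s' = s ∧ pos.length = min n m ∧ (∀ p ∈ pos, p < n) ∧ pos.Pairwise (· ≤ ·) ∧
        (n ≤ m → pos = List.range n) := by
  unfold samplePositions
  split_ifs with h
  · refine Hoare.ret ⟨rfl, rfl, by simp [h], by simp, ?_, fun _ => rfl⟩
    exact List.pairwise_lt_range.imp fun h => h.le
  · refine (randomList_spec (n - 1) m f s).bind ?_
    rintro b f' s' ⟨rfl, rfl, hl, hb⟩
    refine Hoare.ret ⟨rfl, rfl, ?_, ?_, ?_, fun h' => absurd h' h⟩
    · rw [List.length_mergeSort, hl]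
      omega
    · intro p hp
      have := hb p ((List.mergeSort_perm _ _).mem_iff.1 hp)
      omega
    · have := List.pairwise_mergeSort (le := fun i j : ℕ => decide (i ≤ j))
        (fun a b c hab hbc => by
          simp only [decide_eq_true_eq] at *
          exact hab.trans hbc)
        (fun a b => by simpa using le_total _ _) b
      exact this.imp fun h => by simpa using h

/-- A union bound over the starting ranks of windows. For a fixed start, the positions of the
records in the window form a set of size `w`, whatever the order of the input, so `randomList_tail`
applies. -/
theorem samplePositions_windows {xs : List ρ} (hnd : (xs.map key).Nodup) {l t w : ℕ} (hl : 2 ≤ l)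
    (hn : 10 * l ≤ xs.length) (hw : w = 3 * xs.length / (2 * l)) (hwn : w ≤ xs.length)
    (hm : ¬ xs.length ≤ l * t) (f : ℕ) (s : State ρ) :
    Hoare key B S (xs.length * ENNReal.ofReal (0.95 ^ t)) (samplePositions xs.length (l * t)) f s
      fun pos _ _ => ∀ r, r + w ≤ xs.length →
        t < (pick xs pos).countP fun x => decide (r ≤ rank key xs x ∧ rank key xs x < r + w) := by
  have hw0 : 0 < w := by
    rw [hw]
    exact Nat.div_pos (by omega) (by omega)
  set P : ℕ → ρ → Bool := fun r x => decide (r ≤ rank key xs x ∧ rank key xs x < r + w) with hP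
  set A : ℕ → ℕ → Bool := fun r p => (xs[p]?).any (P r) with hA
  have hpick : ∀ r (pos : List ℕ), (pick xs pos).countP (P r) = pos.countP (A r) := by
    intro r pos
    induction pos with
    | nil => rfl
    | cons p pos ih =>
      rcases Nat.lt_or_ge p xs.length with h | h
      · rw [pick_cons _ _ h, List.countP_cons, List.countP_cons, ih]
        simp [hA, h]
      · have : pick xs (p :: pos) = pick xs pos := by
          simp only [pick]
          rw [List.filterMap_cons_none]
          simpa using h
        rw [this, List.countP_cons, ih]
        simp [hA, h]
  have hcount : ∀ r, r + w ≤ xs.length → (List.range xs.length).countP (A r) = w := by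
    intro r hr
    rw [← hpick, pick_range, List.take_length, hP]
    dsimp only
    rw [countP_rank hnd hr]
    omega
  unfold samplePositions
  rw [if_neg hm]
  have hN : xs.length - 1 + 1 = xs.length := by omega
  have key1 : ∀ r ∈ Finset.range xs.length, Hoare key B S (ENNReal.ofReal (0.95 ^ t))
      (randomList (xs.length - 1) (l * t)) f s fun b _ _ =>
        r + w ≤ xs.length → t < b.countP (A r) := by
    intro r _
    by_cases hr : r + w ≤ xs.length
    · refine (randomList_tail (xs.length - 1) (A r) 0.7 (by norm_num) (by norm_num) (l * t) t f s).mono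
        ?_ fun _ _ _ h _ => h
      rw [hN, hcount r hr]
      exact ENNReal.ofReal_le_ofReal (tail_le hl hn hw hwn)
    · exact (randomList_spec (xs.length - 1) (l * t) f s).mono zero_le fun _ _ _ _ h => absurd h hr
  have key2 := Hoare.forall_mem (Finset.range xs.length) _ _ key1
    ((randomList_spec (xs.length - 1) (l * t) f s).imp fun _ _ _ _ => trivial)
  rw [Finset.sum_const, Finset.card_range, nsmul_eq_mul] at key2
  have := key2.bind' (ε₂ := 0) (Q := fun pos _ _ => ∀ r, r + w ≤ xs.length →
        t < (pick xs pos).countP (P r))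
    (g := fun pos => (pure (pos.mergeSort fun i j => decide (i ≤ j)) : Code (List ℕ)))
    fun b f' s' hb => Hoare.ret fun r hr => by
      rw [hpick, (List.mergeSort_perm _ _).countP_eq]
      exact hb r (Finset.mem_range.2 (by omega)) hr
  rw [add_zero] at this
  exact this

/-- The output is valid for every sample; only the balance depends on `good`, and only then must `ε`
cover the random failure. The condition `10 ≤ t` ensures `10 * l ≤ n` whenever the sample is not the
whole input. -/
theorem chooseSplitters_spec {M : ℕ} (hB : 0 < B) (hM : 0 < M) (hBM : B ∣ M) (hS : M + B + 1 ≤ S)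
    (as : List ℕ) (xs : List ρ) (hnd : (xs.map key).Nodup) (l t : ℕ) (hl : 2 ≤ l)
    (hln : 2 * (l - 1) ≤ xs.length) (ht : 10 ≤ t) (good : Prop) (ε : ENNReal)
    (hε : good → xs.length * ENNReal.ofReal (0.95 ^ t) ≤ ε) (f : ℕ) (s : State ρ)
    (hm : s.mem = []) (has : IsArray B s.ext f as xs) :
    Hoare key B S ε (chooseSplitters M B as xs.length l (l * t)) f s fun out f' s' =>
      ∃ sp : List ρ, IsArray B s'.ext f' out sp ∧ Sorted key sp ∧ sp.length = l - 1 ∧ s'.mem = [] ∧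
        Step f s f' s' (as.length + 5 * (ceilDiv (min xs.length (l * t)) B *
            (Nat.clog 2 (ceilDiv (min xs.length (l * t)) B) + 1)))
          (2 * (ceilDiv (min xs.length (l * t)) B *
            (Nat.clog 2 (ceilDiv (min xs.length (l * t)) B) + 1)) + ceilDiv (l - 1) B) ∧
        (good → ∀ j < l,
          2 * l * (xs.filter fun x => bucketOf key sp x == j).length ≤ 3 * xs.length) := by
  have hMB := Nat.le_of_dvd hM hBM
  have hB2 : 2 * B ≤ S := by omega
  set w := 3 * xs.length / (2 * l) with hw
  have hwn : w ≤ xs.length := by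
    rw [hw]
    refine (Nat.div_le_div_left (show 4 ≤ 2 * l by omega) (by norm_num)).trans ?_
    omega
  have hsamp : Hoare key B S ε (samplePositions xs.length (l * t)) f s fun pos f' s' =>
      (f' = f ∧ s' = s ∧ pos.length = min xs.length (l * t) ∧ (∀ p ∈ pos, p < xs.length) ∧
        pos.Pairwise (· ≤ ·) ∧ (xs.length ≤ l * t → pos = List.range xs.length)) ∧
      (good → ¬ xs.length ≤ l * t → ∀ r, r + w ≤ xs.length →
        t < (pick xs pos).countP fun x => decide (r ≤ rank key xs x ∧ rank key xs x < r + w)) := by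
    have h0 := samplePositions_spec (key := key) (B := B) (S := S) xs.length (l * t) f s
    by_cases hg : good ∧ ¬ xs.length ≤ l * t
    · have h10 : 10 * l ≤ xs.length := by
        have : l * 10 ≤ l * t := Nat.mul_le_mul_left _ ht
        omega
      have h1 := samplePositions_windows (B := B) (S := S) hnd hl h10 hw hwn hg.2 f s
      refine (h0.and h1).mono ?_ fun _ _ _ h => ⟨h.1, fun _ _ => h.2⟩
      rw [zero_add]
      exact hε hg.1
    · exact h0.mono zero_le fun _ _ _ h => ⟨h, fun h1 h2 => absurd ⟨h1, h2⟩ hg⟩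
  unfold chooseSplitters
  have hbind := hsamp.bind' (ε₂ := 0) (g := fun pos => (do
      let smp ← gatherPositions B as pos
      let srt ← ramMergeSort M B smp.length smp pos.length
      gatherPositions B srt ((List.range' 1 (l - 1)).map fun i => i * pos.length / l) :
        Code (List ℕ))) (Q := fun out f' s' =>
      ∃ sp : List ρ, IsArray B s'.ext f' out sp ∧ Sorted key sp ∧ sp.length = l - 1 ∧ s'.mem = [] ∧
        Step f s f' s' (as.length + 5 * (ceilDiv (min xs.length (l * t)) B *
            (Nat.clog 2 (ceilDiv (min xs.length (l * t)) B) + 1)))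
          (2 * (ceilDiv (min xs.length (l * t)) B *
            (Nat.clog 2 (ceilDiv (min xs.length (l * t)) B) + 1)) + ceilDiv (l - 1) B) ∧
        (good → ∀ j < l,
          2 * l * (xs.filter fun x => bucketOf key sp x == j).length ≤ 3 * xs.length)) ?_
  · rw [add_zero] at hbind
    exact hbind
  rintro pos f₁ s₁ ⟨⟨rfl, rfl, hpl, hpn, hps, hpf⟩, hwin⟩
  refine (gatherPositions_spec hB hB2 as pos xs hpn hps f₁ s₁ hm has).bind ?_
  rintro smp f₂ s₂ ⟨hsa, hm₂, hst₂⟩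
  have hlp : (pick xs pos).length = pos.length := length_pick xs hpn
  have hmpos : 0 < pos.length := by
    rw [hpl]
    have : 0 < l * t := Nat.mul_pos (by omega) (by omega)
    omega
  have hmemx : ∀ x ∈ pick xs pos, x ∈ xs := by
    intro e he
    simp only [pick, List.mem_filterMap] at he
    obtain ⟨i, -, he⟩ := he
    exact List.mem_of_getElem? he
  have hinj : ∀ x ∈ xs, ∀ y ∈ xs, key x = key y → x = y := fun x hx y hy =>
    List.inj_on_of_nodup_map hnd hx hy
  have hms := ramMergeSort_spec (key := key) hB hM hBM hS smp.length smp (pick xs pos) f₂ s₂ le_rfl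
    (by omega) (fun x hx y hy => hinj x (hmemx x hx) y (hmemx y hy)) hm₂ hsa
  rw [hlp] at hms
  refine hms.bind ?_
  rintro srt f₃ s₃ ⟨Z, hZp, hZs, hZa, hm₃, hst₃⟩
  have hZl : Z.length = pos.length := by rw [hZp.length_eq, hlp]
  rw [← hZl]
  refine (gatherPositions_spec hB hB2 srt _ Z ?_ ?_ f₃ s₃ hm₃ hZa).imp ?_
  · intro i hi
    obtain ⟨j, hj, rfl⟩ := List.mem_map.1 hi
    have := List.mem_range'_1.1 hj
    exact splitter_index_lt (by omega) (by omega)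
  · rw [List.pairwise_map]
    refine (List.pairwise_lt_range' (s := 1) (n := l - 1)).imp fun {a b} h => ?_
    exact Nat.div_le_div_right (Nat.mul_le_mul_right _ h.le)
  · rintro out f₄ s₄ ⟨hoa, hm₄, hst₄⟩
    have hZpos : 0 < Z.length := by omega
    have hspl := length_splittersOf Z l hZpos
    refine ⟨splittersOf Z l, hoa, sorted_splittersOf hZs l hZpos, hspl, hm₄, ?_, ?_⟩
    · have hsl : smp.length = ceilDiv (min xs.length (l * t)) B := by rw [hsa.1, hlp, hpl]
      have hrl : srt.length = ceilDiv (min xs.length (l * t)) B := by rw [hZa.1, hZl, hpl]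
      have hol : out.length = ceilDiv (l - 1) B := by
        rw [hoa.1]
        exact congrArg (ceilDiv · B) hspl
      have hst := (hst₂.trans hst₃).trans hst₄
      rw [hsl, hrl, hol] at hst
      set b := ceilDiv (min xs.length (l * t)) B
      have hb : b ≤ b * (Nat.clog 2 b + 1) := Nat.le_mul_of_pos_right _ (by omega)
      exact hst.mono (by omega) (by omega)
    · intro hg j hj
      by_cases hfull : xs.length ≤ l * t
      · have hperm : Z.Perm xs := by
          rw [hpf hfull, pick_range, List.take_length] at hZp
          exact hZp
        exact balanced_of_full hnd hperm hZs hl hln hj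
      · have hw' := balanced_of_windows (w := w) (t := t) hnd hZs hl (by omega)
          (by rw [hZl, hpl]; omega) (fun r hr => by
            rw [hZp.countP_eq]
            exact hwin hg hfull r hr) hj
        calc 2 * l * _ ≤ 2 * l * w := Nat.mul_le_mul_left _ hw'
          _ ≤ 3 * xs.length := by
            rw [hw]
            exact Nat.mul_div_le _ _

end Splitters
/-! ### The recursion -/

section Recursion

variable {ρ κ : Type*} [LinearOrder κ] {key : ρ → κ} {B S : ℕ}

/-- The blocks `out` hold the records `xs` in sorted order. If `good` holds, then the cost is bounded
by `Φ` writes and `k Φ` reads. -/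
def SortPost (key : ρ → κ) (B : ℕ) (good : Prop) (k : ℕ) (Φ : ℝ) (f : ℕ) (s : State ρ)
    (xs : List ρ) (out : List ℕ) (f' : ℕ) (s' : State ρ) : Prop :=
  (out.flatMap s'.ext).Perm xs ∧ Sorted key (out.flatMap s'.ext) ∧ (∀ a ∈ out, a < f') ∧
    (∀ a ∈ out, (s'.ext a).length ≤ B) ∧ s'.mem = [] ∧
    ∃ r w : ℕ, Step f s f' s' r w ∧ out.length ≤ w ∧ (good → (w : ℝ) ≤ Φ ∧ (r : ℝ) ≤ k * Φ)

theorem flatMap_buckets_perm (bk : ρ → ℕ) (xs : List ρ) (l : ℕ) :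
    ((List.range l).flatMap fun j => xs.filter fun x => bk x == j).Perm
      (xs.filter fun x => decide (bk x < l)) := by
  induction l with
  | zero => simp
  | succ l ih =>
    rw [List.range_succ, List.flatMap_append, List.flatMap_singleton]
    refine (ih.append_right _).trans ?_
    have h := List.filter_append_perm (fun x => decide (bk x < l))
      (xs.filter fun x => decide (bk x < l + 1))
    rw [List.filter_filter, List.filter_filter] at h
    refine List.Perm.trans (List.Perm.of_eq ?_) h
    congr 1
    · refine List.filter_congr fun x _ => ?_
      rw [Bool.eq_iff_iff]
      simp
      omega
    · refine List.filter_congr fun x _ => ?_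
      rw [Bool.eq_iff_iff]
      simp
      omega

theorem sum_length_buckets (bk : ρ → ℕ) (xs : List ρ) (l : ℕ) (h : ∀ x ∈ xs, bk x < l) :
    ∑ j ∈ Finset.range l, (xs.filter fun x => bk x == j).length = xs.length := by
  have h1 := length_eq_sum_tagged (xs.map fun x => (x, bk x)) 0 l (by
    intro e he
    obtain ⟨x, hx, rfl⟩ := List.mem_map.1 he
    exact ⟨Nat.zero_le _, h x hx⟩)
  rw [List.length_map, ← Finset.range_eq_Ico] at h1
  rw [h1]
  refine Finset.sum_congr rfl fun j _ => ?_
  simp [tagged, List.filter_map, Function.comp_def]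

/-- Every call leaves the blocks in use untouched, so earlier outputs and pending buckets survive.
As the buckets are ordered among each other, concatenating their sorted outputs gives a sorted list,
and costs and failure probabilities add. -/
theorem sortBuckets_spec (good : Prop) (k : ℕ) (l : ℕ) (prog : ℕ → Code (List ℕ)) (Φ : ℕ → ℝ)
    (bb : ℕ → List ℕ) (Zb : ℕ → List ρ) (e : ℕ → ENNReal)
    (hrec : ∀ j < l, ∀ f (s : State ρ), s.mem = [] → IsArray B s.ext f (bb j) (Zb j) →
      Hoare key B S (e j) (prog j) f s (SortPost key B good k (Φ j) f s (Zb j)))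
    (hmono : ∀ i j, i < j → ∀ x ∈ Zb i, ∀ y ∈ Zb j, key x ≤ key y) (n : ℕ) :
    ∀ (j₀ f : ℕ) (s : State ρ), j₀ + n ≤ l → s.mem = [] →
    (∀ j < l, IsArray B s.ext f (bb j) (Zb j)) →
    Hoare key B S (∑ j ∈ Finset.Ico j₀ (j₀ + n), e j) ((List.range' j₀ n).mapM' prog) f s
      fun outs => SortPost key B good k (∑ j ∈ Finset.Ico j₀ (j₀ + n), Φ j) f s
        ((List.range' j₀ n).flatMap Zb) outs.flatten := by
  induction n with
  | zero =>
    intro j₀ f s _ hm _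
    refine Hoare.ret ⟨by simp, by simp, by simp, by simp, hm, 0, 0, Step.refl, by simp, ?_⟩
    intro _
    simp
  | succ n ih =>
    intro j₀ f s hj hm harr
    have hs : ∀ {N : Type} [AddCommMonoid N] (g : ℕ → N), ∑ j ∈ Finset.Ico j₀ (j₀ + (n + 1)), g j =
        g j₀ + ∑ j ∈ Finset.Ico (j₀ + 1) (j₀ + 1 + n), g j := by
      intro N _ g
      rw [Finset.sum_eq_sum_Ico_succ_bot (by omega)]
      congr 3
      omega
    rw [hs e, hs Φ, List.range'_succ]
    change Hoare key B S _ (prog j₀ >>= fun b => List.mapM' _ _ >>= fun bs => pure (b :: bs)) f s _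
    refine (hrec j₀ (by omega) f s hm (harr j₀ (by omega))).bind' ?_
    rintro out f₁ s₁ ⟨h1, h2, h3, h4, hm₁, r, w, hst, how, hc⟩
    have h := (ih (j₀ + 1) f₁ s₁ (by omega) hm₁ fun j hj => (harr j hj).step hst).bind' (ε₂ := 0)
      (g := fun bs => (pure (out :: bs) : Code (List (List ℕ))))
      (Q := fun outs => SortPost key B good k (Φ j₀ + ∑ j ∈ Finset.Ico (j₀ + 1) (j₀ + 1 + n), Φ j) f s
        ((j₀ :: List.range' (j₀ + 1) n).flatMap Zb) outs.flatten) ?_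
    · rw [add_zero] at h
      exact h
    rintro outs f₂ s₂ ⟨h1', h2', h3', h4', hm₂, r', w', hst', how', hc'⟩
    have hex : out.flatMap s₂.ext = out.flatMap s₁.ext :=
      List.flatMap_congr fun a ha => hst'.2.1 a (h3 a ha)
    refine Hoare.ret ?_
    rw [List.flatten_cons, List.flatMap_cons]
    refine ⟨?_, ?_, ?_, ?_, hm₂, r + r', w + w', hst.trans hst', ?_, ?_⟩
    · rw [List.flatMap_append, hex]
      exact h1.append h1'
    · rw [List.flatMap_append, hex]
      refine List.pairwise_append.2 ⟨h2, h2', fun x hx y hy => ?_⟩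
      obtain ⟨j, hj, hy⟩ := List.mem_flatMap.1 (h1'.mem_iff.1 hy)
      exact hmono j₀ j (by have := List.mem_range'_1.1 hj; omega) x (h1.mem_iff.1 hx) y hy
    · intro a ha
      rcases List.mem_append.1 ha with ha | ha
      · exact lt_of_lt_of_le (h3 a ha) hst'.1
      · exact h3' a ha
    · intro a ha
      rcases List.mem_append.1 ha with ha | ha
      · rw [hst'.2.1 a (h3 a ha)]
        exact h4 a ha
      · exact h4' a ha
    · rw [List.length_append]
      omega
    · intro hg
      have e1 := hc hg
      have e2 := hc' hg
      push_cast
      rw [mul_add]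
      exact ⟨add_le_add e1.1 e2.1, add_le_add e1.2 e2.2⟩

/-- The bound `l * (k * M) ≤ 2 * n` holds with factor `2` because of the ceiling, using `k * M < n`;
it makes the number of children small compared with `n / B`. The last bound is what
`balanced_of_full` needs. -/
theorem branching_bounds {k M B n : ℕ} (hB : 0 < B) (hBM : B ∣ M) (hK : 2 ≤ k * M / B)
    (hn : k * M < n) : 2 ≤ branching k M B n ∧ branching k M B n ≤ k * M / B ∧
      branching k M B n * (k * M) ≤ 2 * n ∧ 2 * (branching k M B n - 1) ≤ n := by
  obtain ⟨μ, rfl⟩ := hBM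
  have hK' : k * (B * μ) = (k * μ) * B := by ring
  rw [hK', Nat.mul_div_cancel _ hB] at hK
  have hKB : 2 ≤ k * μ * B := hK.trans (Nat.le_mul_of_pos_right _ hB)
  unfold branching
  rw [hK', Nat.mul_div_cancel _ hB]
  rw [hK'] at hn
  split_ifs with h
  · have h1 := (lt_ceilDiv_iff (n := n) (d := k * μ * B) (m := 1) (by omega)).2 (by omega)
    have h2 := (ceilDiv_le_iff (n := n) (d := k * μ * B) (m := k * μ) (by omega)).2 (by
      have : n * B ≤ k * μ * (k * μ * B) * B := by
        refine h.trans (le_of_eq ?_)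
        ring
      exact Nat.le_of_mul_le_mul_right this hB)
    set l := ceilDiv n (k * μ * B) with hl
    have h3 := (lt_ceilDiv_iff (n := n) (d := k * μ * B) (m := l - 1) (by omega)).1 (by omega)
    have h4 : (l - 1) * 2 ≤ (l - 1) * (k * μ * B) := Nat.mul_le_mul_left _ hKB
    have h5 : l * (k * μ * B) = (l - 1) * (k * μ * B) + k * μ * B := by
      obtain ⟨l', hl'⟩ := Nat.exists_eq_add_of_le' (show 1 ≤ l by omega)
      rw [hl', Nat.add_sub_cancel, add_mul, one_mul]
    exact ⟨h1, h2, by omega, by omega⟩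
  · push Not at h
    have h1 : k * μ * (k * μ * B) < n := by
      refine Nat.lt_of_mul_lt_mul_right (a := B) (lt_of_le_of_lt (le_of_eq ?_) h)
      ring
    have h2 : k * μ * 2 ≤ k * μ * (k * μ * B) := Nat.mul_le_mul_left _ hKB
    exact ⟨hK, le_rfl, by omega, by omega⟩

/-- A bound for the cost of a subproblem of size `n` without the recursive calls, where `t` is the
number of samples per bucket. -/
def nodeCost (k M B t n : ℕ) : ℕ :=
  5 * (ceilDiv (min n (branching k M B n * t)) B *
    (Nat.clog 2 (ceilDiv (min n (branching k M B n * t)) B) + 1)) +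
    ceilDiv (branching k M B n - 1) B + 2 * ceilDiv n B + branching k M B n

theorem selectionSort_post {M : ℕ} (hB : 0 < B) (hM : 0 < M) (hBM : B ∣ M) (hS : M + B + 1 ≤ S)
    (good : Prop) (k : ℕ) (Φ : ℝ) (as : List ℕ) (xs : List ρ) (hnd : (xs.map key).Nodup)
    (hgood : good → xs.length ≤ k * M ∧ (ceilDiv xs.length B : ℝ) ≤ Φ) (f : ℕ) (s : State ρ)
    (hm : s.mem = []) (has : IsArray B s.ext f as xs) :
    Hoare key B S 0 (selectionSort M B as xs.length) f s (SortPost key B good k Φ f s xs) := by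
  refine (selectionSort_spec hB hM hBM hS as xs hnd f s hm has).imp ?_
  rintro out f' s' ⟨zs, h1, h2, h3, h4, h5⟩
  have hz : out.flatMap s'.ext = zs := by
    rw [List.flatMap_def]
    exact h3.flatten hB
  have hl : out.length = ceilDiv xs.length B := by rw [h3.1, h1.length_eq]
  refine ⟨hz ▸ h1, hz ▸ h2, h3.2.1, h3.length_block, h4, _, _, h5, le_rfl, fun hg => ?_⟩
  obtain ⟨e1, e2⟩ := hgood hg
  refine ⟨by rw [hl]; exact e2, ?_⟩
  rw [has.1]
  push_cast
  have e3 : (ceilDiv xs.length M : ℝ) ≤ k := by exact_mod_cast (ceilDiv_le_iff hM).2 e1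
  exact mul_le_mul e3 e2 (by positivity) (by positivity)

/-- The failure probability `fuel * n * ε` reflects `fuel` levels: the node spends `n * ε` on its
sample, and the bucket sizes sum to `n`. One potential `Φ` bounds both costs, because the reads at a
node are at most `k` times `nodeCost`: only the partitioning scans are repeated `k` times, and the
rest is covered by `k ≥ 1`. -/
theorem sampleSortRec_spec {a k M n₀ : ℕ} (hB : 0 < B) (hBM : B ∣ M) (hK : 2 ≤ k * M / B)
    (hS : M + B + 1 ≤ S) (ht : 10 ≤ a * Nat.clog 2 n₀) (good : Prop) (ε : ENNReal)
    (hε : good → ENNReal.ofReal (0.95 ^ (a * Nat.clog 2 n₀)) ≤ ε) (Φ : ℕ → ℝ)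
    (hleaf : good → ∀ n ≤ k * M, (ceilDiv n B : ℝ) ≤ Φ n)
    (hnode : good → ∀ n, k * M < n → n ≤ n₀ → ∀ g : ℕ → ℕ,
      ∑ j ∈ Finset.range (branching k M B n), g j = n →
      (∀ j < branching k M B n, 2 * branching k M B n * g j ≤ 3 * n) →
      (nodeCost k M B (a * Nat.clog 2 n₀) n : ℝ) +
        ∑ j ∈ Finset.range (branching k M B n), Φ (g j) ≤ Φ n) (fuel : ℕ) :
    ∀ (as : List ℕ) (xs : List ρ) (f : ℕ) (s : State ρ), (good → xs.length ≤ fuel) →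
    xs.length ≤ n₀ → (xs.map key).Nodup → s.mem = [] → IsArray B s.ext f as xs →
    Hoare key B S (fuel * xs.length * ε) (sampleSortRec a k M B n₀ fuel as xs.length) f s
      (SortPost key B good k (Φ xs.length) f s xs) := by
  set t := a * Nat.clog 2 n₀ with ht'
  have hkM : 0 < k * M := by
    rcases Nat.eq_zero_or_pos (k * M) with h | h
    · rw [h] at hK
      simp at hK
    · exact h
  have hM : 0 < M := Nat.pos_of_mul_pos_left hkM
  have hk : 0 < k := Nat.pos_of_mul_pos_right hkM
  induction fuel with
  | zero =>
    intro as xs f s hfuel _ hnd hm has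
    refine (selectionSort_post hB hM hBM hS good k _ as xs hnd (fun hg => ?_) f s hm has).mono
      zero_le fun _ _ _ h => h
    have := hfuel hg
    exact ⟨by omega, hleaf hg _ (by omega)⟩
  | succ fuel ih =>
    intro as xs f s hfuel hn₀ hnd hm has
    unfold sampleSortRec
    split_ifs with hle
    · exact (selectionSort_post hB hM hBM hS good k _ as xs hnd
        (fun hg => ⟨hle, hleaf hg _ hle⟩) f s hm has).mono zero_le fun _ _ _ h => h
    push Not at hle
    obtain ⟨hl2, hlK, hlkM, hln⟩ := branching_bounds hB hBM hK hle
    dsimp only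
    set n := xs.length with hn
    set l := branching k M B n with hl
    have hlm : a * l * Nat.clog 2 n₀ = l * t := by
      rw [ht']
      ring
    rw [hlm]
    have hsplit := chooseSplitters_spec (S := S) hB hM hBM hS as xs hnd l t hl2 hln ht good
      (n * ε) (fun hg => mul_le_mul' le_rfl (hε hg)) f s hm has
    have hεsum : ((fuel + 1 : ℕ) : ENNReal) * n * ε = n * ε + fuel * n * ε := by
      push_cast
      ring
    rw [hεsum]
    refine hsplit.bind' ?_
    rintro spl f₁ s₁ ⟨sp, hspa, hsps, hspl, hm₁, hst₁, hbal⟩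
    refine (partition_spec hB hBM hS k spl as sp xs hsps l (by omega)
      (by rw [← Nat.mul_div_assoc _ hBM]; exact hlK) f₁ s₁ hm₁ hspa (has.step hst₁)).bind ?_
    rintro log f₂ s₂ ⟨hpart, hm₂, hst₂⟩
    set Zb : ℕ → List ρ := fun j => xs.filter fun x => bucketOf key sp x == j with hZb
    have hbk : ∀ x ∈ xs, bucketOf key sp x < l := fun x _ => by
      have := bucketOf_le (key := key) sp x
      omega
    have hsum : ∑ j ∈ Finset.range l, (Zb j).length = n := sum_length_buckets _ _ _ hbk
    have hloop := sortBuckets_spec (key := key) (B := B) (S := S) good k l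
      (fun j => sampleSortRec a k M B n₀ fuel (bucketBlocks log j) (bucketSize log j))
      (fun j => Φ (Zb j).length) (bucketBlocks log) Zb (fun j => fuel * (Zb j).length * ε) ?_ ?_ l 0
      f₂ s₂ (by omega) hm₂ (fun j hj => (hpart.1 j (Nat.zero_le _) hj).1)
    · rw [zero_add, ← Finset.range_eq_Ico, ← List.range_eq_range'] at hloop
      have hes : ∑ j ∈ Finset.range l, (fuel : ENNReal) * (Zb j).length * ε = fuel * n * ε := by
        rw [← Finset.sum_mul, ← Finset.mul_sum, ← Nat.cast_sum, hsum]
      rw [hes] at hloop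
      have h := hloop.bind' (ε₂ := 0) (g := fun outs => (pure outs.flatten : Code (List ℕ)))
        (Q := SortPost key B good k (Φ n) f s xs) ?_
      · rw [add_zero] at h
        exact h
      rintro outs f₃ s₃ ⟨h1, h2, h3, h4, hm₃, r, w, hst₃, how, hc⟩
      refine Hoare.ret ⟨?_, h2, h3, h4, hm₃, _, _, (hst₁.trans hst₂).trans hst₃, by omega, ?_⟩
      · refine (h1.trans (flatMap_buckets_perm _ xs l)).trans (List.Perm.of_eq ?_)
        rw [List.filter_eq_self]
        intro x hx
        simpa using hbk x hx
      · intro hg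
        obtain ⟨e1, e2⟩ := hc hg
        have e3 := hnode hg n hle hn₀ (fun j => (Zb j).length) hsum (fun j hj => hbal hg j hj)
        have hlog : log.length ≤ ceilDiv n B + l := by
          have h5 := hpart.log_length hB
          have h6 := le_ceilDiv_mul n hB
          refine Nat.le_of_mul_le_mul_right (c := B) ?_ hB
          rw [add_mul]
          omega
        have hspl' : spl.length = ceilDiv (l - 1) B := by rw [hspa.1, hspl]
        rw [has.1, hspl']
        unfold nodeCost at e3
        rw [← hl] at e3
        set E := ceilDiv (min n (l * t)) B * (Nat.clog 2 (ceilDiv (min n (l * t)) B) + 1) with hE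
        set bl := ceilDiv (l - 1) B
        set b := ceilDiv n B
        set σ := ∑ j ∈ Finset.range l, Φ (Zb j).length
        constructor
        · have e4 : ((2 * E + bl + log.length + w : ℕ) : ℝ) ≤
              ((5 * E + bl + 2 * b + l : ℕ) : ℝ) + w := by
            have : 2 * E + bl + log.length + w ≤ 5 * E + bl + 2 * b + l + w := by omega
            exact_mod_cast this
          linarith
        · have e4 : ((b + 5 * E + k * (bl + b) + r : ℕ) : ℝ) ≤
              k * ((5 * E + bl + 2 * b + l : ℕ) : ℝ) + r := by
            have : b + 5 * E + k * (bl + b) + r ≤ k * (5 * E + bl + 2 * b + l) + r := by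
              have h7 : b + 5 * E ≤ k * (b + 5 * E) := Nat.le_mul_of_pos_left _ hk
              have h8 : k * (5 * E + bl + 2 * b + l) = k * (b + 5 * E) + k * (bl + b) + k * l := by
                ring
              omega
            exact_mod_cast this
          have hk' : (0 : ℝ) ≤ k := by positivity
          have e5 := mul_le_mul_of_nonneg_left e3 hk'
          rw [mul_add] at e5
          linarith
    · intro j hj f₃ s₃ hm₃ harr
      have h := hpart.1 j (Nat.zero_le _) hj
      rw [h.2]
      refine ih _ (Zb j) f₃ s₃ (fun hg => ?_) ?_ ?_ hm₃ harr
      -- Since `l ≥ 2`, a balanced bucket has at most `3 n / 4` records, so the remaining fuel still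
      -- bounds its size and the cut-off is harmless.
      · have h5 := hbal hg j hj
        have h6 := hfuel hg
        have h7 : 4 * (Zb j).length ≤ 2 * l * (Zb j).length := Nat.mul_le_mul_right _ (by omega)
        have h8 : 2 * l * (Zb j).length ≤ 3 * n := h5
        omega
      · exact (List.length_filter_le _ _).trans hn₀
      · exact hnd.sublist (List.filter_sublist.map key)
    · intro i j hij x hx y hy
      simp only [hZb, List.mem_filter, beq_iff_eq] at hx hy
      by_contra hc
      push Not at hc
      have : bucketOf key sp y ≤ bucketOf key sp x := List.countP_mono_left fun z _ hz => by
        simp only [decide_eq_true_eq] at hz ⊢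
        exact hz.trans hc.le
      omega

end Recursion
/-! ### The cost of the recursion -/

section Potential

/-- A bound on the depth of the recursion on a problem of size `n`, in terms of `y = n / (k M)`. -/
noncomputable def depthBound (K y : ℝ) : ℝ :=
  if y ≤ 1 then 0 else if y ≤ 9 / 8 then 1 else if y ≤ 3 / 2 then 2 else if y ≤ K then 3
  else 4 + 3 * Real.logb K (y / K)

theorem depthBound_nonneg {K y : ℝ} (hK : 2 ≤ K) : 0 ≤ depthBound K y := by
  unfold depthBound
  split_ifs with h1 h2 h3 h4 <;> norm_num
  have : 0 ≤ Real.logb K (y / K) := Real.logb_nonneg (by linarith) (by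
    rw [le_div_iff₀ (by linarith)]
    linarith)
  linarith

/-- For `y ≤ K` one has `l ≥ y`, so a child has `y' ≤ 3/2`; further factors `3/4` lead to `9/8` and
then below `1`, which explains the thresholds of `depthBound`. For `y > K` the value drops by the
factor `2K/3`. Three such steps gain at least a factor `K`, because `K ≥ 2` gives `K ^ 2 ≥ 27/8`;
this is the `3` in front of the logarithm. -/
theorem depthBound_child {K y l y' : ℝ} (hK : 2 ≤ K) (hy : 1 < y) (hy' : 2 * l * y' ≤ 3 * y)
    (hl : y ≤ K ∧ 2 ≤ l ∧ y ≤ l ∨ K < y ∧ l = K) :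
    depthBound K y' + 1 ≤ depthBound K y := by
  rcases hl with ⟨hyK, hl2, hyl⟩ | ⟨hyK, rfl⟩
  · have h1 : y' ≤ 3 / 2 := by
      by_contra! h
      nlinarith
    have h2 : y' ≤ 3 / 4 * y := by
      by_contra! h
      nlinarith
    unfold depthBound
    split_ifs <;> linarith
  · have h0 : depthBound l y = 4 + 3 * Real.logb l (y / l) := by
      unfold depthBound
      rw [if_neg, if_neg, if_neg, if_neg] <;> linarith
    have h1 : 0 ≤ Real.logb l (y / l) := Real.logb_nonneg (by linarith) (by
      rw [le_div_iff₀ (by linarith)]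
      linarith)
    rw [h0]
    by_cases hy'K : y' ≤ l
    · unfold depthBound
      split_ifs <;> linarith
    · push Not at hy'K
      have h2 : depthBound l y' = 4 + 3 * Real.logb l (y' / l) := by
        unfold depthBound
        rw [if_neg, if_neg, if_neg, if_neg] <;> linarith
      rw [h2]
      have h3 : Real.logb l (l * (y' / l) ^ 3) ≤ Real.logb l ((y / l) ^ 3) := by
        have hl0 : 0 < l := by linarith
        have hy0 : 0 < y' := by linarith
        apply Real.logb_le_logb_of_le (by linarith) (by positivity)
        have h4 : 4 / 3 * y' ≤ y := by nlinarith
        have h5 : y' / l ≤ 3 / 2 * (y / l) / l := by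
          rw [div_le_div_iff₀ (by linarith) (by linarith)]
          have : 3 / 2 * (y / l) * l = 3 / 2 * y := by field_simp
          rw [this]
          nlinarith
        have h6 : (y' / l) ^ 3 ≤ (3 / 2 * (y / l) / l) ^ 3 :=
          pow_le_pow_left₀ (div_nonneg (by linarith) (by linarith)) h5 3
        calc l * (y' / l) ^ 3 ≤ l * (3 / 2 * (y / l) / l) ^ 3 := by gcongr
          _ = 27 / 8 / l ^ 2 * (y / l) ^ 3 := by field_simp; norm_num
          _ ≤ 1 * (y / l) ^ 3 := by
            gcongr
            rw [div_le_one (by positivity)]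
            nlinarith
          _ = _ := one_mul _
      have hl0 : l ≠ 0 := by linarith
      have hy0 : y' / l ≠ 0 := by
        apply div_ne_zero <;> linarith
      rw [Real.logb_mul hl0 (pow_ne_zero _ hy0), Real.logb_self_eq_one (by linarith),
        Real.logb_pow, Real.logb_pow] at h3
      push_cast at h3
      linarith

/-- For `y = n / (K * B)` the number `y * K` is `n / B`, so the hypothesis compares `L` with the
logarithm in the theorem. The additive `4` is absorbed by `L ≥ 1`. -/
theorem depthBound_le {K y L : ℝ} (hK : 2 ≤ K) (hL : 1 ≤ L) (hy : Real.logb K (y * K) ≤ L) :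
    depthBound K y ≤ 7 * L := by
  unfold depthBound
  split_ifs with h1 h2 h3 h4 <;> try linarith
  have : Real.logb K (y / K) ≤ Real.logb K (y * K) := by
    apply Real.logb_le_logb_of_le (by linarith)
    · apply div_pos <;> linarith
    · rw [div_le_iff₀ (by linarith), mul_assoc]
      exact le_mul_of_one_le_right (by linarith) (by nlinarith)
  linarith

/-- A bound on the cost of sorting the samples, in terms of `y = n / (k M)`. -/
noncomputable def sampleBound (β y : ℝ) : ℝ := if y ≤ 1 then 0 else β * (2 - 1 / √y)

theorem sampleBound_nonneg {β y : ℝ} (hβ : 0 ≤ β) : 0 ≤ sampleBound β y := by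
  unfold sampleBound
  split_ifs with h
  · exact le_rfl
  · push Not at h
    have h1 : 1 ≤ √y := Real.one_le_sqrt.2 h.le
    have h2 : 1 / √y ≤ 1 := by rw [div_le_one (by linarith)]; exact h1
    apply mul_nonneg hβ
    linarith

theorem sampleBound_le {β y : ℝ} (hβ : 0 ≤ β) : sampleBound β y ≤ 2 * β := by
  unfold sampleBound
  split_ifs with h
  · linarith
  · have h2 : 0 ≤ 1 / √y := by positivity
    nlinarith

/-- A charge proportional to `1 / √y` grows geometrically towards the leaves, so it can be paid from
a bounded potential. A factor `3/4` in `y` raises `1 / √y` by at least `23/20`, as `(23/20) ^ 2 *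
(3/4) ≤ 1`, and the surplus `3/20` pays for the node. -/
theorem sampleBound_child {β y y' : ℝ} (hβ : 0 ≤ β) (hy : 1 < y) (hy' : 4 * y' ≤ 3 * y) :
    sampleBound β y' + β * (3 / 20) / √y ≤ sampleBound β y := by
  have hs : 1 ≤ √y := Real.one_le_sqrt.2 hy.le
  have h0 : sampleBound β y = β * (2 - 1 / √y) := by
    unfold sampleBound
    rw [if_neg (by linarith)]
  rw [h0, mul_div_assoc]
  unfold sampleBound
  split_ifs with h
  · have h1 : 1 / √y ≤ 1 := by rw [div_le_one (by linarith)]; exact hs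
    have h2 : 3 / 20 / √y = 3 / 20 * (1 / √y) := by ring
    rw [zero_add]
    apply mul_le_mul_of_nonneg_left _ hβ
    rw [h2]
    linarith
  · push Not at h
    have hs' : 1 ≤ √y' := Real.one_le_sqrt.2 h.le
    have h3 : 23 / 20 * √y' ≤ √y := by
      apply Real.le_sqrt_of_sq_le
      rw [mul_pow, Real.sq_sqrt (by linarith)]
      linarith
    have h4 : 23 / 20 / √y ≤ 1 / √y' := by
      rw [div_le_div_iff₀ (by linarith) (by linarith)]
      linarith
    have h5 : 23 / 20 / √y = 3 / 20 / √y + 1 / √y := by ring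
    rw [← mul_add]
    apply mul_le_mul_of_nonneg_left _ hβ
    linarith

/-- The bound on the number of writes of the recursion on a problem of size `n`. -/
noncomputable def writeBound (K B α β : ℝ) (n : ℕ) : ℝ :=
  n / B * (1 + (α * depthBound K (n / (K * B)) + sampleBound β (n / (K * B)))) + 1

theorem cast_ceilDiv_le {B : ℕ} (hB : 0 < B) (n : ℕ) : (ceilDiv n B : ℝ) ≤ n / B + 1 := by
  have h := ceilDiv_mul_lt n hB
  have hB' : (0 : ℝ) < B := by exact_mod_cast hB
  have h' : (ceilDiv n B : ℝ) * B ≤ n + B := by exact_mod_cast h.le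
  have : (ceilDiv n B : ℝ) ≤ (n + B) / B := by rwa [le_div_iff₀ hB']
  rwa [add_div, div_self hB'.ne'] at this

theorem ceilDiv_le_writeBound {B : ℕ} (hB : 0 < B) {K α β : ℝ} (hK : 2 ≤ K) (hα : 0 ≤ α)
    (hβ : 0 ≤ β) (n : ℕ) : (ceilDiv n B : ℝ) ≤ writeBound K B α β n := by
  refine (cast_ceilDiv_le hB n).trans ?_
  have h1 := mul_nonneg hα (depthBound_nonneg (y := (n : ℝ) / (K * B)) hK)
  have h2 := sampleBound_nonneg (y := (n : ℝ) / (K * B)) hβ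
  have h3 : (0 : ℝ) ≤ n / B := by positivity
  unfold writeBound
  nlinarith

/-- Passing to the children lowers the factor of `n / B` by at least the right-hand side of `hγ`.
The constant `7` collects the costs other than sorting samples: `2 * ceilDiv n B` is at most `4 n /
B`, while the splitters, the partial blocks of the buckets and the summands `1` of the children's
bounds contribute at most `l ≤ n / B` each. -/
theorem writeBound_node {k M B t n : ℕ} {α β : ℝ} (hB : 0 < B) (hBM : B ∣ M)
    (hK : 2 ≤ k * M / B) (hn : k * M < n) (hα : 0 ≤ α) (hβ : 0 ≤ β)
    (hγ : 7 + 5 * ((ceilDiv (min n (branching k M B n * t)) B *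
        (Nat.clog 2 (ceilDiv (min n (branching k M B n * t)) B) + 1) : ℕ) * B / n : ℝ) ≤
      α + β * (3 / 20) / √(n / (((k * M / B : ℕ) : ℝ) * B)))
    (g : ℕ → ℕ) (hg : ∑ j ∈ Finset.range (branching k M B n), g j = n)
    (hbal : ∀ j < branching k M B n, 2 * branching k M B n * g j ≤ 3 * n) :
    (nodeCost k M B t n : ℝ) + ∑ j ∈ Finset.range (branching k M B n),
      writeBound (k * M / B : ℕ) B α β (g j) ≤ writeBound (k * M / B : ℕ) B α β n := by
  obtain ⟨hl2, hlK, hln, -⟩ := branching_bounds hB hBM hK hn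
  have hKB : k * M / B * B = k * M := Nat.div_mul_cancel (hBM.mul_left k)
  have hl : n * B ≤ (k * M) ^ 2 ∧ n ≤ branching k M B n * (k * M) ∨
      (k * M) ^ 2 < n * B ∧ branching k M B n = k * M / B := by
    by_cases h : n * B ≤ (k * M) ^ 2
    · refine Or.inl ⟨h, ?_⟩
      rw [branching, if_pos h]
      refine le_ceilDiv_mul n ?_
      rw [← hKB]
      positivity
    · refine Or.inr ⟨not_le.1 h, ?_⟩
      rw [branching, if_neg h]
  set l := branching k M B n with hldef
  set E := ceilDiv (min n (l * t)) B * (Nat.clog 2 (ceilDiv (min n (l * t)) B) + 1) with hE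
  set K := k * M / B with hKdef
  rw [← hKB] at hl hln hn
  have hB' : (0 : ℝ) < B := by exact_mod_cast hB
  have hK' : (2 : ℝ) ≤ K := by exact_mod_cast hK
  have hl2' : (2 : ℝ) ≤ l := by exact_mod_cast hl2
  have hn' : (K * B : ℝ) < n := by exact_mod_cast hn
  have hKB0 : (0 : ℝ) < K * B := by positivity
  have hn0 : (0 : ℝ) < n := hKB0.trans hn'
  set y : ℝ := n / (K * B) with hy
  have hy1 : 1 < y := by rw [hy, one_lt_div hKB0]; exact hn'
  have hly : y ≤ K ∧ 2 ≤ (l : ℝ) ∧ y ≤ l ∨ K < y ∧ (l : ℝ) = K := by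
    rcases hl with ⟨h1, h2⟩ | ⟨h1, h2⟩
    · refine Or.inl ⟨?_, hl2', ?_⟩
      · rw [hy, div_le_iff₀ hKB0]
        have : (n * B : ℝ) ≤ (K * B) ^ 2 := by exact_mod_cast h1
        refine le_of_mul_le_mul_right (this.trans_eq ?_) hB'
        ring
      · rw [hy, div_le_iff₀ hKB0]
        exact_mod_cast h2
    · refine Or.inr ⟨?_, by exact_mod_cast h2⟩
      rw [hy, lt_div_iff₀ hKB0]
      have : ((K * B) ^ 2 : ℝ) < n * B := by exact_mod_cast h1
      refine lt_of_mul_lt_mul_right (lt_of_eq_of_lt ?_ this) hB'.le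
      ring
  set G : ℝ := α * depthBound K y + sampleBound β y with hG
  set γ : ℝ := α + β * (3 / 20) / √y with hγdef
  have hchild : ∀ j ∈ Finset.range l, writeBound K B α β (g j) ≤ g j * ((1 + (G - γ)) / B) + 1 := by
    intro j hj
    have h1 : (2 * l * g j : ℝ) ≤ 3 * n := by exact_mod_cast hbal j (Finset.mem_range.1 hj)
    have h2 : 2 * l * (g j / (K * B)) ≤ 3 * y := by
      rw [hy, ← mul_div_assoc, ← mul_div_assoc]
      gcongr
    have h2' : 4 * (g j / (K * B)) ≤ 3 * y := by
      refine le_trans ?_ h2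
      have : (0 : ℝ) ≤ g j / (K * B) := by positivity
      nlinarith
    have h3 := depthBound_child hK' hy1 h2 hly
    have h4 := sampleBound_child hβ hy1 h2'
    have h5 : (α * depthBound K (g j / (K * B)) + sampleBound β (g j / (K * B))) ≤ G - γ := by
      have := mul_le_mul_of_nonneg_left h3 hα
      rw [hG, hγdef]
      linarith
    unfold writeBound
    have h6 : (0 : ℝ) ≤ g j / B := by positivity
    have := mul_le_mul_of_nonneg_left h5 h6
    have h7 : (g j : ℝ) * ((1 + (G - γ)) / B) = g j / B + g j / B * (G - γ) := by ring
    rw [h7]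
    linarith
  have hsum := Finset.sum_le_sum hchild
  have hg' : ∑ j ∈ Finset.range l, (g j : ℝ) = n := by exact_mod_cast hg
  rw [Finset.sum_add_distrib, ← Finset.sum_mul, hg', Finset.sum_const, Finset.card_range,
    nsmul_eq_mul, mul_one] at hsum
  have hlB : (l : ℝ) ≤ n / B := by
    rw [le_div_iff₀ hB']
    have : (l * (K * B) : ℝ) ≤ 2 * n := by exact_mod_cast hln
    have h0 : (0 : ℝ) ≤ l * B := by positivity
    nlinarith
  have hc1 : (ceilDiv (l - 1) B : ℝ) ≤ l := by
    have h := ceilDiv_le_self (l - 1) hB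
    exact_mod_cast h.trans (Nat.sub_le _ _)
  have hc2 := cast_ceilDiv_le hB n
  have h1B : (1 : ℝ) ≤ n / B := by linarith
  have hE' : (E : ℝ) = E * B / n * (n / B) := by
    field_simp
  have hcost : (nodeCost k M B t n : ℝ) = 5 * E + ceilDiv (l - 1) B + 2 * ceilDiv n B + l := by
    unfold nodeCost
    push_cast [hE]
    rfl
  rw [hcost, hE']
  have h8 := mul_le_mul_of_nonneg_right hγ (by positivity : (0 : ℝ) ≤ n / B)
  have h9 : (n : ℝ) * ((1 + (G - γ)) / B) = n / B + n / B * G - γ * (n / B) := by ring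
  rw [h9] at hsum
  have h10 : writeBound K B α β n = n / B + n / B * G + 1 := by
    unfold writeBound
    rw [← hy, ← hG]
    ring
  rw [h10]
  linarith

end Potential
-- The cost of sorting the samples
section Potential

/-- A sample that fits into one block costs a single block, which is the summand `1`. A larger one
occupies at most twice `m / B` blocks, each treated at most `q` times. -/
theorem sampleCost_le {B m n : ℕ} {q : ℝ} (hB : 0 < B) (hBn : B ≤ n)
    (hq : (Nat.clog 2 (ceilDiv m B) + 1 : ℝ) ≤ q) :
    ((ceilDiv m B * (Nat.clog 2 (ceilDiv m B) + 1) : ℕ) * B / n : ℝ) ≤ 1 + 2 * (m / n) * q := by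
  have hB' : (0 : ℝ) < B := by exact_mod_cast hB
  have hBn' : (B : ℝ) ≤ n := by exact_mod_cast hBn
  have hn' : (0 : ℝ) < n := hB'.trans_le hBn'
  have hq0 : 0 ≤ q := le_trans (by positivity) hq
  by_cases hm : m ≤ B
  · have h1 : ceilDiv m B ≤ 1 := (ceilDiv_le_iff hB).2 (by omega)
    have h2 : Nat.clog 2 (ceilDiv m B) = 0 := Nat.clog_of_right_le_one h1 2
    rw [h2, zero_add, mul_one]
    have h3 : (ceilDiv m B : ℝ) ≤ 1 := by exact_mod_cast h1
    have h4 : (ceilDiv m B * B / n : ℝ) ≤ 1 := by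
      rw [div_le_one hn']
      nlinarith
    have h5 : 0 ≤ 2 * (m / n : ℝ) * q := by positivity
    linarith
  · push Not at hm
    have hm' : (B : ℝ) < m := by exact_mod_cast hm
    have h1 := cast_ceilDiv_le hB m
    have h2 : (1 : ℝ) ≤ m / B := by
      rw [le_div_iff₀ hB']
      linarith
    have h3 : (ceilDiv m B : ℝ) * B ≤ 2 * m := by
      have : (ceilDiv m B : ℝ) ≤ 2 * m / B := by
        rw [mul_div_assoc]
        linarith
      rwa [le_div_iff₀ hB'] at this
    push_cast
    have h4 : (ceilDiv m B * (Nat.clog 2 (ceilDiv m B) + 1) * B / n : ℝ) =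
        ceilDiv m B * B / n * (Nat.clog 2 (ceilDiv m B) + 1) := by ring
    rw [h4]
    calc (ceilDiv m B * B / n * (Nat.clog 2 (ceilDiv m B) + 1) : ℝ) ≤ 2 * m / n * q := by gcongr
      _ ≤ 1 + 2 * (m / n) * q := by
        rw [mul_div_assoc]
        linarith

/-- The sorting of the samples is cheap if `k M` is large. -/
theorem sampleCost_le_of_large {a K B l n n₀ : ℕ} (hB : 0 < B) (hK : 2 ≤ K) (hn : K * B < n)
    (hn₀ : n ≤ n₀) (hl : l * (K * B) ≤ 2 * n) (hlam : Nat.clog 2 n₀ ^ 2 ≤ K * B) :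
    ((ceilDiv (min n (l * (a * Nat.clog 2 n₀))) B *
        (Nat.clog 2 (ceilDiv (min n (l * (a * Nat.clog 2 n₀))) B) + 1) : ℕ) * B / n : ℝ) ≤
      1 + 8 * a := by
  have hKB : 2 ≤ K * B := hK.trans (Nat.le_mul_of_pos_right _ hB)
  have hBn : B ≤ n := (Nat.le_mul_of_pos_left _ (by omega)).trans hn.le
  set lam := Nat.clog 2 n₀ with hlamdef
  have h1 : 1 ≤ lam := Nat.clog_pos (by norm_num) (by omega)
  have h2 : Nat.clog 2 (ceilDiv (min n (l * (a * lam))) B) ≤ lam :=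
    Nat.clog_mono_right _ ((ceilDiv_le_self _ hB).trans ((min_le_left _ _).trans hn₀))
  refine (sampleCost_le (q := 2 * lam) hB hBn ?_).trans ?_
  · norm_cast
    omega
  · have hn' : (0 : ℝ) < n := by exact_mod_cast (by omega : 0 < n)
    have h3 : (min n (l * (a * lam)) : ℕ) * (K * B) ≤ 2 * n * (a * lam) := by
      refine (Nat.mul_le_mul_right _ (min_le_right _ _)).trans ?_
      calc l * (a * lam) * (K * B) = l * (K * B) * (a * lam) := by ring
        _ ≤ _ := Nat.mul_le_mul_right _ hl
    -- This is where `lam ^ 2 ≤ k M` enters. One factor `lam` cancels against the oversampling, the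
    -- other pays for the logarithm in the mergesort.
    have h4 : min n (l * (a * lam)) * (lam * lam) ≤ 2 * n * (a * lam) := by
      refine (Nat.mul_le_mul_left _ ?_).trans h3
      rwa [← sq]
    have h5 : min n (l * (a * lam)) * lam ≤ 2 * n * a := by
      refine Nat.le_of_mul_le_mul_right (c := lam) ?_ h1
      linarith
    have h6 : ((min n (l * (a * lam)) : ℕ) * lam : ℝ) ≤ 2 * n * a := by exact_mod_cast h5
    have h7 : ((min n (l * (a * lam)) : ℕ) : ℝ) / n * lam ≤ 2 * a := by
      rw [div_mul_eq_mul_div, div_le_iff₀ hn']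
      linarith
    linarith

/-- The cost of sorting the samples if `k M` is small. -/
theorem sampleCost_le_of_small {a K B l n lam : ℕ} (hB : 0 < B) (hK0 : 0 < K)
    (hn : K * B < n) (hlK : l ≤ K) (hlam : K * B < lam ^ 2) :
    ((ceilDiv (min n (l * (a * lam))) B *
        (Nat.clog 2 (ceilDiv (min n (l * (a * lam))) B) + 1) : ℕ) * B / n : ℝ) ≤
      1 + 2 * (√(a * lam) / √(n / (K * B))) * (Nat.clog 2 a + 3 * Nat.clog 2 lam + 1 : ℕ) := by
  have hBn : B ≤ n := (Nat.le_mul_of_pos_left _ hK0).trans hn.le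
  have hB' : (1 : ℝ) ≤ B := by exact_mod_cast hB
  have hK' : (1 : ℝ) ≤ K := by exact_mod_cast hK0
  have hn' : (0 : ℝ) < n := by exact_mod_cast (by omega : 0 < n)
  have hm : min n (l * (a * lam)) ≤ K * (a * lam) :=
    (min_le_right _ _).trans (Nat.mul_le_mul_right _ hlK)
  have h2 : Nat.clog 2 (ceilDiv (min n (l * (a * lam))) B) ≤ Nat.clog 2 a + 3 * Nat.clog 2 lam := by
    refine Nat.clog_le_of_le_pow ?_
    calc _ ≤ min n (l * (a * lam)) := ceilDiv_le_self _ hB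
      _ ≤ K * (a * lam) := hm
      _ ≤ lam ^ 2 * (a * lam) :=
        Nat.mul_le_mul_right _ ((Nat.le_mul_of_pos_right _ hB).trans hlam.le)
      _ = a * lam ^ 3 := by ring
      _ ≤ 2 ^ Nat.clog 2 a * (2 ^ Nat.clog 2 lam) ^ 3 :=
        Nat.mul_le_mul (Nat.le_pow_clog (by norm_num) _)
          (Nat.pow_le_pow_left (Nat.le_pow_clog (by norm_num) _) 3)
      _ = _ := by rw [← pow_mul, ← pow_add, mul_comm 3]
  refine (sampleCost_le hB hBn (q := (Nat.clog 2 a + 3 * Nat.clog 2 lam + 1 : ℕ)) ?_).trans ?_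
  · norm_cast
    omega
  · have h5 : ((min n (l * (a * lam)) : ℕ) : ℝ) / n ≤ √(a * lam) / √(n / (K * B)) := by
      rw [← Real.sqrt_div' _ (by positivity)]
      apply Real.le_sqrt_of_sq_le
      have h3 : ((min n (l * (a * lam)) : ℕ) : ℝ) / n ≤ 1 := by
        rw [div_le_one hn']
        exact_mod_cast min_le_left _ _
      have h4 : (0 : ℝ) ≤ (min n (l * (a * lam)) : ℕ) / n := by positivity
      calc (((min n (l * (a * lam)) : ℕ) : ℝ) / n) ^ 2 ≤ (min n (l * (a * lam)) : ℕ) / n := by nlinarith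
        _ ≤ K * (a * lam) / n := by
          gcongr
          exact_mod_cast hm
        _ ≤ K * (a * lam) / n * B := le_mul_of_one_le_right (by positivity) hB'
        _ = _ := by
          field_simp
    gcongr

theorem pow_four_le_two_pow (u : ℕ) : u ^ 4 ≤ 32 * 2 ^ u := by
  rcases Nat.lt_or_ge u 6 with h | h
  · interval_cases u <;> norm_num
  · induction u, h using Nat.le_induction with
    | base => norm_num
    | succ u hu ih =>
      have h1 : (u + 1) ^ 4 ≤ 2 * u ^ 4 := by
        have h2 : 6 * (u + 1) ≤ 7 * u := by omega
        have h3 := Nat.pow_le_pow_left h2 4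
        rw [mul_pow, mul_pow] at h3
        omega
      rw [pow_succ 2]
      omega

/-- If `k M` is small, then the number of levels of the recursion is large. -/
theorem clog_le_of_small {K B n L : ℕ} (hB : 0 < B) (hK : 2 ≤ K) (hL : 1 ≤ L) (hn : n ≤ B * K ^ L)
    (hlam : K * B < Nat.clog 2 n ^ 2) :
    Nat.clog 2 (Nat.clog 2 n) * √(Nat.clog 2 n : ℝ) ≤ 32 * L := by
  set lam := Nat.clog 2 n with hlamdef
  set u := Nat.clog 2 lam with hu
  have hKB : 2 ≤ K * B := hK.trans (Nat.le_mul_of_pos_right _ hB)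
  have hlam2 : 1 < lam := by
    by_contra! h
    have := Nat.pow_le_pow_left h 2
    omega
  have hK2 : K ≤ lam ^ 2 := (Nat.le_mul_of_pos_right _ hB).trans hlam.le
  have hB2 : B ≤ lam ^ 2 := (Nat.le_mul_of_pos_left _ (by omega)).trans hlam.le
  -- Both `B` and `K` are at most `lam ^ 2 ≤ 2 ^ (2 * u)`, so `L` must be large for `B * K ^ L` to
  -- reach `n`.
  have h1 : lam ≤ 2 * u * (L + 1) := by
    refine Nat.clog_le_of_le_pow (hn.trans ?_)
    calc B * K ^ L ≤ lam ^ 2 * (lam ^ 2) ^ L := Nat.mul_le_mul hB2 (Nat.pow_le_pow_left hK2 _)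
      _ = lam ^ (2 * (L + 1)) := by ring
      _ ≤ (2 ^ u) ^ (2 * (L + 1)) := Nat.pow_le_pow_left (Nat.le_pow_clog (by norm_num) _) _
      _ = 2 ^ (2 * u * (L + 1)) := by
        rw [← pow_mul]
        ring
  have h2 : lam ≤ 4 * u * L := by nlinarith
  -- As `2 ^ (u - 1) < lam`, this is `pow_four_le_two_pow`. It gives `u ^ 2 ≤ 8 √lam`, the estimate
  -- that turns `lam ≤ 4 u L` into the claim.
  have h3 : u ^ 4 ≤ 64 * lam := by
    have h4 := Nat.pow_pred_clog_lt_self (b := 2) (by norm_num) hlam2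
    have h5 : 1 ≤ u := Nat.clog_pos (by norm_num) hlam2
    have h6 := pow_four_le_two_pow u
    obtain ⟨v, hv⟩ := Nat.exists_eq_add_of_le' h5
    rw [← hu, hv] at h4
    rw [hv] at h6 ⊢
    rw [pow_succ 2] at h6
    simp only [Nat.pred_succ] at h4
    omega
  have hlam0 : (0 : ℝ) < lam := by exact_mod_cast (by omega : 0 < lam)
  have hs0 : 0 < √(lam : ℝ) := Real.sqrt_pos.2 hlam0
  have h4 : (u : ℝ) ^ 2 ≤ 8 * √(lam : ℝ) := by
    have h5 : ((u : ℝ) ^ 2) ^ 2 ≤ (8 * √(lam : ℝ)) ^ 2 := by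
      rw [mul_pow, Real.sq_sqrt hlam0.le, ← pow_mul]
      norm_num
      exact_mod_cast h3
    exact le_of_sq_le_sq h5 (by positivity)
  have h6 : (lam : ℝ) ≤ 4 * u * L := by exact_mod_cast h2
  refine le_of_mul_le_mul_right ?_ hs0
  rw [mul_assoc, Real.mul_self_sqrt hlam0.le]
  calc (u * lam : ℝ) ≤ u * (4 * u * L) := by gcongr
    _ = 4 * u ^ 2 * L := by ring
    _ ≤ 4 * (8 * √(lam : ℝ)) * L := by gcongr
    _ = _ := by ring

end Potential
-- The choice of the potential
section Potential

theorem one_le_ceil_logb {B K n : ℕ} (hB : 0 < B) (hK : 2 ≤ K) (hn : B < n) :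
    1 ≤ ⌈Real.logb K (n / B)⌉₊ := by
  rw [Nat.one_le_ceil_iff]
  have hB' : (0 : ℝ) < B := by exact_mod_cast hB
  refine Real.logb_pos (by exact_mod_cast hK) ?_
  rw [one_lt_div hB']
  exact_mod_cast hn

theorem le_mul_pow_ceil_logb {B K n : ℕ} (hB : 0 < B) (hK : 2 ≤ K) (hn : B < n) :
    n ≤ B * K ^ ⌈Real.logb K (n / B)⌉₊ := by
  have hB' : (0 : ℝ) < B := by exact_mod_cast hB
  have hn' : (0 : ℝ) < n := by exact_mod_cast hB.trans hn
  have hK' : (1 : ℝ) < K := by exact_mod_cast hK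
  have h := (Real.logb_le_iff_le_rpow hK' (by positivity)).1 (Nat.le_ceil (Real.logb K (n / B)))
  rw [Real.rpow_natCast, div_le_iff₀' hB'] at h
  exact_mod_cast h

theorem writeBound_le {K B n : ℕ} {α β γ : ℝ} (hB : 0 < B) (hK : 2 ≤ K) (hn : B < n)
    (hα : 0 ≤ α) (hβ : 0 ≤ β) (hγ : β ≤ γ * ⌈Real.logb K (n / B)⌉₊) :
    writeBound K B α β n ≤ (2 + 7 * α + 2 * γ) * (n / B * ⌈Real.logb K (n / B)⌉₊) := by
  have hB' : (0 : ℝ) < B := by exact_mod_cast hB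
  have hK' : (2 : ℝ) ≤ K := by exact_mod_cast hK
  have hn' : (B : ℝ) < n := by exact_mod_cast hn
  have hL : (1 : ℝ) ≤ ⌈Real.logb K (n / B)⌉₊ := by exact_mod_cast one_le_ceil_logb hB hK hn
  have h1 : (1 : ℝ) ≤ n / B := by rw [one_le_div hB']; exact hn'.le
  have h2 : depthBound K (n / (K * B)) ≤ 7 * ⌈Real.logb K (n / B)⌉₊ := by
    refine depthBound_le hK' hL ?_
    have h3 : (n / (K * B) * K : ℝ) = n / B := by field_simp
    rw [h3]
    exact Nat.le_ceil _
  have h3 := sampleBound_le (y := (n : ℝ) / (K * B)) hβ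
  have h4 := mul_le_mul_of_nonneg_left h2 hα
  unfold writeBound
  set L : ℝ := Nat.cast ⌈Real.logb K (n / B)⌉₊
  calc (n / B * (1 + (α * depthBound K (n / (K * B)) + sampleBound β (n / (K * B)))) + 1 : ℝ)
      ≤ n / B * (1 + (α * (7 * L) + 2 * (γ * L))) + n / B := by
        gcongr
        exact h3.trans (by linarith)
    _ = n / B * (2 + (7 * α + 2 * γ) * L) := by ring
    _ ≤ n / B * (2 * L + (7 * α + 2 * γ) * L) := by gcongr; linarith
    _ = _ := by ring

/-- The factor `12 + 40 a = 7 + 5 (1 + 8 a)` pays at every level for a node whose sample is cheap,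
and `β = 0` then suffices. For small `k M` the excess is `10 q √(a lam) / √y`, so `β` is `10 /
(3/20) = 200/3` times `q √(a lam)`; by `clog_le_of_small` this is at most `γ` times the number of
levels. -/
theorem exists_writeBound (a : ℕ) : ∃ C : ℝ, ∀ k M B n₀ : ℕ, 0 < B → B ∣ M → 2 ≤ k * M / B →
    B < n₀ → ∃ Φ : ℕ → ℝ, (∀ n, (ceilDiv n B : ℝ) ≤ Φ n) ∧
      (∀ n, k * M < n → n ≤ n₀ → ∀ g : ℕ → ℕ, ∑ j ∈ Finset.range (branching k M B n), g j = n →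
        (∀ j < branching k M B n, 2 * branching k M B n * g j ≤ 3 * n) →
        (nodeCost k M B (a * Nat.clog 2 n₀) n : ℝ) +
          ∑ j ∈ Finset.range (branching k M B n), Φ (g j) ≤ Φ n) ∧
      Φ n₀ ≤ C * (n₀ / B * ⌈Real.logb (k * M / B : ℕ) (n₀ / B)⌉₊) := by
  set γ : ℝ := 200 / 3 * ((Nat.clog 2 a + 4) * √a * 32) with hγ
  refine ⟨2 + 7 * (12 + 40 * a) + 2 * γ, fun k M B n₀ hB hBM hK hn₀ => ?_⟩
  have hL := one_le_ceil_logb hB hK hn₀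
  have hnL := le_mul_pow_ceil_logb hB hK hn₀
  have hKB : k * M / B * B = k * M := Nat.div_mul_cancel (hBM.mul_left k)
  set L := ⌈Real.logb (k * M / B : ℕ) (n₀ / B)⌉₊ with hLdef
  set K := k * M / B with hKdef
  set lam := Nat.clog 2 n₀ with hlam
  have hα : (0 : ℝ) ≤ 12 + 40 * a := by positivity
  have hK' : (2 : ℝ) ≤ K := by exact_mod_cast hK
  rcases Nat.lt_or_ge (K * B) (lam ^ 2) with hsmall | hlarge
  · set q : ℕ := Nat.clog 2 a + 3 * Nat.clog 2 lam + 1 with hq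
    have hβ : (0 : ℝ) ≤ 200 / 3 * (q * √(a * lam)) := by positivity
    refine ⟨writeBound K B (12 + 40 * a) (200 / 3 * (q * √(a * lam))),
      ceilDiv_le_writeBound hB hK' hα hβ, fun n hn _ g hg hbal => ?_,
      writeBound_le hB hK hn₀ hα hβ ?_⟩
    · refine writeBound_node hB hBM hK hn hα hβ ?_ g hg hbal
      have hlK := (branching_bounds hB hBM hK hn).2.1
      rw [← hKB] at hn
      have h := sampleCost_le_of_small (a := a) hB (by omega) hn hlK hsmall
      have h2 : 200 / 3 * (q * √(a * lam)) * (3 / 20) / √(n / (K * B)) =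
        5 * (2 * (√(a * lam) / √(n / (K * B))) * q) := by ring
      rw [h2]
      have h3 : (0 : ℝ) ≤ a := by positivity
      linarith
    · have h := clog_le_of_small hB hK hL hnL hsmall
      have h1 : 1 ≤ Nat.clog 2 lam := by
        refine Nat.clog_pos (by norm_num) ?_
        by_contra! h
        have := Nat.pow_le_pow_left h 2
        have : 2 ≤ K * B := hK.trans (Nat.le_mul_of_pos_right _ hB)
        omega
      have h2 : q ≤ (Nat.clog 2 a + 4) * Nat.clog 2 lam := by nlinarith
      have h2' : (q : ℝ) ≤ (Nat.clog 2 a + 4) * Nat.clog 2 lam := by exact_mod_cast h2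
      rw [hγ, Real.sqrt_mul (by positivity)]
      calc (200 / 3 * (q * (√a * √lam)) : ℝ)
          ≤ 200 / 3 * ((Nat.clog 2 a + 4) * Nat.clog 2 lam * (√a * √lam)) := by gcongr
        _ = 200 / 3 * ((Nat.clog 2 a + 4) * √a * (Nat.clog 2 lam * √lam)) := by ring
        _ ≤ 200 / 3 * ((Nat.clog 2 a + 4) * √a * (32 * L)) := by gcongr
        _ = _ := by ring
  · refine ⟨writeBound K B (12 + 40 * a) 0, ceilDiv_le_writeBound hB hK' hα le_rfl,
      fun n hn hn' g hg hbal => ?_, writeBound_le hB hK hn₀ hα le_rfl (by positivity)⟩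
    refine writeBound_node hB hBM hK hn hα le_rfl ?_ g hg hbal
    have hln := (branching_bounds hB hBM hK hn).2.2.1
    rw [← hKB] at hn hln
    have h := sampleCost_le_of_large (a := a) hB hK hn hn' hln hlarge
    rw [zero_mul, zero_div, add_zero]
    linarith

end Potential
/-! ### The sample sort -/

section SampleSort

variable {ρ κ : Type*} [LinearOrder κ] {key : ρ → κ} {B S : ℕ}

theorem Hoare.run' {β : Type} {ε : ENNReal} {p : Code β} {f : ℕ} {s : State ρ}
    {Q : β → ℕ → State ρ → Prop} (h : Hoare key B S ε p f s Q) :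
    (exec key B S (StateT.run' p f) s).toOuterMeasure
      {r | ¬ ∃ b s', r = some (b, s') ∧ ∃ f', Q b f' s'} ≤ ε := by
  have e : StateT.run' p f = (p f).bind fun r => Prog.done r.1 := rfl
  rw [e, exec_bind, ← add_zero ε]
  refine toOuterMeasure_bind_le _ _ _ _ _ _ h ?_
  intro r _ hn
  simp only [Set.mem_ofPred_eq, not_not] at hn
  obtain ⟨b, f', s', rfl, hQ⟩ := hn
  refine le_of_eq ?_
  rw [PMF.toOuterMeasure_apply_eq_zero_iff, Set.disjoint_left]
  intro r hr hn
  have hr' : r ∈ (PMF.pure (some (b, s'))).support := hr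
  rw [PMF.mem_support_pure_iff] at hr'
  exact hn ⟨b, s', hr', f', hQ⟩

theorem one_sub_le_toOuterMeasure {α : Type*} (p : PMF α) (A A' : Set α) {ε ε' : ENNReal}
    (h : p.toOuterMeasure {r | ¬ r ∈ A} ≤ ε) (hA : A ⊆ A') (hε : ε ≤ ε') :
    1 - ε' ≤ p.toOuterMeasure A' := by
  rw [tsub_le_iff_right]
  calc 1 = p.toOuterMeasure Set.univ :=
        ((p.toOuterMeasure_apply_eq_one_iff _).2 (Set.subset_univ _)).symm
    _ ≤ p.toOuterMeasure (A ∪ {r | ¬ r ∈ A}) :=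
        MeasureTheory.measure_mono fun r _ => (em (r ∈ A)).imp id id
    _ ≤ p.toOuterMeasure A + p.toOuterMeasure {r | ¬ r ∈ A} := MeasureTheory.measure_union_le _ _
    _ ≤ _ := add_le_add (MeasureTheory.measure_mono hA) (h.trans hε)

theorem isArray_initial (input : List ρ) :
    IsArray B (initial B input).ext (ceilDiv input.length B)
      (List.range (ceilDiv input.length B)) input := by
  refine ⟨by simp, by simp, fun i hi => ?_⟩
  simp [initial]

theorem IsArray.storedAt {ext : ℕ → List ρ} {f f' : ℕ} {xs : List ρ} (hB : 0 < B)
    (h : IsArray B ext f' (List.range' f (ceilDiv xs.length B)) xs) : StoredAt B ext f xs := by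
  intro i hi
  have h1 : i < (List.range' f (ceilDiv xs.length B)).length := by
    rw [List.length_range']
    exact (lt_ceilDiv_iff hB).2 hi
  have h2 := h.2.2 i h1
  rwa [List.getElem_range', one_mul] at h2

/-- The factors `2` account for the final copy. It reads each block of the recursive output, of
which there are at most as many as writes made, and writes `ceilDiv n B` blocks; either number is at
most `Φ n`. -/
theorem sampleSort_spec {a k M n : ℕ} (hB : 0 < B) (hBM : B ∣ M) (hK : 2 ≤ k * M / B)
    (ht : 10 ≤ a * Nat.clog 2 n) (good : Prop) (ε : ENNReal)
    (hε : good → ENNReal.ofReal (0.95 ^ (a * Nat.clog 2 n)) ≤ ε) (Φ : ℕ → ℝ)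
    (hleaf : good → ∀ m, (ceilDiv m B : ℝ) ≤ Φ m)
    (hnode : good → ∀ m, k * M < m → m ≤ n → ∀ g : ℕ → ℕ,
      ∑ j ∈ Finset.range (branching k M B m), g j = m →
      (∀ j < branching k M B m, 2 * branching k M B m * g j ≤ 3 * m) →
      (nodeCost k M B (a * Nat.clog 2 n) m : ℝ) +
        ∑ j ∈ Finset.range (branching k M B m), Φ (g j) ≤ Φ m)
    (input : List ρ) (hn : input.length = n) (hnd : (input.map key).Nodup) :
    (exec key B (M + B + M / B) (sampleSort a k M B n) (initial B input)).toOuterMeasure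
      {r | ¬ ∃ start s, r = some (start, s) ∧ (∃ sorted : List ρ, sorted.Perm input ∧
        sorted.Pairwise (fun x y => key x ≤ key y) ∧ StoredAt B s.ext start sorted) ∧
        (good → (s.reads : ℝ) ≤ 2 * (k * Φ n) ∧ (s.writes : ℝ) ≤ 2 * Φ n)} ≤ n * n * ε := by
  have hkM : 0 < k * M := by
    rcases Nat.eq_zero_or_pos (k * M) with h | h
    · rw [h] at hK
      simp at hK
    · exact h
  have hM : 0 < M := Nat.pos_of_mul_pos_left hkM
  have hk : 0 < k := Nat.pos_of_mul_pos_right hkM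
  have hBM' : B ≤ M := Nat.le_of_dvd hM hBM
  have hMB : 1 ≤ M / B := Nat.div_pos hBM' hB
  have key_spec : Hoare key B (M + B + M / B) (n * n * ε)
      (sampleSortRec a k M B n n (List.range (ceilDiv n B)) n >>= fun blocks =>
        get >>= fun start => compact B blocks >>= fun _ => pure start)
      (ceilDiv n B) (initial B input) fun start _ s => (∃ sorted : List ρ, sorted.Perm input ∧
        sorted.Pairwise (fun x y => key x ≤ key y) ∧ StoredAt B s.ext start sorted) ∧
        (good → (s.reads : ℝ) ≤ 2 * (k * Φ n) ∧ (s.writes : ℝ) ≤ 2 * Φ n) := by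
    have h1 := sampleSortRec_spec (key := key) (S := M + B + M / B) hB hBM hK (by omega) ht good ε
      hε Φ (fun hg m _ => hleaf hg m) hnode n (List.range (ceilDiv n B)) input (ceilDiv n B)
      (initial B input) (fun _ => hn.le) hn.le hnd rfl (by subst hn; exact isArray_initial input)
    rw [hn] at h1
    rw [← add_zero (n * n * ε : ENNReal)]
    refine h1.bind' ?_
    rintro blocks f s ⟨hp, hs, hlt, hlen, hm, r, w, hst, hbw, hcost⟩
    change Hoare key B _ 0 (compact B blocks >>= fun _ => pure f) f s _
    refine (compact_spec hB (by omega) blocks f s hm hlt hlen).bind ?_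
    rintro out f' s' ⟨rfl, harr, -, hst'⟩
    refine Hoare.ret ⟨⟨_, hp, hs, harr.storedAt hB⟩, fun hg => ?_⟩
    obtain ⟨hw, hr⟩ := hcost hg
    have h2 := (hst.trans hst').2.2
    rw [List.length_range', hp.length_eq, hn] at h2
    have h3 : (s'.reads : ℝ) ≤ r + blocks.length := by
      have : s'.reads ≤ r + blocks.length := by simpa [initial] using h2.1
      exact_mod_cast this
    have h4 : (s'.writes : ℝ) ≤ w + ceilDiv n B := by
      have : s'.writes ≤ w + ceilDiv n B := by simpa [initial] using h2.2
      exact_mod_cast this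
    have h5 := hleaf hg n
    have h6 : (blocks.length : ℝ) ≤ w := by exact_mod_cast hbw
    have h7 : (1 : ℝ) ≤ k := by exact_mod_cast hk
    have h8 : (0 : ℝ) ≤ Φ n := le_trans (by positivity) h5
    have h9 : Φ n ≤ k * Φ n := le_mul_of_one_le_left h8 h7
    constructor <;> linarith
  refine le_trans (MeasureTheory.measure_mono ?_) key_spec.run'
  rintro r hr ⟨b, s', rfl, f', h⟩
  exact hr ⟨b, s', rfl, h⟩

/-- Since `2 ^ Nat.clog 2 n ≥ n`, the tail is at most `n ^ (-N)`. Two of the powers of `n` are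
consumed by the factor `n * n`. -/
theorem failure_le {c : ℝ} {N a n : ℕ} (hN : c + 2 ≤ N) (ha : (0.95 : ℝ) ^ a ≤ (1 / 2) ^ N)
    (hn : 1 ≤ n) :
    (n * n * ENNReal.ofReal (0.95 ^ (a * Nat.clog 2 n)) : ENNReal) ≤
      ENNReal.ofReal ((n : ℝ) ^ (-c)) := by
  have hn' : (1 : ℝ) ≤ n := by exact_mod_cast hn
  have h1 : (0.95 : ℝ) ^ (a * Nat.clog 2 n) ≤ (n : ℝ) ^ (-(N : ℝ)) := by
    have h2 : (n : ℝ) ≤ 2 ^ Nat.clog 2 n := by exact_mod_cast Nat.le_pow_clog (by norm_num) n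
    calc (0.95 : ℝ) ^ (a * Nat.clog 2 n) = (0.95 ^ a) ^ Nat.clog 2 n := pow_mul _ _ _
      _ ≤ ((1 / 2) ^ N) ^ Nat.clog 2 n := pow_le_pow_left₀ (by positivity) ha _
      _ = ((2 ^ Nat.clog 2 n) ^ N)⁻¹ := by
        rw [← pow_mul, ← pow_mul, one_div, inv_pow, mul_comm]
      _ ≤ ((n : ℝ) ^ N)⁻¹ := by gcongr
      _ = _ := by rw [Real.rpow_neg (by positivity), Real.rpow_natCast]
  have h3 : (n * n * ENNReal.ofReal (0.95 ^ (a * Nat.clog 2 n)) : ENNReal) =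
      ENNReal.ofReal (n * n * 0.95 ^ (a * Nat.clog 2 n)) := by
    rw [ENNReal.ofReal_mul (by positivity), ENNReal.ofReal_mul (by positivity),
      ENNReal.ofReal_natCast]
  rw [h3]
  apply ENNReal.ofReal_le_ofReal
  calc (n * n * 0.95 ^ (a * Nat.clog 2 n) : ℝ) ≤ n * n * (n : ℝ) ^ (-(N : ℝ)) := by gcongr
    _ = (n : ℝ) ^ (2 + -(N : ℝ)) := by
      rw [Real.rpow_add (by positivity), Real.rpow_two, sq]
    _ ≤ _ := Real.rpow_le_rpow_of_exponent_le hn' (by linarith)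

end SampleSort
end AEM

/-! ### The theorem -/

theorem mainTheorem3 (c : ℝ) :
    ∃ a₀ : ℕ, ∀ a : ℕ, a₀ ≤ a → ∃ C : ℝ,
      ∀ k M B n : ℕ, 1 ≤ B → B ∣ M → 2 ≤ k * M / B → B < n →
      ∀ (ρ : Type*) (κ : Type*) [LinearOrder κ] (key : ρ → κ) (input : List ρ),
        input.length = n → (input.map key).Nodup →
        -- on every run, the program stays within primary memory `M + B + M/B` and sorts
        (∀ r ∈ (AEM.exec key B (M + B + M / B) (AEM.sampleSort a k M B n)
            (AEM.initial B input)).support,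
          ∃ (start : ℕ) (s : AEM.State ρ) (sorted : List ρ), r = some (start, s) ∧
            sorted.Perm input ∧ sorted.Pairwise (fun x y => key x ≤ key y) ∧
            AEM.StoredAt B s.ext start sorted) ∧
        -- the bounds on the reads and the writes hold with probability at least `1 - n ^ (-c)`
        1 - ENNReal.ofReal ((n : ℝ) ^ (-c)) ≤
          (AEM.exec key B (M + B + M / B) (AEM.sampleSort a k M B n)
            (AEM.initial B input)).toOuterMeasure
          {r | ∃ (start : ℕ) (s : AEM.State ρ), r = some (start, s) ∧
            (s.reads : ℝ) ≤
              C * ((k * n / B : ℝ) * ⌈Real.logb (k * M / B : ℝ) (n / B : ℝ)⌉) ∧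
            (s.writes : ℝ) ≤
              C * ((n / B : ℝ) * ⌈Real.logb (k * M / B : ℝ) (n / B : ℝ)⌉)} := by
  obtain ⟨N, hN⟩ := exists_nat_ge (c + 2)
  obtain ⟨m, hm⟩ := exists_pow_lt_of_lt_one (show (0 : ℝ) < (1 / 2) ^ N by positivity)
    (show (0.95 : ℝ) < 1 by norm_num)
  -- The bound `m` makes `0.95 ^ a` at most `2 ^ (-N)`. The bound `10` gives at least ten samples
  -- per bucket, since `n ≥ 2` makes the logarithm at least `1`.
  refine ⟨max m 10, fun a ha => ?_⟩
  obtain ⟨C, hC⟩ := AEM.exists_writeBound a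
  refine ⟨2 * C, fun k M B n hB hBM hK hBn ρ κ _ key input hn hnd => ?_⟩
  have ht : 10 ≤ a * Nat.clog 2 n :=
    (le_max_right m 10).trans (ha.trans
      (Nat.le_mul_of_pos_right _ (Nat.clog_pos (by norm_num) (by omega))))
  constructor
  -- With `good := False` all cost hypotheses are void and `ε = 0` is allowed. The failure event
  -- then has measure zero, hence contains no possible outcome.
  · have h := AEM.sampleSort_spec (key := key) hB hBM hK ht False 0 (fun h => h.elim)
      (fun _ => 0) (fun h => h.elim) (fun h => h.elim) input hn hnd
    have h' := le_antisymm (h.trans_eq (mul_zero _)) zero_le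
    rw [PMF.toOuterMeasure_apply_eq_zero_iff, Set.disjoint_left] at h'
    intro r hr
    by_contra hc
    refine h' hr ?_
    rintro ⟨start, s, hrs, ⟨sorted, h1, h2, h3⟩, -⟩
    exact hc ⟨start, s, sorted, hrs, h1, h2, h3⟩
  · obtain ⟨Φ, hleaf, hnode, hΦ⟩ := hC k M B n hB hBM hK hBn
    refine AEM.one_sub_le_toOuterMeasure _ _ _ (AEM.sampleSort_spec (key := key) hB hBM hK ht True _
      (fun _ => le_rfl) Φ (fun _ => hleaf) (fun _ => hnode) input hn hnd) ?_
      (AEM.failure_le hN ((pow_le_pow_of_le_one (by norm_num) (by norm_num)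
        ((le_max_left m 10).trans ha)).trans hm.le) (by omega))
    rintro r ⟨start, s, hrs, -, hcost⟩
    obtain ⟨hr, hw⟩ := hcost trivial
    have hB' : (B : ℝ) ≠ 0 := by exact_mod_cast (by omega : B ≠ 0)
    have hKcast : ((k * M / B : ℕ) : ℝ) = k * M / B := by
      rw [Nat.cast_div (hBM.mul_left k) hB', Nat.cast_mul]
    have hL := AEM.one_le_ceil_logb hB hK hBn
    have hL0 := (Nat.one_le_ceil_iff.1 hL).le
    -- The logarithm is nonnegative because `B < n`, so the natural and the integer ceiling agree;
    -- the quotient `k M / B` is exact because `B ∣ M`.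
    rw [natCast_ceil_eq_intCast_ceil hL0, hKcast] at hΦ
    refine ⟨start, s, hrs, ?_, ?_⟩
    · refine hr.trans ?_
      have h1 := mul_le_mul_of_nonneg_left hΦ (Nat.cast_nonneg (α := ℝ) k)
      refine (mul_le_mul_of_nonneg_left h1 (by norm_num)).trans_eq ?_
      ring
    · refine hw.trans ?_
      linarith
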